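/- \textbf{Conventions.} All algebras are over $\mathbb C$; $\Lambda=\mathbb Z\sigma_1\oplus\mathbb Z\sigma_2$ is free abelian of rank $2$. A $\Lambda$-Jordan torus $\mathcal J$ is a unital Jordan algebra with a homogeneous basis $x^\lambda$ ($\lambda\in\operatorname{supp}\mathcal J\subseteq\Lambda$), $x^0=1$, such that $\operatorname{supp}\mathcal J$ generates $\Lambda$; put $x^\lambda=0$ for $\lambda\notin\operatorname{supp}\mathcal J$, and let $L_a$ be multiplication by $a$. We consider three families. (a) $\mathcal J_S$: here $S\subseteq\Lambda$ is a semilattice, i.e. $0\in S$, $S+2\Lambda\subseteq S$, $\langle S\rangle=\Lambda$. The basis is $x^\sigma$, $\sigma\in S$, and $x^\sigma\cdot x^\tau=x^{\sigma+\tau}$ if $\sigma\in2\Lambda$, or $\tau\in2\Lambda$, or $\sigma-\tau\in2\Lambda$, and $x^\sigma\cdot x^\tau=0$ otherwise. (b) $\mathbb C_q^+$, $q\in\mathbb C^\times$: here $\mathbb C_q$ is the quantum torus, the associative algebra generated by $x_1^{\pm1},x_2^{\pm1}$ with $x_2x_1=q\,x_1x_2$; its basis is $x^\lambda=x_1^{\lambda_1}x_2^{\lambda_2}$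 and $x^\lambda x^\mu=\eta(\lambda,\mu)x^{\lambda+\mu}$ with $\eta(\lambda,\mu)=q^{\lambda_2\mu_1}$. $\mathbb C_q^+$ is the same space with the product $a\cdot b=\frac12(ab+ba)$. Put $f(\lambda,\mu)=\eta(\lambda,\mu)\eta(\mu,\lambda)^{-1}$ and $\operatorname{rad}(f)=\{\lambda\mid f(\lambda,\mu)=1\ \text{for all}\ \mu\in\Lambda\}$, and $r_\sigma(a)=ax^\sigma$ for $a\in\mathbb C_q$. (c) $H(\mathbb C_{\bf e},-)$: here $\mathbb C_{\bf e}=\mathbb C_q$ with $q=\varepsilon\in\{1,-1\}$, $-$ is the involution with $\overline{x_1}=x_1$, $\overline{x_2}=x_2$ (so it is the identity iff $\varepsilon=1$), and $H(\mathbb C_{\bf e},-)=\{a\mid\bar a=a\}$, a Jordan subalgebra of $\mathbb C_{\bf e}^+$. \textbf{The Lie algebra.} Let $\operatorname{Inder}$ be the span of all $[L_a,L_b]$, $\operatorname{Instrl}(\mathcal J)=L_{\mathcal J}\oplus\operatorname{Inder}$, $\overline{L_a+D}=-L_a+D$, and $\mathfrak g=\mathrm{TKK}(\mathcal J)=\mathcal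 J\oplus\operatorname{Instrl}(\mathcal J)\oplus\bar{\mathcal J}$ with $$[a_1+T_1+\bar b_1,\,a_2+T_2+\bar b_2]=(T_1a_2-T_2a_1)+\big(L_{a_1b_2}+[L_{a_1},L_{b_2}]-L_{a_2b_1}-[L_{a_2},L_{b_1}]+[T_1,T_2]\big)+\overline{\bar T_1b_2-\bar T_2b_1},$$ with its natural $\Lambda$-grading. Let $\epsilon(x^0)=1$, $\epsilon(x^\lambda)=0$ for $\lambda\ne0$, $(a,b)=\epsilon(ab)$ on $\mathcal J$, let $(\cdot,\cdot)$ on $\operatorname{Inder}$ be given by $(D,[L_a,L_b])=(Da,b)$, and on $\mathfrak g$ by $(a_1+L_{y_1}+D_1+\bar b_1,a_2+L_{y_2}+D_2+\bar b_2)=(a_1,b_2)+(a_2,b_1)+(y_1,y_2)+(D_1,D_2)$. For $\theta\in\operatorname{Hom}_{\mathbb Z}(\Lambda,\mathbb C)$ let $\partial_\theta$ act on $\mathfrak g^\lambda$ by $\theta(\lambda)$. $\mathrm{CDer}(\mathfrak g)$ is the span of all $\chi\partial_\theta$, with $\chi$ in the centroid of $\mathfrak g$, and $\mathrm{SCDer}(\mathfrak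 g)=\{d\in\mathrm{CDer}(\mathfrak g)\mid(d(u),u)=0\ \text{for all}\ u\in\mathfrak g\}$. A graded subalgebra $D=\bigoplus_\mu D^\mu\subseteq\mathrm{SCDer}(\mathfrak g)$ is permissible if $\mathrm{ev}:\Lambda\to(D^0)^*$, $\mathrm{ev}(\lambda)(\partial_\theta)=\theta(\lambda)$, is injective with discrete image. Let $C=\sum_\mu(D^\mu)^*$ be the graded dual, $C^\mu=(D^{-\mu})^*$, with $(d\cdot\varphi)(d')=\varphi([d',d])$. An affine cocycle on $D$ is a bilinear map $\kappa:D\times D\to C$ with $\kappa(d,d)=0$, $\sum_{\circlearrowleft}\kappa([d_1,d_2],d_3)=\sum_{\circlearrowleft}d_1\cdot\kappa(d_2,d_3)$, $\kappa(D^\mu,D^\nu)\subseteq C^{\mu+\nu}$, $\kappa(d_1,d_2)(d_3)=\kappa(d_2,d_3)(d_1)$, $\kappa(D^0,D)=0$. Then $E=E(\mathfrak g,D,\kappa)=\mathfrak g\oplus C\oplus D$ is a Lie algebra with $$[u_1+c_1+d_1,u_2+c_2+d_2]=\big([u_1,u_2]+d_1u_2-d_2u_1\big)+\big(c_D(u_1,u_2)+d_1\cdot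 c_2-d_2\cdot c_1+\kappa(d_1,d_2)\big)+[d_1,d_2],$$ $c_D(u,v)(d)=(d(u),v)$, and it carries the form $(u_1+c_1+d_1,u_2+c_2+d_2)=(u_1,u_2)+c_1(d_2)+c_2(d_1)$. Put $\mathcal H=\mathbb CL_1\oplus C^0\oplus D^0$, $E_\alpha=\{e\mid[h,e]=\alpha(h)e\ \text{for all}\ h\in\mathcal H\}$ for $\alpha\in\mathcal H^*$, and let $R^0$ be the set of isotropic roots: those $\alpha$ with $E_\alpha\ne0$ for which there is $t_\alpha\in\mathcal H$ with $\alpha(h)=(h,t_\alpha)$ for all $h\in\mathcal H$ and $(t_\alpha,t_\alpha)=0$. View $\sigma\in\Lambda$ as the form $aL_1+c+\partial_\theta\mapsto\theta(\sigma)$ on $\mathcal H$. \textbf{Proposition.} Let $\mathcal J$ be $\mathcal J_S$, $\mathbb C_q^+$ or $H(\mathbb C_{\bf e},-)$, $\mathfrak g=\mathrm{TKK}(\mathcal J)$, $D\subseteq\mathrm{SCDer}(\mathfrak g)$ permissible, $\kappa$ an affine cocycle on $D$, and $E=E(\mathfrak g,D,\kappa)$. Then $\Lambda\to\mathcal H^*$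 is injective with image $R^0$. For $0\ne\sigma\in\Lambda=R^0$: $$\dim E_\sigma=\begin{cases}2+\dim D^\sigma+\dim C^\sigma&\text{if }\mathcal J=\mathcal J_\Lambda\text{ and }\sigma\notin2\Lambda,\text{ or }\mathcal J=\mathbb C_q^+\text{ and }\sigma\notin\operatorname{rad}(f),\\1+\dim D^\sigma+\dim C^\sigma&\text{otherwise,}\end{cases}$$ and $2\le\dim E_\sigma\le4$ in the first case, $1\le\dim E_\sigma\le3$ in the second. More precisely (with $L_{x^\sigma}$ and the brackets, formed in $\operatorname{Instrl}(\mathcal J)$, viewed in $E$): (i) $\mathcal J=\mathcal J_S$. If $S=\Lambda$ and $\sigma\notin2\Lambda$, then $E_\sigma=\mathbb CL_{x^\sigma}+\mathbb C[L_{x^{\sigma+\tau}},L_{x^{-\tau}}]+D^\sigma+C^\sigma$ for every $\tau\in\Lambda$ with $\tau\notin2\Lambda$ and $\sigma+\tau\notin2\Lambda$. Otherwise, if $\sigma\in S$ then $E_\sigma=\mathbb CL_{x^\sigma}+D^\sigma+C^\sigma$, and if $\sigma\notin S$ then $E_\sigma=\mathbb C[L_{x^{\sigma+\tau}},L_{x^{-\tau}}]+D^\sigma+C^\sigma$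 for every $\tau\in S\setminus2\Lambda$. (ii) $\mathcal J=\mathbb C_q^+$. If $\sigma\notin\operatorname{rad}(f)$, then $L_{x^\sigma}-r_\sigma\in\operatorname{Instrl}(\mathcal J)$ and $E_\sigma=\mathbb CL_{x^\sigma}+\mathbb C(L_{x^\sigma}-r_\sigma)+D^\sigma+C^\sigma$; if $\sigma\in\operatorname{rad}(f)$, then $E_\sigma=\mathbb CL_{x^\sigma}+D^\sigma+C^\sigma$. (iii) $\mathcal J=H(\mathbb C_{\bf e},-)$. If $\varepsilon=1$ or $\sigma\in2\Lambda\cup(\sigma_1+2\Lambda)\cup(\sigma_2+2\Lambda)$, then $E_\sigma=\mathbb CL_{x^\sigma}+D^\sigma+C^\sigma$; otherwise $E_\sigma=\mathbb C[L_{x^{\sigma+\sigma_1}},L_{x^{-\sigma_1}}]+D^\sigma+C^\sigma$. -/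

import Mathlib

noncomputable section

attribute [local instance 100] LieRing.ofAssociativeRing

namespace EllipticEALA

open TensorProduct

/-- The lattice `Λ = ℤσ₁ ⊕ ℤσ₂` of rank two, with `σ₁ = (1, 0)` and `σ₂ = (0, 1)`. -/
abbrev GrLat : Type := ℤ × ℤ

/-- A Jordan torus over `ℂ` graded by `Λ`: a unital Jordan algebra with a homogeneous basis
`x^λ` (`λ ∈ supp`, `x^0 = 1`) such that `supp` generates `Λ` and such that the functional `ε`
(`ε (x^0) = 1`, `ε (x^λ) = 0` for `λ ≠ 0`) gives an associative form `(x, y) = ε (x y)`. -/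
class JordanTorus (J : Type) [AddCommGroup J] [Module ℂ J] where
  mul : J →ₗ[ℂ] J →ₗ[ℂ] J
  mul_comm : ∀ a b, mul a b = mul b a
  jordan : ∀ a b, mul (mul a b) (mul a a) = mul a (mul b (mul a a))
  supp : Set GrLat
  basis : Module.Basis supp ℂ J
  zero_mem : (0 : GrLat) ∈ supp
  one_mul : ∀ a, mul (basis ⟨0, zero_mem⟩) a = a
  mul_graded : ∀ a b c : supp, basis.repr (mul (basis a) (basis b)) c ≠ 0 → (c : GrLat) = a + b
  closure_supp : AddSubgroup.closure supp = ⊤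
  trace_assoc : ∀ a b c, basis.coord ⟨0, zero_mem⟩ (mul (mul a b) c) =
    basis.coord ⟨0, zero_mem⟩ (mul a (mul b c))

section Jordan

variable (J : Type) [AddCommGroup J] [Module ℂ J] [JordanTorus J]

/-- The left multiplication operators `L_x y = x y`. -/
def L : J →ₗ[ℂ] Module.End ℂ J := JordanTorus.mul

/-- The unit `1 = x^0`. -/
def one : J := JordanTorus.basis ⟨0, JordanTorus.zero_mem⟩

/-- The functional `ε`. -/
def eps : J →ₗ[ℂ] ℂ := JordanTorus.basis.coord ⟨0, JordanTorus.zero_mem⟩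

open Classical in
/-- The element `x^λ`, which is zero when `λ` is not in the support. -/
def xElt (l : GrLat) : J := if h : l ∈ JordanTorus.supp J then JordanTorus.basis ⟨l, h⟩ else 0

/-- The homogeneous component `J^λ`. -/
def gr (l : GrLat) : Submodule ℂ J := Submodule.span ℂ {xElt J l}

variable {J}

theorem L_comm (a b : J) : L J a b = L J b a := JordanTorus.mul_comm a b

@[simp] theorem L_one (a : J) : L J (one J) a = a := JordanTorus.one_mul a

@[simp] theorem L_one' (a : J) : L J a (one J) = a := by rw [L_comm, L_one]

theorem eps_assoc (a b c : J) : eps J (L J (L J a b) c) = eps J (L J a (L J b c)) :=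
  JordanTorus.trace_assoc a b c

theorem L_jordan (a b : J) : L J (L J a b) (L J a a) = L J a (L J b (L J a a)) :=
  JordanTorus.jordan a b

/-- Linearised Jordan identity. -/
theorem L_jordan_lin (a b c d : J) :
    (L J a (L J (L J b c) d) - L J (L J b c) (L J a d)) +
    (L J b (L J (L J c a) d) - L J (L J c a) (L J b d)) +
    (L J c (L J (L J a b) d) - L J (L J a b) (L J c d)) = 0 := by
  have key : ∀ u : J, L J u (L J (L J u u) d) - L J (L J u u) (L J u d) = 0 := by
    intro u
    rw [L_comm (L J u u) (L J u d), L_jordan, L_comm d, sub_self]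
  have h1 := key a
  have h2 := key b
  have h3 := key c
  have h12 := key (a + b)
  have h13 := key (a + c)
  have h23 := key (b + c)
  have h123 := key (a + b + c)
  simp only [map_add, LinearMap.add_apply] at h12 h13 h23 h123
  rw [L_comm b a] at h12 h123
  rw [L_comm c a] at h13 h123
  rw [L_comm c b] at h23 h123
  rw [L_comm c a]
  have : (2 : ℂ) • ((L J a (L J (L J b c) d) - L J (L J b c) (L J a d)) +
    (L J b (L J (L J a c) d) - L J (L J a c) (L J b d)) +
    (L J c (L J (L J a b) d) - L J (L J a b) (L J c d))) = 0 := by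
    rw [two_smul]
    linear_combination (norm := module) h123 - h12 - h13 - h23 + h1 + h2 + h3
  exact (smul_eq_zero.1 this).resolve_left two_ne_zero

/-- `[L_x, L_y]` is a derivation of `J`. -/
theorem lie_L_L_L (a b c : J) : ⁅⁅L J a, L J b⁆, L J c⁆ = L J (⁅L J a, L J b⁆ c) := by
  ext d
  have h1 := L_jordan_lin c d b a
  have h2 := L_jordan_lin c d a b
  simp only [LieRing.of_associative_ring_bracket, LinearMap.sub_apply, Module.End.mul_apply,
    map_sub]
  rw [L_comm (L J a (L J b c)) d, L_comm (L J b (L J a c)) d]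
  rw [L_comm (L J d b) a, L_comm d b, L_comm (L J b c) a, L_comm (L J c d) a,
    L_comm c a, L_comm d a] at h1
  rw [L_comm (L J d a) b, L_comm d a, L_comm (L J a c) b, L_comm (L J c d) b,
    L_comm c b, L_comm d b, L_comm (L J a d) (L J b c), L_comm (L J a c) (L J b d),
    L_comm a b] at h2
  rw [L_comm b a] at h1 h2
  linear_combination (norm := module) h2 - h1

/-- The space `∑ [L_x, L_y]` of inner derivations. -/
def inder (J : Type) [AddCommGroup J] [Module ℂ J] [JordanTorus J] :
    Submodule ℂ (Module.End ℂ J) :=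
  Submodule.span ℂ {D | ∃ a b : J, D = ⁅L J a, L J b⁆}

theorem lie_mem_inder (a b : J) : ⁅L J a, L J b⁆ ∈ inder J :=
  Submodule.subset_span ⟨a, b, rfl⟩

theorem inder_lie_L {D : Module.End ℂ J} (hD : D ∈ inder J) (a : J) :
    ⁅D, L J a⁆ = L J (D a) := by
  induction hD using Submodule.span_induction with
  | mem D h => obtain ⟨u, v, rfl⟩ := h; exact lie_L_L_L u v a
  | zero => simp
  | add D E _ _ h1 h2 => simp [add_lie, h1, h2]
  | smul c D _ h => simp [smul_lie, h]

theorem inder_apply_L {D : Module.End ℂ J} (hD : D ∈ inder J) (a b : J) :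
    D (L J a b) = L J (D a) b + L J a (D b) := by
  have := LinearMap.congr_fun (inder_lie_L hD a) b
  simp only [LieRing.of_associative_ring_bracket, LinearMap.sub_apply,
    Module.End.mul_apply] at this
  rw [← this]; abel

theorem inder_one {D : Module.End ℂ J} (hD : D ∈ inder J) : D (one J) = 0 := by
  have := inder_apply_L hD (one J) (one J)
  simpa using this

theorem inder_lie {D E : Module.End ℂ J} (hD : D ∈ inder J) (hE : E ∈ inder J) :
    ⁅D, E⁆ ∈ inder J := by
  induction hE using Submodule.span_induction with
  | mem E h =>
    obtain ⟨u, v, rfl⟩ := h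
    rw [leibniz_lie, inder_lie_L hD, inder_lie_L hD]
    exact add_mem (lie_mem_inder _ _) (lie_mem_inder _ _)
  | zero => simp
  | add D E _ _ h1 h2 => rw [lie_add]; exact add_mem h1 h2
  | smul c D _ h => rw [lie_smul]; exact Submodule.smul_mem _ _ h

/-- The inner structure algebra `Instrl(J) = L_J + ∑ [L_x, L_y]`. -/
def instrl (J : Type) [AddCommGroup J] [Module ℂ J] [JordanTorus J] :
    LieSubalgebra ℂ (Module.End ℂ J) where
  toSubmodule := LinearMap.range (L J) ⊔ inder J
  lie_mem' := by
    intro S T hS hT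
    obtain ⟨_, ⟨a, rfl⟩, D, hD, rfl⟩ := Submodule.mem_sup.1 hS
    obtain ⟨_, ⟨b, rfl⟩, E, hE, rfl⟩ := Submodule.mem_sup.1 hT
    change ⁅L J a + D, L J b + E⁆ ∈ LinearMap.range (L J) ⊔ inder J
    rw [add_lie, lie_add, lie_add, inder_lie_L hD, ← lie_skew (L J a) E, inder_lie_L hE]
    refine add_mem (add_mem ?_ ?_) (add_mem ?_ ?_)
    · exact Submodule.mem_sup_right (lie_mem_inder _ _)
    · exact Submodule.mem_sup_left (neg_mem ⟨_, rfl⟩)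
    · exact Submodule.mem_sup_left ⟨_, rfl⟩
    · exact Submodule.mem_sup_right (inder_lie hD hE)

theorem L_mem (a : J) : L J a ∈ instrl J := Submodule.mem_sup_left ⟨a, rfl⟩

theorem inder_mem {D : Module.End ℂ J} (hD : D ∈ inder J) : D ∈ instrl J :=
  Submodule.mem_sup_right hD

/-- `T = L_{T 1} + D` with `D` an inner derivation. -/
theorem sub_mem_inder {T : Module.End ℂ J} (hT : T ∈ instrl J) :
    T - L J (T (one J)) ∈ inder J := by
  obtain ⟨_, ⟨a, rfl⟩, D, hD, rfl⟩ := Submodule.mem_sup.1 hT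
  simpa [inder_one hD] using hD

/-- `L_x` as an element of `Instrl(J)`. -/
def LI (J : Type) [AddCommGroup J] [Module ℂ J] [JordanTorus J] : J →ₗ[ℂ] instrl J :=
  (L J).codRestrict (instrl J).toSubmodule L_mem

@[simp] theorem coe_LI (a : J) : (LI J a : Module.End ℂ J) = L J a := rfl

/-- The component `T 1` of `T = L_{T 1} + D`. -/
def LPart (J : Type) [AddCommGroup J] [Module ℂ J] [JordanTorus J] : instrl J →ₗ[ℂ] J where
  toFun T := (T : Module.End ℂ J) (one J)
  map_add' _ _ := rfl
  map_smul' _ _ := rfl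

theorem LPart_apply (T : instrl J) : LPart J T = (T : Module.End ℂ J) (one J) := rfl

/-- The component `D` of `T = L_{T 1} + D`. -/
def dPart (J : Type) [AddCommGroup J] [Module ℂ J] [JordanTorus J] : instrl J →ₗ[ℂ] inder J where
  toFun T := ⟨_, sub_mem_inder T.2⟩
  map_add' S T := by ext; simp; abel
  map_smul' c T := by ext; simp [smul_sub]

theorem coe_dPart (T : instrl J) :
    (dPart J T : Module.End ℂ J) = (T : Module.End ℂ J) - L J (LPart J T) := rfl

/-- The involution `L_a + D ↦ -L_a + D` of `Instrl(J)`. -/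
def bar (J : Type) [AddCommGroup J] [Module ℂ J] [JordanTorus J] : instrl J →ₗ[ℂ] instrl J :=
  LinearMap.id - (2 : ℂ) • (LI J ∘ₗ LPart J)

theorem bar_apply (T : instrl J) : bar J T = T - (2 : ℂ) • LI J (LPart J T) := rfl

/-- `x △ y = L_{x y} + [L_x, L_y]`. -/
def tri (J : Type) [AddCommGroup J] [Module ℂ J] [JordanTorus J] : J →ₗ[ℂ] J →ₗ[ℂ] instrl J :=
  LinearMap.mk₂ ℂ (fun a b => LI J (L J a b) + ⁅LI J a, LI J b⁆)
    (by intros; simp only [map_add, LinearMap.add_apply, add_lie]; abel)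
    (by intros; simp only [map_smul, LinearMap.smul_apply, smul_lie, smul_add])
    (by intros; simp only [map_add, lie_add]; abel)
    (by intros; simp only [map_smul, lie_smul, smul_add])

theorem tri_apply (a b : J) : tri J a b = LI J (L J a b) + ⁅LI J a, LI J b⁆ := rfl

theorem tri_coe_apply (a b c : J) : (tri J a b : Module.End ℂ J) c =
    L J (L J a b) c + (L J a (L J b c) - L J b (L J a c)) := rfl

theorem bar_tri (a b : J) : bar J (tri J a b) = - tri J b a := by
  have : LPart J (tri J a b) = L J a b := by
    rw [LPart_apply, tri_coe_apply]; simp [L_comm b a]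
  rw [bar_apply, this, tri_apply, tri_apply, ← lie_skew, L_comm b a]
  module

/-- Elements of `Instrl(J)` written as `L_a + D`. -/
theorem instrl_cases (T : instrl J) : ∃ (a : J) (D : instrl J),
    (D : Module.End ℂ J) ∈ inder J ∧ T = LI J a + D :=
  ⟨LPart J T, ⟨_, inder_mem (dPart J T).2⟩, (dPart J T).2, by ext; simp [coe_dPart]⟩

theorem bar_add_inder (a : J) (D : instrl J) (hD : (D : Module.End ℂ J) ∈ inder J) :
    bar J (LI J a + D) = - LI J a + D := by
  have : LPart J (LI J a + D) = a := by
    rw [LPart_apply]; simp [inder_one hD]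
  rw [bar_apply, this]; module

theorem LI_lie_inder (a : J) (D : instrl J) (hD : (D : Module.End ℂ J) ∈ inder J) :
    ⁅D, LI J a⁆ = LI J ((D : Module.End ℂ J) a) :=
  Subtype.ext (inder_lie_L hD a)

theorem bar_lie (S T : instrl J) : bar J ⁅S, T⁆ = ⁅bar J S, bar J T⁆ := by
  obtain ⟨a, D, hD, rfl⟩ := instrl_cases S
  obtain ⟨b, E, hE, rfl⟩ := instrl_cases T
  rw [bar_add_inder a D hD, bar_add_inder b E hE]
  have e : ⁅LI J a + D, LI J b + E⁆ = LI J ((D : Module.End ℂ J) b - (E : Module.End ℂ J) a) +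
      (⁅LI J a, LI J b⁆ + ⁅D, E⁆) := by
    rw [add_lie, lie_add, lie_add, ← lie_skew (LI J a) E, LI_lie_inder b D hD,
      LI_lie_inder a E hE, map_sub]
    abel
  have e' : ⁅-LI J a + D, -LI J b + E⁆ = -LI J ((D : Module.End ℂ J) b - (E : Module.End ℂ J) a) +
      (⁅LI J a, LI J b⁆ + ⁅D, E⁆) := by
    rw [add_lie, lie_add, lie_add, neg_lie, neg_lie, lie_neg, lie_neg, ← lie_skew (LI J a) E,
      LI_lie_inder b D hD, LI_lie_inder a E hE, map_sub]
    abel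
  rw [e, e', bar_add_inder]
  exact add_mem (lie_mem_inder a b) (inder_lie hD hE)

theorem bar_bar (T : instrl J) : bar J (bar J T) = T := by
  obtain ⟨a, D, hD, rfl⟩ := instrl_cases T
  rw [bar_add_inder a D hD, ← map_neg, bar_add_inder _ D hD, map_neg, neg_neg]

theorem lie_tri (T : instrl J) (a b : J) : ⁅T, tri J a b⁆ =
    tri J ((T : Module.End ℂ J) a) b + tri J a ((bar J T : Module.End ℂ J) b) := by
  obtain ⟨c, D, hD, rfl⟩ := instrl_cases T
  rw [bar_add_inder c D hD]
  have h1 : ⁅D, tri J a b⁆ = tri J ((D : Module.End ℂ J) a) b +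
      tri J a ((D : Module.End ℂ J) b) := by
    rw [tri_apply, lie_add, leibniz_lie, LI_lie_inder _ D hD, LI_lie_inder _ D hD,
      LI_lie_inder _ D hD, inder_apply_L hD, tri_apply, tri_apply, map_add]
    abel
  have h2 : ⁅LI J c, tri J a b⁆ = tri J (L J c a) b - tri J a (L J c b) := by
    have e : ⁅LI J c, ⁅LI J a, LI J b⁆⁆ = LI J (-(L J a (L J b c) - L J b (L J a c))) := by
      rw [← lie_skew, map_neg]; congr 1; exact Subtype.ext (lie_L_L_L a b c)
    have f : ⁅LI J c, LI J (L J a b)⁆ = ⁅LI J (L J c a), LI J b⁆ - ⁅LI J a, LI J (L J c b)⁆ := by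
      apply Subtype.ext
      ext d
      have h := L_jordan_lin a b c d
      rw [L_comm b c] at h
      simp only [AddSubgroupClass.coe_sub, LieSubalgebra.coe_bracket, coe_LI,
        LieRing.of_associative_ring_bracket, LinearMap.sub_apply, Module.End.mul_apply]
      linear_combination (norm := module) h
    rw [tri_apply, lie_add, e, f, tri_apply, tri_apply, L_comm (L J c a) b, L_comm c a, L_comm c b,
      map_neg, map_sub]
    abel
  rw [add_lie, h1, h2]
  simp only [AddMemClass.coe_add, NegMemClass.coe_neg, coe_LI, LinearMap.add_apply,
    LinearMap.neg_apply, map_add, map_neg]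
  abel

/-- The Tits-Kantor-Koecher algebra `TKK(J) = J ⊕ Instrl(J) ⊕ J̄`. -/
abbrev TKK (J : Type) [AddCommGroup J] [Module ℂ J] [JordanTorus J] : Type :=
  J × instrl J × J

instance : Bracket (TKK J) (TKK J) where
  bracket u v :=
    ((u.2.1 : Module.End ℂ J) v.1 - (v.2.1 : Module.End ℂ J) u.1,
     tri J u.1 v.2.2 - tri J v.1 u.2.2 + ⁅u.2.1, v.2.1⁆,
     (bar J u.2.1 : Module.End ℂ J) v.2.2 - (bar J v.2.1 : Module.End ℂ J) u.2.2)

theorem TKK_lie (u v : TKK J) : ⁅u, v⁆ =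
    ((u.2.1 : Module.End ℂ J) v.1 - (v.2.1 : Module.End ℂ J) u.1,
     tri J u.1 v.2.2 - tri J v.1 u.2.2 + ⁅u.2.1, v.2.1⁆,
     (bar J u.2.1 : Module.End ℂ J) v.2.2 - (bar J v.2.1 : Module.End ℂ J) u.2.2) := rfl

theorem tri_swap (a b c : J) : (tri J a b : Module.End ℂ J) c = (tri J c b : Module.End ℂ J) a := by
  rw [tri_coe_apply, tri_coe_apply, L_comm (L J a b) c, L_comm (L J c b) a, L_comm c b,
    L_comm a b, L_comm a c]
  abel

theorem coe_lie_apply (S T : instrl J) (a : J) : (⁅S, T⁆ : Module.End ℂ J) a =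
    (S : Module.End ℂ J) ((T : Module.End ℂ J) a) -
    (T : Module.End ℂ J) ((S : Module.End ℂ J) a) := rfl

instance : LieRing (TKK J) where
  add_lie u v w := by
    refine Prod.ext ?_ (Prod.ext ?_ ?_) <;>
    simp only [TKK_lie, Prod.fst_add, Prod.snd_add, AddMemClass.coe_add, LinearMap.add_apply,
      map_add, add_lie] <;> abel
  lie_add u v w := by
    refine Prod.ext ?_ (Prod.ext ?_ ?_) <;>
    simp only [TKK_lie, Prod.fst_add, Prod.snd_add, AddMemClass.coe_add, LinearMap.add_apply,
      map_add, lie_add] <;> abel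
  lie_self u := by
    refine Prod.ext ?_ (Prod.ext ?_ ?_) <;> simp [TKK_lie]
  leibniz_lie u v w := by
    obtain ⟨x1, T1, y1⟩ := u
    obtain ⟨x2, T2, y2⟩ := v
    obtain ⟨x3, T3, y3⟩ := w
    refine Prod.ext ?_ (Prod.ext ?_ ?_)
    · simp only [TKK_lie, Prod.fst_add, Prod.snd_add, AddMemClass.coe_add, AddSubgroupClass.coe_sub,
        LinearMap.add_apply, LinearMap.sub_apply, map_add, map_sub, LieSubalgebra.coe_bracket,
        LieRing.of_associative_ring_bracket, Module.End.mul_apply]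
      rw [tri_swap x2 y3 x1, tri_swap x3 y2 x1, tri_swap x2 y1 x3]
      abel
    · simp only [TKK_lie, Prod.fst_add, Prod.snd_add, map_sub, LinearMap.sub_apply, lie_add,
        lie_sub, add_lie, sub_lie, lie_tri, leibniz_lie T1 T2 T3]
      simp only [← lie_skew (tri J _ _) _, lie_tri]
      abel
    · simp only [TKK_lie, Prod.fst_add, Prod.snd_add, AddMemClass.coe_add, AddSubgroupClass.coe_sub,
        LinearMap.add_apply, LinearMap.sub_apply, map_add, map_sub, bar_lie, bar_tri,
        NegMemClass.coe_neg, LinearMap.neg_apply,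
        LieSubalgebra.coe_bracket,
        LieRing.of_associative_ring_bracket, Module.End.mul_apply]
      rw [tri_swap y3 x2 y1, tri_swap y2 x3 y1, tri_swap y3 x1 y2]
      abel

instance : LieAlgebra ℂ (TKK J) where
  lie_smul c u v := by
    refine Prod.ext ?_ (Prod.ext ?_ ?_) <;>
    simp [TKK_lie, smul_sub]

/-! ### The invariant form -/

/-- The form `(a, b) = ε (a b)` on `J`. -/
def formJ (J : Type) [AddCommGroup J] [Module ℂ J] [JordanTorus J] : J →ₗ[ℂ] J →ₗ[ℂ] ℂ :=
  (L J).compr₂ (eps J)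

theorem formJ_apply (a b : J) : formJ J a b = eps J (L J a b) := rfl

theorem formJ_comm (a b : J) : formJ J a b = formJ J b a := by
  rw [formJ_apply, L_comm, formJ_apply]

theorem formJ_L (a b c : J) : formJ J (L J a b) c = formJ J b (L J a c) := by
  rw [formJ_apply, L_comm a b, eps_assoc, formJ_apply]

theorem formJ_lie (a b c d : J) :
    formJ J (⁅L J a, L J b⁆ c) d = formJ J (⁅L J c, L J d⁆ a) b := by
  simp only [LieRing.of_associative_ring_bracket, LinearMap.sub_apply, Module.End.mul_apply,
    map_sub]
  rw [formJ_L a (L J b c) d, formJ_L b (L J a c) d, formJ_L c (L J d a) b, formJ_L d (L J c a) b,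
    formJ_comm (L J b c), L_comm c b, L_comm d a, L_comm c a, L_comm d b]

/-- There is a bilinear form on the inner derivations with `(D, [L_a, L_b]) = (D a, b)`. -/
theorem exists_formInder (J : Type) [AddCommGroup J] [Module ℂ J] [JordanTorus J] :
    ∃ β : inder J →ₗ[ℂ] inder J →ₗ[ℂ] ℂ, ∀ (D : inder J) (a b : J),
      β D ⟨⁅L J a, L J b⁆, lie_mem_inder a b⟩ = formJ J ((D : Module.End ℂ J) a) b := by
  let br : J →ₗ[ℂ] J →ₗ[ℂ] inder J := LinearMap.mk₂ ℂ
    (fun a b => ⟨⁅L J a, L J b⁆, lie_mem_inder a b⟩)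
    (by intros; ext1; simp only [map_add, add_lie]; rfl)
    (by intros; ext1; simp only [map_smul, smul_lie]; rfl)
    (by intros; ext1; simp only [map_add, lie_add]; rfl)
    (by intros; ext1; simp only [map_smul, lie_smul]; rfl)
  let op : J ⊗[ℂ] J →ₗ[ℂ] inder J := TensorProduct.lift br
  let pr : inder J →ₗ[ℂ] J ⊗[ℂ] J →ₗ[ℂ] ℂ :=
    { toFun := fun D => TensorProduct.lift ((formJ J) ∘ₗ (D : Module.End ℂ J))
      map_add' := by intros; ext; simp
      map_smul' := by intros; ext; simp }
  have hpr : ∀ D a b, pr D (a ⊗ₜ b) = formJ J ((D : Module.End ℂ J) a) b := fun _ _ _ => rfl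
  have hop : ∀ a b, op (a ⊗ₜ b) = ⟨⁅L J a, L J b⁆, lie_mem_inder a b⟩ := fun _ _ => rfl
  have hsurj : ∀ D, ∃ t, op t = D := by
    rintro ⟨D, hD⟩
    induction hD using Submodule.span_induction with
    | mem D h => obtain ⟨a, b, rfl⟩ := h; exact ⟨a ⊗ₜ b, rfl⟩
    | zero => exact ⟨0, map_zero _⟩
    | add D E hD hE h1 h2 =>
      obtain ⟨s, hs⟩ := h1
      obtain ⟨t, ht⟩ := h2
      exact ⟨s + t, by rw [map_add, hs, ht]; rfl⟩
    | smul c D hD h =>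
      obtain ⟨s, hs⟩ := h
      exact ⟨c • s, by rw [map_smul, hs]; rfl⟩
  have hsym : ∀ s t, pr (op s) t = pr (op t) s := by
    intro s t
    induction s using TensorProduct.induction_on with
    | zero => simp
    | add s s' h h' => simp only [map_add, LinearMap.add_apply, h, h']
    | tmul a b =>
      induction t using TensorProduct.induction_on with
      | zero => simp
      | add t t' h h' => simp only [map_add, LinearMap.add_apply, h, h']
      | tmul c d =>
        rw [hpr, hpr, hop, hop]
        exact formJ_lie a b c d
  obtain ⟨s, hs⟩ := op.exists_rightInverse_of_surjective (LinearMap.range_eq_top.2 hsurj)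
  refine ⟨pr.compl₂ s, fun D a b => ?_⟩
  obtain ⟨t, rfl⟩ := hsurj D
  have h1 : op (s (op (a ⊗ₜ b))) = op (a ⊗ₜ b) := LinearMap.congr_fun hs _
  rw [LinearMap.compl₂_apply, ← hop, hsym, h1, ← hsym, hpr]

/-- The form on the inner derivations, determined by `(D, [L_a, L_b]) = (D a, b)`. -/
def formInder (J : Type) [AddCommGroup J] [Module ℂ J] [JordanTorus J] :
    inder J →ₗ[ℂ] inder J →ₗ[ℂ] ℂ :=
  (exists_formInder J).choose

theorem formInder_lie (D : inder J) (a b : J) :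
    formInder J D ⟨⁅L J a, L J b⁆, lie_mem_inder a b⟩ = formJ J ((D : Module.End ℂ J) a) b :=
  (exists_formInder J).choose_spec D a b

theorem formInder_lie' (D E : inder J) (a b : J) (hE : (E : Module.End ℂ J) = ⁅L J a, L J b⁆) :
    formInder J D E = formJ J ((D : Module.End ℂ J) a) b := by
  obtain rfl : E = ⟨⁅L J a, L J b⁆, lie_mem_inder a b⟩ := Subtype.ext hE
  exact formInder_lie D a b

/-- The form
`(x₁ + L_{y₁} + D₁ + z̄₁, x₂ + L_{y₂} + D₂ + z̄₂) = (x₁, z₂) + (x₂, z₁) + (y₁, y₂) + (D₁, D₂)`. -/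
def form (J : Type) [AddCommGroup J] [Module ℂ J] [JordanTorus J] :
    TKK J →ₗ[ℂ] TKK J →ₗ[ℂ] ℂ :=
  LinearMap.mk₂ ℂ (fun u v => formJ J u.1 v.2.2 + formJ J v.1 u.2.2 +
      formJ J (LPart J u.2.1) (LPart J v.2.1) + formInder J (dPart J u.2.1) (dPart J v.2.1))
    (by intros; simp only [Prod.fst_add, Prod.snd_add, map_add, LinearMap.add_apply]; ring)
    (by intros; simp only [Prod.smul_fst, Prod.smul_snd, map_smul, LinearMap.smul_apply,
          smul_eq_mul]; ring)
    (by intros; simp only [Prod.fst_add, Prod.snd_add, map_add, LinearMap.add_apply]; ring)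
    (by intros; simp only [Prod.smul_fst, Prod.smul_snd, map_smul, LinearMap.smul_apply,
          smul_eq_mul]; ring)

theorem form_apply (u v : TKK J) : form J u v = formJ J u.1 v.2.2 + formJ J v.1 u.2.2 +
    formJ J (LPart J u.2.1) (LPart J v.2.1) + formInder J (dPart J u.2.1) (dPart J v.2.1) := rfl

theorem inder_induction {p : inder J → Prop}
    (lie : ∀ a b, p ⟨⁅L J a, L J b⁆, lie_mem_inder a b⟩) (zero : p 0)
    (add : ∀ D E, p D → p E → p (D + E)) (smul : ∀ (c : ℂ) D, p D → p (c • D)) (D : inder J) :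
    p D := by
  obtain ⟨D, hD⟩ := D
  induction hD using Submodule.span_induction with
  | mem D h => obtain ⟨a, b, rfl⟩ := h; exact lie a b
  | zero => exact zero
  | add D E hD hE h1 h2 => exact add ⟨D, hD⟩ ⟨E, hE⟩ h1 h2
  | smul c D hD h => exact smul c ⟨D, hD⟩ h

theorem formInder_comm (D E : inder J) : formInder J D E = formInder J E D := by
  induction E using inder_induction with
  | zero => simp
  | add E F h1 h2 => simp only [map_add, LinearMap.add_apply, h1, h2]
  | smul c E h => simp only [map_smul, LinearMap.smul_apply, h]
  | lie a b =>
    induction D using inder_induction with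
    | zero => simp
    | add E F h1 h2 => simp only [map_add, LinearMap.add_apply, h1, h2]
    | smul c E h => simp only [map_smul, LinearMap.smul_apply, h]
    | lie c d => rw [formInder_lie, formInder_lie]; exact formJ_lie c d a b

theorem formJ_inder {D : Module.End ℂ J} (hD : D ∈ inder J) (a b : J) :
    formJ J (D a) b = - formJ J a (D b) := by
  have key : ∀ D : inder J, formJ J ((D : Module.End ℂ J) a) b +
      formJ J a ((D : Module.End ℂ J) b) = 0 := by
    intro D
    induction D using inder_induction with
    | zero => simp
    | add E F h1 h2 =>
      simp only [Submodule.coe_add, map_add, LinearMap.add_apply]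
      linear_combination h1 + h2
    | smul c E h =>
      simp only [Submodule.coe_smul, map_smul, LinearMap.smul_apply, smul_eq_mul]
      linear_combination c * h
    | lie c d =>
      simp only [LieRing.of_associative_ring_bracket, LinearMap.sub_apply, Module.End.mul_apply,
        map_sub]
      rw [formJ_L c, formJ_L d, formJ_L d, formJ_L c]
      ring
  exact eq_neg_of_add_eq_zero_left (key ⟨D, hD⟩)

theorem formInder_inv (D E F : inder J) :
    formInder J ⟨⁅(D : Module.End ℂ J), (E : Module.End ℂ J)⁆, inder_lie D.2 E.2⟩ F =
    formInder J D ⟨⁅(E : Module.End ℂ J), (F : Module.End ℂ J)⁆, inder_lie E.2 F.2⟩ := by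
  induction F using inder_induction with
  | zero =>
    have : (⟨⁅(E : Module.End ℂ J), ((0 : inder J) : Module.End ℂ J)⁆,
      inder_lie E.2 (0 : inder J).2⟩ : inder J) = 0 := by ext1; simp
    rw [this]; simp
  | add F G h1 h2 =>
    have : (⟨⁅(E : Module.End ℂ J), ((F + G : inder J) : Module.End ℂ J)⁆,
      inder_lie E.2 (F + G).2⟩ : inder J) = ⟨_, inder_lie E.2 F.2⟩ + ⟨_, inder_lie E.2 G.2⟩ := by
      ext1; simp
    rw [this, map_add, map_add, h1, h2]
  | smul c F h =>
    have : (⟨⁅(E : Module.End ℂ J), ((c • F : inder J) : Module.End ℂ J)⁆,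
      inder_lie E.2 (c • F).2⟩ : inder J) = c • ⟨_, inder_lie E.2 F.2⟩ := by
      ext1; simp
    rw [this, map_smul, map_smul, h]
  | lie a b =>
    have : (⟨⁅(E : Module.End ℂ J), ⁅L J a, L J b⁆⁆, inder_lie E.2 (lie_mem_inder a b)⟩ : inder J) =
        ⟨_, lie_mem_inder ((E : Module.End ℂ J) a) b⟩ +
        ⟨_, lie_mem_inder a ((E : Module.End ℂ J) b)⟩ := by
      ext1
      change ⁅(E : Module.End ℂ J), ⁅L J a, L J b⁆⁆ = ⁅L J ((E : Module.End ℂ J) a), L J b⁆ +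
        ⁅L J a, L J ((E : Module.End ℂ J) b)⁆
      rw [← inder_lie_L E.2, ← inder_lie_L E.2, leibniz_lie]
    rw [this, formInder_lie, map_add, formInder_lie, formInder_lie]
    simp only [LieRing.of_associative_ring_bracket, LinearMap.sub_apply, Module.End.mul_apply,
        map_sub]
    rw [formJ_inder E.2]
    ring

/-- The form on `Instrl(J)`. -/
def formI (J : Type) [AddCommGroup J] [Module ℂ J] [JordanTorus J] (S T : instrl J) : ℂ :=
  formJ J (LPart J S) (LPart J T) + formInder J (dPart J S) (dPart J T)

theorem formI_comm (S T : instrl J) : formI J S T = formI J T S := by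
  rw [formI, formI, formJ_comm, formInder_comm]

theorem formI_add (S T U : instrl J) : formI J (S + T) U = formI J S U + formI J T U := by
  simp only [formI, map_add, LinearMap.add_apply]; ring

theorem formI_sub (S T U : instrl J) : formI J (S - T) U = formI J S U - formI J T U := by
  simp only [formI, map_sub, LinearMap.sub_apply]; ring

theorem form_apply' (u v : TKK J) : form J u v = formJ J u.1 v.2.2 + formJ J v.1 u.2.2 +
    formI J u.2.1 v.2.1 := by
  rw [form_apply, formI, add_assoc]

theorem form_comm (u v : TKK J) : form J u v = form J v u := by
  rw [form_apply', form_apply', formI_comm]; ring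

theorem LPart_add (a : J) (D : instrl J) (hD : (D : Module.End ℂ J) ∈ inder J) :
    LPart J (LI J a + D) = a := by
  rw [LPart_apply]; simp [inder_one hD]

theorem dPart_add (a : J) (D : instrl J) (hD : (D : Module.End ℂ J) ∈ inder J) :
    dPart J (LI J a + D) = ⟨D, hD⟩ := by
  ext1; rw [coe_dPart, LPart_add a D hD]; simp

theorem formI_tri (T : instrl J) (a b : J) :
    formI J T (tri J a b) = formJ J ((T : Module.End ℂ J) a) b := by
  have hd : ((⁅LI J a, LI J b⁆ : instrl J) : Module.End ℂ J) ∈ inder J := lie_mem_inder a b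
  have e : ((dPart J T : inder J) : Module.End ℂ J) a =
    (T : Module.End ℂ J) a - L J (LPart J T) a := rfl
  have f : formJ J (L J (LPart J T) a) b = formJ J (LPart J T) (L J a b) := by
    rw [formJ_apply, eps_assoc, formJ_apply]
  rw [formI, tri_apply, LPart_add _ _ hd, dPart_add _ _ hd, formInder_lie' _ _ a b rfl, e, map_sub,
    LinearMap.sub_apply, f]
  ring

theorem lie_add_add (a b : J) (D E : instrl J) (hD : (D : Module.End ℂ J) ∈ inder J)
    (hE : (E : Module.End ℂ J) ∈ inder J) : ⁅LI J a + D, LI J b + E⁆ =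
      LI J ((D : Module.End ℂ J) b - (E : Module.End ℂ J) a) + (⁅LI J a, LI J b⁆ + ⁅D, E⁆) := by
  rw [add_lie, lie_add, lie_add, ← lie_skew (LI J a) E, LI_lie_inder b D hD,
    LI_lie_inder a E hE, map_sub]
  abel

theorem formI_inv (S T U : instrl J) : formI J ⁅S, T⁆ U = formI J S ⁅T, U⁆ := by
  obtain ⟨a, D, hD, rfl⟩ := instrl_cases S
  obtain ⟨b, E, hE, rfl⟩ := instrl_cases T
  obtain ⟨c, F, hF, rfl⟩ := instrl_cases U
  have h1 : ((⁅LI J a, LI J b⁆ + ⁅D, E⁆ : instrl J) : Module.End ℂ J) ∈ inder J :=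
    add_mem (lie_mem_inder a b) (inder_lie hD hE)
  have h2 : ((⁅LI J b, LI J c⁆ + ⁅E, F⁆ : instrl J) : Module.End ℂ J) ∈ inder J :=
    add_mem (lie_mem_inder b c) (inder_lie hE hF)
  rw [lie_add_add a b D E hD hE, lie_add_add b c E F hE hF, formI, formI, LPart_add _ _ h1,
    LPart_add _ _ h2, LPart_add _ _ hD, LPart_add _ _ hF, dPart_add _ _ h1, dPart_add _ _ h2,
    dPart_add _ _ hD, dPart_add _ _ hF]
  have e1 : (⟨_, h1⟩ : inder J) = ⟨_, lie_mem_inder a b⟩ + ⟨_, inder_lie hD hE⟩ := rfl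
  have e2 : (⟨_, h2⟩ : inder J) = ⟨_, lie_mem_inder b c⟩ + ⟨_, inder_lie hE hF⟩ := rfl
  have e3 := formInder_inv (⟨D, hD⟩ : inder J) ⟨E, hE⟩ ⟨F, hF⟩
  rw [e1, e2, map_add, map_add, LinearMap.add_apply, e3, formInder_lie, formInder_comm,
    formInder_lie]
  simp only [map_sub, LinearMap.sub_apply]
  rw [formJ_inder hE a c, formJ_inder hF a b]
  ring

theorem formJ_instrl (T : instrl J) (a b : J) : formJ J ((T : Module.End ℂ J) a) b =
    - formJ J a ((bar J T : Module.End ℂ J) b) := by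
  obtain ⟨c, D, hD, rfl⟩ := instrl_cases T
  rw [bar_add_inder c D hD]
  simp only [AddMemClass.coe_add, NegMemClass.coe_neg, coe_LI, LinearMap.add_apply,
    LinearMap.neg_apply, map_add, map_neg]
  rw [formJ_L, formJ_inder hD]
  ring

/-- The form on `TKK(J)` is invariant. -/
theorem form_inv (u v w : TKK J) : form J ⁅u, v⁆ w = form J u ⁅v, w⁆ := by
  obtain ⟨x1, T1, y1⟩ := u
  obtain ⟨x2, T2, y2⟩ := v
  obtain ⟨x3, T3, y3⟩ := w
  simp only [form_apply', TKK_lie, formI_add, formI_sub, map_sub, LinearMap.sub_apply]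
  rw [formI_comm T1 (_ + _), formI_add, formI_sub, formI_comm _ T1, formI_comm _ T1,
    formI_comm _ T1, formI_comm _ T3, formI_comm _ T3]
  simp only [formI_tri]
  rw [formI_inv]
  have h1 := formJ_instrl T1 x3 y2
  have h2 := formJ_instrl T2 x3 y1
  have h3 := formJ_instrl T2 x1 y3
  have h4 := formJ_instrl T3 x1 y2
  linear_combination h1 - h2 - h3 + h4

end Jordan

section Grading

variable {J : Type} [AddCommGroup J] [Module ℂ J] [JordanTorus J]

variable (J) in
/-- The component `Instrl(J)^λ = L_{J^λ} + ∑_{μ + ν = λ} [L_{J^μ}, L_{J^ν}]`. -/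
def instrlGr (l : GrLat) : Submodule ℂ (instrl J) :=
  Submodule.map (LI J) (gr J l) ⊔ Submodule.span ℂ {T | ∃ m n : GrLat, m + n = l ∧
    ∃ a ∈ gr J m, ∃ b ∈ gr J n, T = ⁅LI J a, LI J b⁆}

variable (J) in
/-- The component `TKK(J)^λ = J^λ ⊕ Instrl(J)^λ ⊕ J̄^λ`. -/
def tkkGr (l : GrLat) : Submodule ℂ (TKK J) :=
  (gr J l).prod ((instrlGr J l).prod (gr J l))

variable (J) in
/-- The diagonal operator `x^λ ↦ θ(λ) x^λ` on `J`. -/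
def Theta : (GrLat →+ ℂ) →ₗ[ℂ] Module.End ℂ J where
  toFun θ := JordanTorus.basis.constr ℂ fun l => θ (l : GrLat) • (JordanTorus.basis l : J)
  map_add' θ ψ := by
    refine JordanTorus.basis.ext fun l => ?_
    simp [Module.Basis.constr_basis, add_smul]
  map_smul' c θ := by
    refine JordanTorus.basis.ext fun l => ?_
    simp [Module.Basis.constr_basis, mul_smul]

theorem Theta_basis (θ : GrLat →+ ℂ) (l : JordanTorus.supp J) :
    Theta J θ (JordanTorus.basis l) = θ (l : GrLat) • JordanTorus.basis l := by
  simp [Theta, Module.Basis.constr_basis]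

theorem Theta_of_repr (θ : GrLat →+ ℂ) (l : GrLat) (a : J)
    (h : ∀ c, JordanTorus.basis.repr a c ≠ 0 → (c : GrLat) = l) : Theta J θ a = θ l • a := by
  have e := JordanTorus.basis.linearCombination_repr a
  rw [Finsupp.linearCombination_apply, Finsupp.sum] at e
  conv_lhs => rw [← e]
  conv_rhs => rw [← e]
  rw [map_sum, Finset.smul_sum]
  refine Finset.sum_congr rfl fun c hc => ?_
  rw [map_smul, Theta_basis, h c (Finsupp.mem_support_iff.1 hc), smul_comm]

theorem Theta_gr (θ : GrLat →+ ℂ) (l : GrLat) {a : J} (ha : a ∈ gr J l) :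
    Theta J θ a = θ l • a := by
  obtain ⟨c, rfl⟩ := Submodule.mem_span_singleton.1 ha
  rw [map_smul, smul_comm]
  congr 1
  unfold xElt
  split_ifs with h
  · exact Theta_basis θ ⟨l, h⟩
  · simp

theorem basis_mem_gr (l : JordanTorus.supp J) : (JordanTorus.basis l : J) ∈ gr J l := by
  refine Submodule.subset_span ?_
  simp [xElt]

theorem iSup_gr : ⨆ l, gr J l = ⊤ := by
  rw [eq_top_iff, ← JordanTorus.basis.span_eq, Submodule.span_le]
  rintro _ ⟨l, rfl⟩
  exact Submodule.mem_iSup_of_mem (l : GrLat) (basis_mem_gr l)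

/-- `x ↦ θ(λ) x` on `J^λ` is a derivation of `J`. -/
theorem Theta_L (θ : GrLat →+ ℂ) (a b : J) :
    Theta J θ (L J a b) = L J (Theta J θ a) b + L J a (Theta J θ b) := by
  have : (L J).compr₂ (Theta J θ) =
      (L J) ∘ₗ (Theta J θ) + (L J).compl₂ (Theta J θ) := by
    refine JordanTorus.basis.ext fun l => JordanTorus.basis.ext fun m => ?_
    simp only [LinearMap.compr₂_apply, LinearMap.add_apply, LinearMap.comp_apply,
      LinearMap.compl₂_apply, Theta_basis, map_smul, LinearMap.smul_apply]
    rw [← add_smul, ← map_add]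
    exact Theta_of_repr θ _ _ (JordanTorus.mul_graded l m)
  exact LinearMap.congr_fun₂ this a b

theorem lie_Theta_L (θ : GrLat →+ ℂ) (a : J) : ⁅Theta J θ, L J a⁆ = L J (Theta J θ a) := by
  ext b
  simp only [LieRing.of_associative_ring_bracket, LinearMap.sub_apply, Module.End.mul_apply]
  rw [Theta_L]; abel

@[simp] theorem Theta_one (θ : GrLat →+ ℂ) : Theta J θ (one J) = 0 := by
  rw [one, Theta_basis]; simp

theorem eps_Theta (θ : GrLat →+ ℂ) (a : J) : eps J (Theta J θ a) = 0 := by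
  have : eps J ∘ₗ Theta J θ = 0 := by
    refine JordanTorus.basis.ext fun l => ?_
    rw [LinearMap.comp_apply, Theta_basis, map_smul, eps, Module.Basis.coord_apply,
      Module.Basis.repr_self, LinearMap.zero_apply]
    by_cases h : l = ⟨0, JordanTorus.zero_mem⟩
    · subst h; simp
    · rw [Finsupp.single_eq_of_ne' h, smul_zero]
  exact LinearMap.congr_fun this a

theorem formJ_Theta (θ : GrLat →+ ℂ) (a b : J) :
    formJ J (Theta J θ a) b = - formJ J a (Theta J θ b) := by
  rw [eq_neg_iff_add_eq_zero, formJ_apply, formJ_apply, ← map_add, ← Theta_L, eps_Theta]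

theorem lie_Theta_inder (θ : GrLat →+ ℂ) {D : Module.End ℂ J} (hD : D ∈ inder J) :
    ⁅Theta J θ, D⁆ ∈ inder J := by
  induction hD using Submodule.span_induction with
  | mem D h =>
    obtain ⟨u, v, rfl⟩ := h
    rw [leibniz_lie, lie_Theta_L, lie_Theta_L]
    exact add_mem (lie_mem_inder _ _) (lie_mem_inder _ _)
  | zero => simp
  | add D E _ _ h1 h2 => rw [lie_add]; exact add_mem h1 h2
  | smul c D _ h => rw [lie_smul]; exact Submodule.smul_mem _ _ h

theorem lie_Theta_mem (θ : GrLat →+ ℂ) {T : Module.End ℂ J} (hT : T ∈ instrl J) :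
    ⁅Theta J θ, T⁆ ∈ instrl J := by
  obtain ⟨_, ⟨a, rfl⟩, D, hD, rfl⟩ := Submodule.mem_sup.1 hT
  rw [lie_add, lie_Theta_L]
  exact add_mem (L_mem _) (inder_mem (lie_Theta_inder θ hD))

variable (J) in
/-- The operator `T ↦ [θ, T]` on `Instrl(J)`. -/
def ThetaI (θ : GrLat →+ ℂ) : instrl J →ₗ[ℂ] instrl J where
  toFun T := ⟨⁅Theta J θ, (T : Module.End ℂ J)⁆, lie_Theta_mem θ T.2⟩
  map_add' S T := by ext1; simp only [AddMemClass.coe_add, lie_add]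
  map_smul' c T := by
    ext1
    change ⁅Theta J θ, c • (T : Module.End ℂ J)⁆ = c • ⁅Theta J θ, (T : Module.End ℂ J)⁆
    rw [lie_smul]

theorem coe_ThetaI (θ : GrLat →+ ℂ) (T : instrl J) :
    (ThetaI J θ T : Module.End ℂ J) = ⁅Theta J θ, (T : Module.End ℂ J)⁆ := rfl

theorem ThetaI_apply (θ : GrLat →+ ℂ) (T : instrl J) (a : J) :
    (ThetaI J θ T : Module.End ℂ J) a =
    Theta J θ ((T : Module.End ℂ J) a) - (T : Module.End ℂ J) (Theta J θ a) := rfl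

theorem ThetaI_LI (θ : GrLat →+ ℂ) (a : J) : ThetaI J θ (LI J a) = LI J (Theta J θ a) :=
  Subtype.ext (lie_Theta_L θ a)

theorem ThetaI_lie (θ : GrLat →+ ℂ) (S T : instrl J) :
    ThetaI J θ ⁅S, T⁆ = ⁅ThetaI J θ S, T⁆ + ⁅S, ThetaI J θ T⁆ :=
  Subtype.ext (leibniz_lie _ _ _)

theorem LPart_ThetaI (θ : GrLat →+ ℂ) (T : instrl J) :
    LPart J (ThetaI J θ T) = Theta J θ (LPart J T) := by
  rw [LPart_apply, ThetaI_apply, Theta_one, map_zero, sub_zero, LPart_apply]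

theorem ThetaI_bar (θ : GrLat →+ ℂ) (T : instrl J) :
    ThetaI J θ (bar J T) = bar J (ThetaI J θ T) := by
  rw [bar_apply, bar_apply, map_sub, map_smul, ThetaI_LI, LPart_ThetaI]

theorem ThetaI_tri (θ : GrLat →+ ℂ) (a b : J) :
    ThetaI J θ (tri J a b) = tri J (Theta J θ a) b + tri J a (Theta J θ b) := by
  rw [tri_apply, map_add, ThetaI_LI, ThetaI_lie, ThetaI_LI, ThetaI_LI, Theta_L, tri_apply,
    tri_apply, map_add]
  abel

variable (J) in
/-- The degree derivation `∂_θ` of `TKK(J)`, with `∂_θ(u) = θ(λ) u` for `u ∈ TKK(J)^λ`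
(see `degDer_apply`). -/
def degDer : (GrLat →+ ℂ) →ₗ[ℂ] Module.End ℂ (TKK J) where
  toFun θ := (Theta J θ).prodMap ((ThetaI J θ).prodMap (Theta J θ))
  map_add' θ ψ := by
    ext u
    all_goals simp [ThetaI, add_lie]
  map_smul' c θ := by
    ext u
    all_goals simp [ThetaI, smul_lie]

theorem degDer_def (θ : GrLat →+ ℂ) (u : TKK J) :
    degDer J θ u = (Theta J θ u.1, ThetaI J θ u.2.1, Theta J θ u.2.2) := rfl

theorem ThetaI_gr (θ : GrLat →+ ℂ) (l : GrLat) {T : instrl J} (hT : T ∈ instrlGr J l) :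
    ThetaI J θ T = θ l • T := by
  have : instrlGr J l ≤ LinearMap.ker (ThetaI J θ - θ l • LinearMap.id) := by
    refine sup_le ?_ (Submodule.span_le.2 ?_)
    · rintro _ ⟨a, ha, rfl⟩
      simp [ThetaI_LI, Theta_gr θ l ha]
    · rintro _ ⟨m, n, rfl, a, ha, b, hb, rfl⟩
      simp [ThetaI_LI, ThetaI_lie, Theta_gr θ m ha, Theta_gr θ n hb, add_smul]
  have h := this hT
  rwa [LinearMap.mem_ker, LinearMap.sub_apply, sub_eq_zero] at h

theorem degDer_apply (θ : GrLat →+ ℂ) (l : GrLat) {u : TKK J} (hu : u ∈ tkkGr J l) :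
    degDer J θ u = θ l • u := by
  obtain ⟨h1, h2, h3⟩ := hu
  rw [degDer_def, Theta_gr θ l h1, ThetaI_gr θ l h2, Theta_gr θ l h3]
  rfl

/-- `∂_θ` is a derivation. -/
theorem degDer_lie (θ : GrLat →+ ℂ) (u v : TKK J) :
    degDer J θ ⁅u, v⁆ = ⁅degDer J θ u, v⁆ + ⁅u, degDer J θ v⁆ := by
  refine Prod.ext ?_ (Prod.ext ?_ ?_)
  · simp only [degDer_def, TKK_lie, Prod.fst_add, map_sub, ThetaI_apply]
    abel
  · simp only [degDer_def, TKK_lie, Prod.fst_add, Prod.snd_add, map_sub, map_add, ThetaI_tri,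
      ThetaI_lie]
    abel
  · simp only [degDer_def, TKK_lie, Prod.snd_add, map_sub, ← ThetaI_bar, ThetaI_apply]
    abel

/-- `∂_θ` is skew for the form. -/
theorem form_degDer (θ : GrLat →+ ℂ) (u v : TKK J) :
    form J (degDer J θ u) v = - form J u (degDer J θ v) := by
  have hI : ∀ D E : inder J, formInder J ⟨_, lie_Theta_inder θ D.2⟩ E =
      - formInder J D ⟨_, lie_Theta_inder θ E.2⟩ := by
    intro D E
    induction E using inder_induction with
    | zero =>
      have : (⟨⁅Theta J θ, ((0 : inder J) : Module.End ℂ J)⁆,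
        lie_Theta_inder θ (0 : inder J).2⟩ : inder J) = 0 := by ext1; simp
      rw [this]; simp
    | add F G h1 h2 =>
      have : (⟨⁅Theta J θ, ((F + G : inder J) : Module.End ℂ J)⁆,
        lie_Theta_inder θ (F + G).2⟩ : inder J) =
          ⟨_, lie_Theta_inder θ F.2⟩ + ⟨_, lie_Theta_inder θ G.2⟩ := by
        ext1; simp
      rw [this, map_add, map_add, h1, h2]; ring
    | smul c F h =>
      have : (⟨⁅Theta J θ, ((c • F : inder J) : Module.End ℂ J)⁆,
        lie_Theta_inder θ (c • F).2⟩ : inder J) = c • ⟨_, lie_Theta_inder θ F.2⟩ := by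
        ext1; simp
      rw [this, map_smul, map_smul, h]; simp
    | lie a b =>
      have : (⟨⁅Theta J θ, ⁅L J a, L J b⁆⁆, lie_Theta_inder θ (lie_mem_inder a b)⟩ : inder J) =
          ⟨_, lie_mem_inder (Theta J θ a) b⟩ + ⟨_, lie_mem_inder a (Theta J θ b)⟩ := by
        ext1
        change ⁅Theta J θ, ⁅L J a, L J b⁆⁆ = ⁅L J (Theta J θ a), L J b⁆ +
          ⁅L J a, L J (Theta J θ b)⁆
        rw [← lie_Theta_L, ← lie_Theta_L, leibniz_lie]
      rw [this, formInder_lie, map_add, formInder_lie, formInder_lie]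
      simp only [LieRing.of_associative_ring_bracket, LinearMap.sub_apply, Module.End.mul_apply,
          map_sub]
      rw [formJ_Theta]
      ring
  have hd : ∀ T : instrl J, dPart J (ThetaI J θ T) = ⟨_, lie_Theta_inder θ (dPart J T).2⟩ := by
    intro T
    ext1
    change (dPart J (ThetaI J θ T) : Module.End ℂ J) = ⁅Theta J θ, (dPart J T : Module.End ℂ J)⁆
    rw [coe_dPart, coe_dPart, lie_sub, lie_Theta_L, LPart_ThetaI, coe_ThetaI]
  rw [form_apply, form_apply, degDer_def, degDer_def]
  dsimp only
  rw [hd, hd, hI, LPart_ThetaI, LPart_ThetaI, formJ_Theta, formJ_Theta θ (LPart J _),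
    formJ_Theta θ v.1]
  ring

theorem exists_hom_ne_zero {l : GrLat} (hl : l ≠ 0) : ∃ θ : GrLat →+ ℂ, θ l ≠ 0 := by
  by_cases h : l.1 = 0
  · refine ⟨(Int.castAddHom ℂ).comp (AddMonoidHom.snd ℤ ℤ), ?_⟩
    have : l.2 ≠ 0 := fun h' => hl (Prod.ext h h')
    simpa using this
  · exact ⟨(Int.castAddHom ℂ).comp (AddMonoidHom.fst ℤ ℤ), by simpa using h⟩

theorem form_gr {l m : GrLat} (h : l + m ≠ 0) {u v : TKK J} (hu : u ∈ tkkGr J l)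
    (hv : v ∈ tkkGr J m) : form J u v = 0 := by
  obtain ⟨θ, hθ⟩ := exists_hom_ne_zero h
  have := form_degDer θ u v
  rw [degDer_apply θ l hu, degDer_apply θ m hv, map_smul, map_smul, LinearMap.smul_apply,
    smul_eq_mul, smul_eq_mul] at this
  have h2 : θ (l + m) * form J u v = 0 := by rw [map_add]; linear_combination this
  exact (mul_eq_zero.1 h2).resolve_left hθ

theorem iSup_tkkGr : ⨆ l, tkkGr J l = ⊤ := by
  rw [eq_top_iff]
  have h1 : ∀ a : J, ((a, 0, 0) : TKK J) ∈ ⨆ l, tkkGr J l := by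
    intro a
    have ha : a ∈ ⨆ l, gr J l := by rw [iSup_gr]; trivial
    have : (⨆ l, gr J l) ≤ Submodule.comap (LinearMap.inl ℂ J (instrl J × J))
        (⨆ l, tkkGr J l) :=
      iSup_le fun l b hb => Submodule.mem_iSup_of_mem l ⟨hb, zero_mem _, zero_mem _⟩
    exact this ha
  have h3 : ∀ a : J, ((0, 0, a) : TKK J) ∈ ⨆ l, tkkGr J l := by
    intro a
    have ha : a ∈ ⨆ l, gr J l := by rw [iSup_gr]; trivial
    have : (⨆ l, gr J l) ≤ Submodule.comap
        (LinearMap.inr ℂ J (instrl J × J) ∘ₗ LinearMap.inr ℂ (instrl J) J)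
        (⨆ l, tkkGr J l) :=
      iSup_le fun l b hb => Submodule.mem_iSup_of_mem l ⟨zero_mem _, zero_mem _, hb⟩
    exact this ha
  let φ : instrl J →ₗ[ℂ] TKK J := LinearMap.inr ℂ J (instrl J × J) ∘ₗ LinearMap.inl ℂ (instrl J) J
  have hφ : ∀ l, instrlGr J l ≤ Submodule.comap φ (⨆ l, tkkGr J l) := fun l T hT =>
    Submodule.mem_iSup_of_mem l ⟨zero_mem _, hT, zero_mem _⟩
  have h2L : ∀ a : J, LI J a ∈ Submodule.comap φ (⨆ l, tkkGr J l) := by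
    intro a
    have ha : a ∈ ⨆ l, gr J l := by rw [iSup_gr]; trivial
    have : (⨆ l, gr J l) ≤ Submodule.comap (LI J) (Submodule.comap φ (⨆ l, tkkGr J l)) :=
      iSup_le fun l b hb => hφ l (Submodule.mem_sup_left ⟨b, hb, rfl⟩)
    exact this ha
  have h2D : ∀ a b : J, ⁅LI J a, LI J b⁆ ∈ Submodule.comap φ (⨆ l, tkkGr J l) := by
    intro a b
    let P := Submodule.comap φ (⨆ l, tkkGr J l)
    have ha : a ∈ ⨆ l, gr J l := by rw [iSup_gr]; trivial
    have hb : b ∈ ⨆ l, gr J l := by rw [iSup_gr]; trivial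
    change ⁅LI J a, LI J b⁆ ∈ P
    induction ha using Submodule.iSup_induction' with
    | zero => simp
    | add a a' _ _ h h' => rw [map_add, add_lie]; exact add_mem h h'
    | mem l a ha =>
      induction hb using Submodule.iSup_induction' with
      | zero => simp
      | add a a' _ _ h h' => rw [map_add, lie_add]; exact add_mem h h'
      | mem m b hb =>
        exact hφ (l + m) (Submodule.mem_sup_right (Submodule.subset_span
          ⟨l, m, rfl, a, ha, b, hb, rfl⟩))
  have h2 : ∀ T : instrl J, T ∈ Submodule.comap φ (⨆ l, tkkGr J l) := by
    intro T
    obtain ⟨a, D, hD, rfl⟩ := instrl_cases T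
    have : ∀ D : inder J, (⟨_, inder_mem D.2⟩ : instrl J) ∈
        Submodule.comap φ (⨆ l, tkkGr J l) := by
      intro D
      induction D using inder_induction with
      | zero => exact Submodule.zero_mem _
      | add D E h1 h2 =>
        have e : (⟨_, inder_mem (D + E).2⟩ : instrl J) =
          ⟨_, inder_mem D.2⟩ + ⟨_, inder_mem E.2⟩ := Subtype.ext rfl
        rw [e]
        exact Submodule.add_mem _ h1 h2
      | smul c D h =>
        have e : (⟨_, inder_mem (c • D).2⟩ : instrl J) = c • ⟨_, inder_mem D.2⟩ :=
          Subtype.ext rfl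
        rw [e]
        exact Submodule.smul_mem _ c h
      | lie a b =>
        have e : (⟨⁅L J a, L J b⁆, inder_mem (lie_mem_inder a b)⟩ : instrl J) =
          ⁅LI J a, LI J b⁆ := Subtype.ext rfl
        rw [e]
        exact h2D a b
    exact Submodule.add_mem (Submodule.comap φ (⨆ l, tkkGr J l)) (h2L a) (this ⟨D, hD⟩)
  rintro ⟨a, T, b⟩ -
  have h2' : ((0, T, 0) : TKK J) ∈ ⨆ l, tkkGr J l := h2 T
  have : ((a, T, b) : TKK J) = (a, 0, 0) + (0, T, 0) + (0, 0, b) := by simp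
  rw [this]
  exact Submodule.add_mem _ (Submodule.add_mem _ (h1 a) h2') (h3 b)

theorem degDer_injective : Function.Injective (degDer J) := by
  refine (injective_iff_map_eq_zero _).2 fun θ hθ => ?_
  have h : ∀ l ∈ JordanTorus.supp J, θ l = 0 := by
    intro l hl
    have := congrArg Prod.fst (LinearMap.congr_fun hθ ((JordanTorus.basis ⟨l, hl⟩, 0, 0) : TKK J))
    rw [degDer_def] at this
    dsimp only at this
    rw [Theta_basis] at this
    exact (smul_eq_zero.1 this).resolve_right (JordanTorus.basis.ne_zero _)
  have h2 : AddSubgroup.closure (JordanTorus.supp J) ≤ θ.ker :=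
    (AddSubgroup.closure_le _).2 h
  rw [JordanTorus.closure_supp] at h2
  exact AddMonoidHom.ext fun l => h2 (AddSubgroup.mem_top l)

end Grading

section Construction

variable (J : Type) [AddCommGroup J] [Module ℂ J] [JordanTorus J]

/-- The endomorphisms of `TKK(J)` of degree `λ`. -/
def endDeg (l : GrLat) : Submodule ℂ (Module.End ℂ (TKK J)) where
  carrier := {f | ∀ m, ∀ u ∈ tkkGr J m, f u ∈ tkkGr J (m + l)}
  add_mem' hf hg m u hu := add_mem (hf m u hu) (hg m u hu)
  zero_mem' _ _ _ := zero_mem _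
  smul_mem' c _ hf m u hu := Submodule.smul_mem _ c (hf m u hu)

/-- The centroid of `TKK(J)`. -/
def centroid : Set (Module.End ℂ (TKK J)) :=
  {χ | ∀ u v, χ ⁅u, v⁆ = ⁅χ u, v⁆ ∧ χ ⁅u, v⁆ = ⁅u, χ v⁆}

/-- The centroidal derivations: the span of the products `χ ∂_θ`, with `χ` in the centroid. -/
def CDer : Submodule ℂ (Module.End ℂ (TKK J)) :=
  Submodule.span ℂ {d | ∃ χ ∈ centroid J, ∃ θ : GrLat →+ ℂ, d = χ * degDer J θ}

/-- The skew centroidal derivations: those `d` in `CDer` with `(d u, u) = 0` for all `u`. -/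
def SCDer : Submodule ℂ (Module.End ℂ (TKK J)) where
  carrier := {d | d ∈ CDer J ∧ ∀ u, form J (d u) u = 0}
  add_mem' hf hg := ⟨add_mem hf.1 hg.1, fun u => by simp [hf.2 u, hg.2 u]⟩
  zero_mem' := ⟨zero_mem _, by simp⟩
  smul_mem' c _ hf := ⟨Submodule.smul_mem _ c hf.1, fun u => by simp [hf.2 u]⟩

variable {J}

theorem CDer_lie {d : Module.End ℂ (TKK J)} (hd : d ∈ CDer J) (u v : TKK J) :
    d ⁅u, v⁆ = ⁅d u, v⁆ + ⁅u, d v⁆ := by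
  induction hd using Submodule.span_induction with
  | mem d h =>
    obtain ⟨χ, hχ, θ, rfl⟩ := h
    simp only [Module.End.mul_apply]
    rw [degDer_lie, map_add, (hχ _ _).1, (hχ u _).2]
  | zero => simp
  | add d e _ _ h1 h2 => simp only [LinearMap.add_apply, h1, h2, add_lie, lie_add]; abel
  | smul c d _ h => simp only [LinearMap.smul_apply, h, smul_lie, lie_smul, smul_add]

theorem SCDer_skew {d : Module.End ℂ (TKK J)} (hd : d ∈ SCDer J) (u v : TKK J) :
    form J (d u) v = - form J u (d v) := by
  have h := hd.2 (u + v)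
  simp only [map_add, LinearMap.add_apply, hd.2 u, hd.2 v] at h
  rw [form_comm u (d v)]
  linear_combination h

variable (J) in
/-- The map `λ ↦ (θ ↦ θ(λ))`, where `∂_θ` runs through the degree derivations in `D`. With
`D^0 = {∂_θ ∈ D}` this is the evaluation map `ev : Λ → (D^0)^*`, `ev(λ)(∂_θ) = θ(λ)`. -/
def ev (D : LieSubalgebra ℂ (Module.End ℂ (TKK J))) (l : GrLat) :
    {θ : GrLat →+ ℂ // degDer J θ ∈ D} → ℂ :=
  fun θ => (θ : GrLat →+ ℂ) l

variable (J) in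
/-- The permissible subalgebras: graded subalgebras `D` of `SCDer(TKK(J))` such that
`ev : Λ → (D^0)^*` is injective with discrete image. -/
structure Permissible where
  D : LieSubalgebra ℂ (Module.End ℂ (TKK J))
  le_SCDer : D.toSubmodule ≤ SCDer J
  graded : D.toSubmodule ≤ ⨆ l, D.toSubmodule ⊓ endDeg J l
  ev_injective : Function.Injective (ev J D)
  ev_discrete : DiscreteTopology (Set.range (ev J D))

namespace Permissible

variable (P : Permissible J)

/-- The Lie algebra `D`. -/
def DAlg : Type := P.D

instance : LieRing P.DAlg := inferInstanceAs (LieRing P.D)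

instance : LieAlgebra ℂ P.DAlg := inferInstanceAs (LieAlgebra ℂ P.D)

/-- The inclusion of `D` in the endomorphisms of `TKK(J)`. -/
def toEnd : P.DAlg →ₗ[ℂ] Module.End ℂ (TKK J) := P.D.toSubmodule.subtype

theorem toEnd_mem (d : P.DAlg) : P.toEnd d ∈ P.D := Subtype.property (p := (· ∈ P.D)) d

theorem toEnd_lie (d e : P.DAlg) : P.toEnd ⁅d, e⁆ = P.toEnd d * P.toEnd e - P.toEnd e * P.toEnd d :=
  rfl

/-- The homogeneous component `D^λ`. -/
def Dgr (l : GrLat) : Submodule ℂ P.DAlg := (endDeg J l).comap P.toEnd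

/-- The functionals on `D` vanishing on `D^μ` for all `μ ≠ -λ`, that is, `(D^{-λ})^*`. -/
def dualGr (l : GrLat) : Submodule ℂ (Module.Dual ℂ P.DAlg) where
  carrier := {φ | ∀ m, m ≠ -l → ∀ d ∈ P.Dgr m, φ d = 0}
  add_mem' hf hg m hm d hd := by simp [hf m hm d hd, hg m hm d hd]
  zero_mem' _ _ _ _ := rfl
  smul_mem' c _ hf m hm d hd := by simp [hf m hm d hd]

/-- The graded dual `D^{gr*} = ∑_μ (D^μ)^*`, as a subspace of the dual of `D`. -/
def gradedDual : Submodule ℂ (Module.Dual ℂ P.DAlg) := ⨆ l, P.dualGr l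

/-- The graded dual `C = D^{gr*}` of `D`. -/
def C : Type := P.gradedDual

instance : AddCommGroup P.C := inferInstanceAs (AddCommGroup P.gradedDual)

instance : Module ℂ P.C := inferInstanceAs (Module ℂ P.gradedDual)

/-- An element of `D^{gr*}` as a linear functional on `D`. -/
def toDual : P.C →ₗ[ℂ] Module.Dual ℂ P.DAlg := P.gradedDual.subtype

theorem toDual_injective : Function.Injective P.toDual := Subtype.val_injective

theorem C_ext {c c' : P.C} (h : ∀ d, P.toDual c d = P.toDual c' d) : c = c' :=
  P.toDual_injective (LinearMap.ext h)

theorem toDual_mem (c : P.C) : P.toDual c ∈ P.gradedDual := Subtype.property c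

/-- A functional in the graded dual, as an element of `C`. -/
def mkC (φ : Module.Dual ℂ P.DAlg) (h : φ ∈ P.gradedDual) : P.C := ⟨φ, h⟩

@[simp] theorem toDual_mkC (φ : Module.Dual ℂ P.DAlg) (h : φ ∈ P.gradedDual) :
    P.toDual (P.mkC φ h) = φ := rfl

/-- The homogeneous component `C^λ = (D^{-λ})^*`. -/
def Cgr (l : GrLat) : Submodule ℂ P.C := (P.dualGr l).comap P.toDual

theorem iSup_Dgr : ⨆ l, P.Dgr l = ⊤ := by
  rw [eq_top_iff]
  rintro ⟨d, hd⟩ -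
  have h : (⨆ l, P.D.toSubmodule ⊓ endDeg J l) ≤
      Submodule.map P.toEnd (⨆ l, P.Dgr l) :=
    iSup_le fun l e he => ⟨⟨e, he.1⟩, Submodule.mem_iSup_of_mem l he.2, rfl⟩
  obtain ⟨e, he, rfl⟩ := h (P.graded hd)
  exact he

theorem Dgr_lie {l m : GrLat} {d e : P.DAlg} (hd : d ∈ P.Dgr l) (he : e ∈ P.Dgr m) :
    ⁅d, e⁆ ∈ P.Dgr (l + m) := by
  intro n u hu
  have h1 := hd _ _ (he n u hu)
  have h2 := he _ _ (hd n u hu)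
  rw [show n + m + l = n + (l + m) by abel] at h1
  rw [show n + l + m = n + (l + m) by abel] at h2
  exact sub_mem h1 h2

/-- The action `(d · φ)(d') = φ([d', d])` on the dual of `D`. -/
def dualAct : P.DAlg →ₗ[ℂ] Module.Dual ℂ P.DAlg →ₗ[ℂ] Module.Dual ℂ P.DAlg :=
  LinearMap.mk₂ ℂ
    (fun d φ => φ ∘ₗ
      { toFun := fun e => ⁅e, d⁆
        map_add' := fun _ _ => add_lie _ _ _
        map_smul' := fun _ _ => smul_lie _ _ _ })
    (by intros; ext; simp) (by intros; ext; simp) (by intros; ext; simp) (by intros; ext; simp)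

theorem dualAct_apply (d e : P.DAlg) (φ : Module.Dual ℂ P.DAlg) : P.dualAct d φ e = φ ⁅e, d⁆ := rfl

theorem dualAct_mem (d : P.DAlg) {φ : Module.Dual ℂ P.DAlg} (hφ : φ ∈ P.gradedDual) : P.dualAct d φ ∈ P.gradedDual := by
  have hd : d ∈ ⨆ l, P.Dgr l := by rw [iSup_Dgr]; trivial
  induction hd using Submodule.iSup_induction' with
  | zero => simp
  | add d e _ _ h1 h2 => rw [map_add, LinearMap.add_apply]; exact add_mem h1 h2
  | mem l d hd =>
    have : P.gradedDual ≤ Submodule.comap (P.dualAct d) P.gradedDual := by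
      refine iSup_le fun m ψ hψ => Submodule.mem_iSup_of_mem (m + l) ?_
      intro n hn e he
      rw [dualAct_apply]
      refine hψ (n + l) ?_ _ (P.Dgr_lie he hd)
      intro h
      exact hn (by rw [neg_add, ← h]; abel)
    exact this hφ

/-- The action of `D` on the graded dual, `(d · φ)(d') = φ([d', d])`. -/
def act : P.DAlg →ₗ[ℂ] P.C →ₗ[ℂ] P.C :=
  LinearMap.mk₂ ℂ (fun d c => P.mkC (P.dualAct d (P.toDual c)) (P.dualAct_mem d (P.toDual_mem c)))
    (by intros; apply P.C_ext; intro; simp) (by intros; apply P.C_ext; intro; simp)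
    (by intros; apply P.C_ext; intro; simp) (by intros; apply P.C_ext; intro; simp)

theorem act_apply (d e : P.DAlg) (c : P.C) :
    P.toDual (P.act d c) e = P.toDual c ⁅e, d⁆ := rfl

theorem cD_mem (u v : TKK J) : ((form J).flip v ∘ₗ LinearMap.applyₗ u) ∘ₗ P.toEnd ∈
    P.gradedDual := by
  have hu : u ∈ ⨆ l, tkkGr J l := by rw [iSup_tkkGr]; trivial
  have hv : v ∈ ⨆ l, tkkGr J l := by rw [iSup_tkkGr]; trivial
  induction hu using Submodule.iSup_induction' with
  | zero => simp
  | add u u' _ _ h h' =>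
    rw [map_add, LinearMap.comp_add, LinearMap.add_comp]; exact add_mem h h'
  | mem l u hu =>
    induction hv using Submodule.iSup_induction' with
    | zero => simp
    | add u u' _ _ h h' => rw [map_add, LinearMap.add_comp, LinearMap.add_comp]; exact add_mem h h'
    | mem m v hv =>
      refine Submodule.mem_iSup_of_mem (l + m) ?_
      intro n hn d hd
      refine form_gr ?_ (hd l u hu) hv
      intro h
      exact hn (eq_neg_of_add_eq_zero_left (by rw [← h]; abel))

/-- The central cocycle `c_D(u, v)(d) = (d u | v)`. -/
def cD : TKK J →ₗ[ℂ] TKK J →ₗ[ℂ] P.C :=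
  LinearMap.mk₂ ℂ (fun u v => P.mkC _ (P.cD_mem u v))
    (by intros; apply P.C_ext; intro; simp) (by intros; apply P.C_ext; intro; simp)
    (by intros; apply P.C_ext; intro; simp) (by intros; apply P.C_ext; intro; simp)

theorem cD_apply (u v : TKK J) (d : P.DAlg) : P.toDual (P.cD u v) d =
    form J (P.toEnd d u) v := rfl

end Permissible

/-- The affine cocycles on `D`. -/
structure AffineCocycle (P : Permissible J) where
  κ : P.DAlg →ₗ[ℂ] P.DAlg →ₗ[ℂ] P.C
  self : ∀ d, κ d d = 0
  cocycle : ∀ d₁ d₂ d₃, κ ⁅d₁, d₂⁆ d₃ + κ ⁅d₂, d₃⁆ d₁ + κ ⁅d₃, d₁⁆ d₂ =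
    P.act d₁ (κ d₂ d₃) + P.act d₂ (κ d₃ d₁) + P.act d₃ (κ d₁ d₂)
  graded : ∀ l m, ∀ d ∈ P.Dgr l, ∀ e ∈ P.Dgr m, κ d e ∈ P.Cgr (l + m)
  cyclic : ∀ d₁ d₂ d₃, P.toDual (κ d₁ d₂) d₃ = P.toDual (κ d₂ d₃) d₁
  zero : ∀ d ∈ P.Dgr 0, ∀ e, κ d e = 0

/-- The extended affine Lie algebra `E(𝔤, D, κ) = 𝔤 ⊕ D^{gr*} ⊕ D` with `𝔤 = TKK(J)`. -/
def EALA {P : Permissible J} (_ : AffineCocycle P) : Type := TKK J × P.C × P.DAlg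

namespace EALA

variable {P : Permissible J} (K : AffineCocycle P)

instance : AddCommGroup (EALA K) := inferInstanceAs (AddCommGroup (TKK J × P.C × P.DAlg))

instance : Module ℂ (EALA K) := inferInstanceAs (Module ℂ (TKK J × P.C × P.DAlg))

/-- The projection `E → 𝔤`. -/
def prG : EALA K →ₗ[ℂ] TKK J := LinearMap.fst ℂ (TKK J) (P.C × P.DAlg)

/-- The projection `E → D^{gr*}`. -/
def prC : EALA K →ₗ[ℂ] P.C := LinearMap.fst ℂ P.C P.DAlg ∘ₗ LinearMap.snd ℂ (TKK J) (P.C × P.DAlg)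

/-- The projection `E → D`. -/
def prD : EALA K →ₗ[ℂ] P.DAlg := LinearMap.snd ℂ P.C P.DAlg ∘ₗ LinearMap.snd ℂ (TKK J) (P.C × P.DAlg)

/-- The embedding `𝔤 → E`. -/
def inG : TKK J →ₗ[ℂ] EALA K := LinearMap.inl ℂ (TKK J) (P.C × P.DAlg)

/-- The embedding `D^{gr*} → E`. -/
def inC : P.C →ₗ[ℂ] EALA K := LinearMap.inr ℂ (TKK J) (P.C × P.DAlg) ∘ₗ LinearMap.inl ℂ P.C P.DAlg

/-- The embedding `D → E`. -/
def inD : P.DAlg →ₗ[ℂ] EALA K := LinearMap.inr ℂ (TKK J) (P.C × P.DAlg) ∘ₗ LinearMap.inr ℂ P.C P.DAlg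

variable {K}

theorem ext {a b : EALA K} (h1 : prG K a = prG K b) (h2 : prC K a = prC K b)
    (h3 : prD K a = prD K b) : a = b := Prod.ext h1 (Prod.ext h2 h3)

instance : Bracket (EALA K) (EALA K) where
  bracket a b :=
    ((⁅prG K a, prG K b⁆ + P.toEnd (prD K a) (prG K b) -
        P.toEnd (prD K b) (prG K a),
      P.cD (prG K a) (prG K b) + P.act (prD K a) (prC K b) - P.act (prD K b) (prC K a) +
        K.κ (prD K a) (prD K b),
      ⁅prD K a, prD K b⁆) : TKK J × P.C × P.DAlg)

theorem prG_lie (a b : EALA K) : prG K ⁅a, b⁆ = ⁅prG K a, prG K b⁆ +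
    P.toEnd (prD K a) (prG K b) - P.toEnd (prD K b) (prG K a) := rfl

theorem prC_lie (a b : EALA K) : prC K ⁅a, b⁆ = P.cD (prG K a) (prG K b) +
    P.act (prD K a) (prC K b) - P.act (prD K b) (prC K a) + K.κ (prD K a) (prD K b) := rfl

theorem prD_lie (a b : EALA K) : prD K ⁅a, b⁆ = ⁅prD K a, prD K b⁆ := rfl

theorem D_lie (d : P.DAlg) (u v : TKK J) : P.toEnd d ⁅u, v⁆ =
    ⁅P.toEnd d u, v⁆ + ⁅u, P.toEnd d v⁆ :=
  CDer_lie (P.le_SCDer (P.toEnd_mem d)).1 u v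

theorem D_skew (d : P.DAlg) (u v : TKK J) : form J (P.toEnd d u) v =
    - form J u (P.toEnd d v) :=
  SCDer_skew (P.le_SCDer (P.toEnd_mem d)) u v

theorem coe_D_lie (d e : P.DAlg) (u : TKK J) : P.toEnd ⁅d, e⁆ u =
    P.toEnd d (P.toEnd e u) -
    P.toEnd e (P.toEnd d u) := rfl

theorem cD_self (u : TKK J) : P.cD u u = 0 := by
  apply P.C_ext; intro d
  exact (P.le_SCDer (P.toEnd_mem d)).2 u

theorem κ_skew (d e : P.DAlg) : K.κ d e = - K.κ e d := by
  have := K.self (d + e)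
  simp only [map_add, LinearMap.add_apply, K.self, zero_add, add_zero] at this
  exact eq_neg_of_add_eq_zero_right this

theorem act_lie (d e : P.DAlg) (c : P.C) :
    P.act ⁅d, e⁆ c = P.act d (P.act e c) - P.act e (P.act d c) := by
  apply P.C_ext; intro f
  simp only [map_sub, LinearMap.sub_apply, Permissible.act_apply]
  rw [leibniz_lie f d e, ← lie_skew d ⁅f, e⁆, map_add, map_neg, sub_eq_add_neg]

theorem act_cD (d : P.DAlg) (u v : TKK J) : P.act d (P.cD u v) =
    P.cD (P.toEnd d u) v + P.cD u (P.toEnd d v) := by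
  apply P.C_ext; intro e
  simp only [map_add, AddMemClass.coe_add, LinearMap.add_apply, Permissible.act_apply, Permissible.cD_apply,
    Permissible.toEnd_lie, LinearMap.sub_apply,
    Module.End.mul_apply, map_sub]
  rw [D_skew d]
  ring

theorem cD_lie (u v w : TKK J) : P.cD u ⁅v, w⁆ = P.cD ⁅u, v⁆ w + P.cD v ⁅u, w⁆ := by
  apply P.C_ext; intro d
  simp only [map_add, AddMemClass.coe_add, LinearMap.add_apply, Permissible.cD_apply, D_lie, map_add]
  rw [← form_inv, ← form_inv _ u w, ← lie_skew u (P.toEnd d v), map_neg,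
    LinearMap.neg_apply]
  ring

instance : LieRing (EALA K) where
  add_lie a b c := by
    refine ext ?_ ?_ ?_
    · simp only [prG_lie, map_add, add_lie, AddMemClass.coe_add, LinearMap.add_apply]; abel
    · simp only [prC_lie, map_add, LinearMap.add_apply]; abel
    · simp only [prD_lie, map_add, add_lie]
  lie_add a b c := by
    refine ext ?_ ?_ ?_
    · simp only [prG_lie, map_add, lie_add, AddMemClass.coe_add, LinearMap.add_apply]; abel
    · simp only [prC_lie, map_add, LinearMap.add_apply]; abel
    · simp only [prD_lie, map_add, lie_add]
  lie_self a := by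
    refine ext ?_ ?_ ?_
    · simp [prG_lie]
    · simp [prC_lie, cD_self, K.self]
    · simp [prD_lie]
  leibniz_lie a b c := by
    refine ext ?_ ?_ ?_
    · simp only [prG_lie, prD_lie, map_add, lie_add, lie_sub, add_lie, sub_lie, map_sub, coe_D_lie,
        D_lie]
      rw [leibniz_lie (prG K a) (prG K b) (prG K c),
        ← lie_skew (P.toEnd (prD K b) (prG K a)) (prG K c),
        ← lie_skew (prG K b) (P.toEnd (prD K c) (prG K a))]
      abel
    · have hκ := K.cocycle (prD K a) (prD K b) (prD K c)
      have h1 := κ_skew (K := K) (prD K a) ⁅prD K b, prD K c⁆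
      have h2 := κ_skew (K := K) (prD K b) ⁅prD K a, prD K c⁆
      have h3 : K.κ ⁅prD K a, prD K c⁆ (prD K b) = - K.κ ⁅prD K c, prD K a⁆ (prD K b) := by
        rw [← lie_skew, map_neg, LinearMap.neg_apply]
      have h4 : P.act (prD K b) (K.κ (prD K a) (prD K c)) =
        - P.act (prD K b) (K.κ (prD K c) (prD K a)) := by rw [κ_skew, map_neg]
      simp only [prG_lie, prC_lie, prD_lie, map_add, map_sub, LinearMap.add_apply,
        LinearMap.sub_apply, act_lie, act_cD]
      have h5 : ∀ u v, P.cD u v = - P.cD v u := by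
        intro u v
        have := cD_self (P := P) (u + v)
        simp only [map_add, LinearMap.add_apply, cD_self, zero_add, add_zero] at this
        exact eq_neg_of_add_eq_zero_right this
      rw [cD_lie (prG K a) (prG K b) (prG K c), h1, h2, h3, h4,
        h5 (P.toEnd (prD K b) (prG K a)) (prG K c),
        h5 (prG K b) (P.toEnd (prD K c) (prG K a))]
      linear_combination (norm := module) -hκ
    · simp only [prD_lie, map_add]; rw [leibniz_lie]

instance : LieAlgebra ℂ (EALA K) where
  lie_smul c a b := by
    refine ext ?_ ?_ ?_
    · simp [prG_lie, smul_sub, smul_add]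
    · simp [prC_lie, smul_sub, smul_add]
    · simp [prD_lie]

/-- The form `(u₁ + c₁ + d₁, u₂ + c₂ + d₂) = (u₁, u₂) + c₁(d₂) + c₂(d₁)` on `E`. -/
def bilin (a b : EALA K) : ℂ :=
  form J (prG K a) (prG K b) + P.toDual (prC K a) (prD K b) +
    P.toDual (prC K b) (prD K a)

variable (K)

/-- The subalgebra `H = ℂ L_1 ⊕ (D^0)^* ⊕ D^0`, where `D^0 = {∂_θ ∈ D}`. -/
def H : Submodule ℂ (EALA K) :=
  (ℂ ∙ ((0, LI J (one J), 0) : TKK J)).comap (prG K) ⊓ (P.Cgr 0).comap (prC K) ⊓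
    ((LinearMap.range (degDer J)).comap P.toEnd).comap (prD K)

/-- The element `σ ∈ Λ` as a linear form on `H`: it sends `a L_1 + c + ∂_θ` to `θ(σ)`. -/
def latticeRoot (σ : GrLat) : Module.Dual ℂ (H K) where
  toFun h := (LinearEquiv.ofInjective (degDer J) degDer_injective).symm
    ⟨P.toEnd (prD K (h : EALA K)), h.2.2⟩ σ
  map_add' a b := by
    rw [← AddMonoidHom.add_apply, ← map_add]; rfl
  map_smul' c a := by
    rw [RingHom.id_apply, smul_eq_mul, ← smul_eq_mul, ← AddMonoidHom.smul_apply, ← map_smul]; rfl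

theorem latticeRoot_apply (σ : GrLat) (h : H K) (θ : GrLat →+ ℂ)
    (e : degDer J θ = P.toEnd (prD K (h : EALA K))) :
    latticeRoot K σ h = θ σ := by
  have : (⟨P.toEnd (prD K (h : EALA K)), h.2.2⟩ : LinearMap.range (degDer J)) =
      LinearEquiv.ofInjective (degDer J) degDer_injective θ := Subtype.ext e.symm
  change (LinearEquiv.ofInjective (degDer J) degDer_injective).symm _ σ = _
  rw [this, LinearEquiv.symm_apply_apply]

/-- The root space `E_α = {e | [h, e] = α(h) e for all h ∈ H}`. -/
def rootSpace (α : Module.Dual ℂ (H K)) : Submodule ℂ (EALA K) where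
  carrier := {e | ∀ h : H K, ⁅(h : EALA K), e⁆ = α h • e}
  add_mem' ha hb h := by rw [lie_add, ha h, hb h, smul_add]
  zero_mem' h := by rw [lie_zero, smul_zero]
  smul_mem' c _ ha h := by rw [lie_smul, ha h, smul_comm]

/-- The set `R^0` of isotropic roots: the `α` with `E_α ≠ 0` and `(α, α) = (t_α, t_α) = 0`, where
`t_α ∈ H` represents `α` through the form. -/
def isotropicRoots : Set (Module.Dual ℂ (H K)) :=
  {α | rootSpace K α ≠ ⊥ ∧ ∃ t : H K, (∀ h : H K, α h = bilin (h : EALA K) t) ∧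
    bilin (t : EALA K) t = 0}

/-- An element of `Instrl(J)`, seen in `E`. -/
def inI : instrl J →ₗ[ℂ] EALA K :=
  inG K ∘ₗ LinearMap.inr ℂ J (instrl J × J) ∘ₗ LinearMap.inl ℂ (instrl J) J

/-- The subspace `D^σ ⊕ C^σ` of `E`. -/
def DC (σ : GrLat) : Submodule ℂ (EALA K) := (P.Dgr σ).map (inD K) ⊔ (P.Cgr σ).map (inC K)

/-- The root space `E_σ`, for `σ ∈ Λ`. -/
def Egr (σ : GrLat) : Submodule ℂ (EALA K) := rootSpace K (latticeRoot K σ)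

/-- The element `L_{x^σ}` of `E`, which is zero when `σ` is not in the support of `J`. -/
def Lx (σ : GrLat) : EALA K := inI K (LI J (xElt J σ))

/-- The element `[L_{x^{σ+τ}}, L_{x^{-τ}}]` of `E`; the bracket is taken in `Instrl(J)`. -/
def brLx (σ τ : GrLat) : EALA K := inI K ⁅LI J (xElt J (σ + τ)), LI J (xElt J (-τ))⁆

end EALA

end Construction

section Semilattice

/-- A semilattice in `Λ` generating `Λ`: `0 ∈ S`, `S + 2Λ ⊆ S`, `⟨S⟩ = Λ`. -/
structure Semilattice where
  carrier : Set GrLat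
  zero_mem : 0 ∈ carrier
  add_two_smul_mem : ∀ s ∈ carrier, ∀ l : GrLat, s + (2 : ℤ) • l ∈ carrier
  closure_eq : AddSubgroup.closure carrier = ⊤

/-- The sublattice `2Λ`. -/
def twoLat : AddSubgroup GrLat := (zsmulAddGroupHom (2 : ℤ) : GrLat →+ GrLat).range

/-- The vector space with basis `x^σ`, `σ ∈ S`, underlying the Jordan torus `J_S`. -/
def JS (S : Semilattice) : Type := S.carrier →₀ ℂ

variable (S : Semilattice)

instance : AddCommGroup (JS S) := inferInstanceAs (AddCommGroup (S.carrier →₀ ℂ))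

instance : Module ℂ (JS S) := inferInstanceAs (Module ℂ (S.carrier →₀ ℂ))

/-- The basis `x^σ`, `σ ∈ S`. -/
def JS.basis : Module.Basis S.carrier ℂ (JS S) :=
  (Finsupp.basisSingleOne : Module.Basis S.carrier ℂ (S.carrier →₀ ℂ))

open Classical in
/-- `x^σ`, which is zero for `σ ∉ S`. -/
def JS.e (l : GrLat) : JS S := if h : l ∈ S.carrier then JS.basis S ⟨l, h⟩ else 0

open Classical in
/-- `Γ(σ, τ) = 1` if `σ, τ` lie in `S_0 ∪ S_i` for one of the cosets `S_i ⊆ S` of `S_0 = 2Λ`, and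
`Γ(σ, τ) = 0` otherwise. -/
def JS.Gam (l m : GrLat) : ℤ :=
  if l ∈ S.carrier ∧ m ∈ S.carrier ∧ (l ∈ twoLat ∨ m ∈ twoLat ∨ l - m ∈ twoLat) then 1 else 0

/-- The product `x^σ · x^τ = Γ(σ, τ) x^{σ + τ}` of `J_S`. -/
def JS.mul : JS S →ₗ[ℂ] JS S →ₗ[ℂ] JS S :=
  (JS.basis S).constr ℂ fun l => (JS.basis S).constr ℂ fun m =>
    (JS.Gam S l m : ℂ) • JS.e S ((l : GrLat) + m)

/-- The class modulo `2Λ`. -/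
def red (l : GrLat) : ZMod 2 × ZMod 2 := (l.1, l.2)

theorem red_add (l m : GrLat) : red (l + m) = red l + red m := by simp [red]

theorem red_sub (l m : GrLat) : red (l - m) = red l - red m := by simp [red]

theorem mem_twoLat (l : GrLat) : l ∈ twoLat ↔ red l = 0 := by
  constructor
  · rintro ⟨m, rfl⟩
    simp only [red, zsmulAddGroupHom_apply, Prod.smul_fst, Prod.smul_snd, smul_eq_mul, Int.cast_mul,
      Prod.mk_eq_zero]
    have : (2 : ZMod 2) = 0 := rfl
    simp [this]
  · intro h
    have h1 : ((l.1 : ℤ) : ZMod 2) = 0 := congrArg Prod.fst h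
    have h2 : ((l.2 : ℤ) : ZMod 2) = 0 := congrArg Prod.snd h
    obtain ⟨a, ha⟩ := (ZMod.intCast_zmod_eq_zero_iff_dvd _ 2).1 h1
    obtain ⟨b, hb⟩ := (ZMod.intCast_zmod_eq_zero_iff_dvd _ 2).1 h2
    exact ⟨(a, b), Prod.ext ha.symm hb.symm⟩

variable {S}

theorem mem_of_red {l m : GrLat} (h : red l = red m) (hl : l ∈ S.carrier) : m ∈ S.carrier := by
  have : m - l ∈ twoLat := by rw [mem_twoLat, red_sub, h, sub_self]
  obtain ⟨n, hn⟩ := this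
  have := S.add_two_smul_mem l hl n
  rwa [show l + (2 : ℤ) • n = m by rw [eq_sub_iff_add_eq] at hn; rw [← hn, add_comm]; rfl] at this

variable (S)

/-- The finite model of `Γ` on `Λ / 2Λ`. -/
def gamBar (s : ZMod 2 × ZMod 2 → Bool) (i j : ZMod 2 × ZMod 2) : ℤ :=
  if s i && s j && (i == 0 || j == 0 || i == j) then 1 else 0

open Classical in
/-- The cosets contained in `S`. -/
def sBar (i : ZMod 2 × ZMod 2) : Bool := decide (∃ l ∈ S.carrier, red l = i)

theorem sBar_red (l : GrLat) : sBar S (red l) = true ↔ l ∈ S.carrier := by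
  simp only [sBar, decide_eq_true_eq]
  exact ⟨fun ⟨m, hm, e⟩ => mem_of_red e hm, fun h => ⟨l, h, rfl⟩⟩

theorem sBar_zero : sBar S 0 = true := (sBar_red S 0).2 S.zero_mem

theorem Gam_eq (l m : GrLat) : JS.Gam S l m = gamBar (sBar S) (red l) (red m) := by
  unfold JS.Gam gamBar
  congr 1
  rw [eq_iff_iff]
  simp only [mem_twoLat, red_sub, sub_eq_zero, Bool.and_eq_true, sBar_red, Bool.or_eq_true,
    beq_iff_eq, or_assoc, and_assoc]

theorem gamBar_mem : ∀ s i j, s 0 = true → gamBar s i j ≠ 0 →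
    s (i + j) = true := by decide

theorem gamBar_assoc : ∀ s i j, s 0 = true →
    gamBar s i j * gamBar s (i + j) (-(i + j)) = gamBar s j (-(i + j)) * gamBar s i (-i) := by
  decide

set_option maxRecDepth 100000 in
theorem gamBar_jordan : ∀ s, s 0 = true → ∀ a b c d : ZMod 2 × ZMod 2,
    (gamBar s b c * gamBar s (b + c) d * gamBar s a (b + c + d) -
      gamBar s b c * gamBar s a d * gamBar s (b + c) (a + d)) +
    (gamBar s c a * gamBar s (c + a) d * gamBar s b (c + a + d) -
      gamBar s c a * gamBar s b d * gamBar s (c + a) (b + d)) +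
    (gamBar s a b * gamBar s (a + b) d * gamBar s c (a + b + d) -
      gamBar s a b * gamBar s c d * gamBar s (a + b) (c + d)) = 0 := by
  decide

variable {S}

theorem JS.mul_e (l m : GrLat) : JS.mul S (JS.e S l) (JS.e S m) =
    (JS.Gam S l m : ℂ) • JS.e S (l + m) := by
  by_cases hl : l ∈ S.carrier
  · by_cases hm : m ∈ S.carrier
    · have el : JS.e S l = JS.basis S ⟨l, hl⟩ := dif_pos hl
      have em : JS.e S m = JS.basis S ⟨m, hm⟩ := dif_pos hm
      rw [el, em, JS.mul, Module.Basis.constr_basis, Module.Basis.constr_basis]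
    · have em : JS.e S m = 0 := dif_neg hm
      have : JS.Gam S l m = 0 := if_neg fun h => hm h.2.1
      simp [em, this]
  · have el : JS.e S l = 0 := dif_neg hl
    have : JS.Gam S l m = 0 := if_neg fun h => hl h.1
    simp [el, this]

theorem JS.basis_eq (l : S.carrier) : JS.basis S l = JS.e S l := by
  rw [JS.e, dif_pos l.2]

theorem JS.Gam_comm (l m : GrLat) : JS.Gam S l m = JS.Gam S m l := by
  unfold JS.Gam
  congr 1
  rw [← neg_sub m l, neg_mem_iff, eq_iff_iff]
  tauto

theorem JS.mul_comm (a b : JS S) : JS.mul S a b = JS.mul S b a := by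
  have : JS.mul S = (JS.mul S).flip := by
    refine (JS.basis S).ext fun l => (JS.basis S).ext fun m => ?_
    rw [LinearMap.flip_apply, JS.basis_eq, JS.basis_eq, JS.mul_e, JS.mul_e, JS.Gam_comm, add_comm]
  exact LinearMap.congr_fun₂ this a b

theorem JS.mul_assoc_e (a b c d : GrLat) :
    (JS.mul S (JS.e S a) (JS.mul S (JS.mul S (JS.e S b) (JS.e S c)) (JS.e S d)) -
      JS.mul S (JS.mul S (JS.e S b) (JS.e S c)) (JS.mul S (JS.e S a) (JS.e S d))) +
    (JS.mul S (JS.e S b) (JS.mul S (JS.mul S (JS.e S c) (JS.e S a)) (JS.e S d)) -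
      JS.mul S (JS.mul S (JS.e S c) (JS.e S a)) (JS.mul S (JS.e S b) (JS.e S d))) +
    (JS.mul S (JS.e S c) (JS.mul S (JS.mul S (JS.e S a) (JS.e S b)) (JS.e S d)) -
      JS.mul S (JS.mul S (JS.e S a) (JS.e S b)) (JS.mul S (JS.e S c) (JS.e S d))) = 0 := by
  simp only [JS.mul_e, map_smul, LinearMap.smul_apply, smul_smul, Gam_eq, red_add]
  have h := gamBar_jordan (sBar S) (sBar_zero S) (red a) (red b) (red c) (red d)
  have h' := congrArg (Int.cast : ℤ → ℂ) h
  push_cast at h'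
  rw [show a + (b + c + d) = a + b + c + d by abel, show b + c + (a + d) = a + b + c + d by abel,
    show b + (c + a + d) = a + b + c + d by abel, show c + a + (b + d) = a + b + c + d by abel,
    show c + (a + b + d) = a + b + c + d by abel, show a + b + (c + d) = a + b + c + d by abel]
  rw [← sub_smul, ← sub_smul, ← sub_smul, ← add_smul, ← add_smul]
  convert zero_smul ℂ _ using 2
  linear_combination h'

theorem JS.induction {p : JS S → Prop} (a : JS S) (mem : ∀ l, p (JS.e S l)) (zero : p 0)
    (add : ∀ a b, p a → p b → p (a + b)) (smul : ∀ (r : ℂ) a, p a → p (r • a)) : p a := by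
  induction (JS.basis S).mem_span a using Submodule.span_induction with
  | mem x h => obtain ⟨l, rfl⟩ := h; rw [JS.basis_eq]; exact mem l
  | zero => exact zero
  | add x y _ _ hx hy => exact add x y hx hy
  | smul r x _ hx => exact smul r x hx

theorem JS.jordan_lin (a b c d : JS S) :
    (JS.mul S a (JS.mul S (JS.mul S b c) d) - JS.mul S (JS.mul S b c) (JS.mul S a d)) +
    (JS.mul S b (JS.mul S (JS.mul S c a) d) - JS.mul S (JS.mul S c a) (JS.mul S b d)) +
    (JS.mul S c (JS.mul S (JS.mul S a b) d) - JS.mul S (JS.mul S a b) (JS.mul S c d)) = 0 := by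
  induction a using JS.induction with
  | zero => simp
  | add x y h h' =>
    simp only [map_add, LinearMap.add_apply]; linear_combination (norm := module) h + h'
  | smul r x h =>
    simp only [map_smul, LinearMap.smul_apply]; linear_combination (norm := module) r • h
  | mem l =>
  induction b using JS.induction with
  | zero => simp
  | add x y h h' =>
    simp only [map_add, LinearMap.add_apply]; linear_combination (norm := module) h + h'
  | smul r x h =>
    simp only [map_smul, LinearMap.smul_apply]; linear_combination (norm := module) r • h
  | mem m =>
  induction c using JS.induction with
  | zero => simp
  | add x y h h' =>
    simp only [map_add, LinearMap.add_apply]; linear_combination (norm := module) h + h'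
  | smul r x h =>
    simp only [map_smul, LinearMap.smul_apply]; linear_combination (norm := module) r • h
  | mem n =>
  induction d using JS.induction with
  | zero => simp
  | add x y h h' =>
    simp only [map_add]; linear_combination (norm := module) h + h'
  | smul r x h =>
    simp only [map_smul]; linear_combination (norm := module) r • h
  | mem k => exact JS.mul_assoc_e l m n k

theorem JS.jordan (a b : JS S) :
    JS.mul S (JS.mul S a b) (JS.mul S a a) = JS.mul S a (JS.mul S b (JS.mul S a a)) := by
  have h := JS.jordan_lin a a a b
  have h2 : (3 : ℂ) • (JS.mul S a (JS.mul S (JS.mul S a a) b) -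
      JS.mul S (JS.mul S a a) (JS.mul S a b)) = 0 := by
    linear_combination (norm := module) h
  have h3 := sub_eq_zero.1 ((smul_eq_zero.1 h2).resolve_left three_ne_zero)
  rw [JS.mul_comm (JS.mul S a b), ← h3, JS.mul_comm b]

open Classical in
theorem JS.coord_e (l : GrLat) (m : S.carrier) :
    (JS.basis S).repr (JS.e S l) m = if l = m then 1 else 0 := by
  by_cases h : l ∈ S.carrier
  · rw [JS.e, dif_pos h, Module.Basis.repr_self, Finsupp.single_apply]
    simp only [Subtype.ext_iff]
  · rw [JS.e, dif_neg h, map_zero, Finsupp.zero_apply, if_neg]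
    rintro rfl
    exact h m.2

theorem JS.trace_e (a b c : GrLat) :
    (JS.basis S).coord ⟨0, S.zero_mem⟩ (JS.mul S (JS.mul S (JS.e S a) (JS.e S b)) (JS.e S c)) =
    (JS.basis S).coord ⟨0, S.zero_mem⟩ (JS.mul S (JS.e S a) (JS.mul S (JS.e S b) (JS.e S c))) := by
  simp only [JS.mul_e, map_smul, LinearMap.smul_apply, smul_smul, Module.Basis.coord_apply,
    JS.coord_e, smul_eq_mul, ← add_assoc]
  by_cases h : a + b + c = 0
  · rw [if_pos h, mul_one, mul_one]
    have hc : c = -(a + b) := (neg_eq_of_add_eq_zero_right h).symm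
    have hbc : b + c = -a := by rw [hc]; abel
    have hr : red c = -(red a + red b) := by rw [hc, ← red_add]; simp [red]
    have hr2 : red (b + c) = -red a := by rw [hbc]; simp [red]
    rw [Gam_eq, Gam_eq, Gam_eq, Gam_eq, hr2, red_add, hr]
    exact_mod_cast gamBar_assoc (sBar S) (red a) (red b) (sBar_zero S)
  · rw [if_neg h, mul_zero, mul_zero]

theorem JS.trace_assoc (a b c : JS S) :
    (JS.basis S).coord ⟨0, S.zero_mem⟩ (JS.mul S (JS.mul S a b) c) =
    (JS.basis S).coord ⟨0, S.zero_mem⟩ (JS.mul S a (JS.mul S b c)) := by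
  induction a using JS.induction with
  | zero => simp
  | add x y h h' => simp only [map_add, LinearMap.add_apply, h, h']
  | smul r x h => simp only [map_smul, LinearMap.smul_apply, h]
  | mem l =>
  induction b using JS.induction with
  | zero => simp
  | add x y h h' => simp only [map_add, LinearMap.add_apply, h, h']
  | smul r x h => simp only [map_smul, LinearMap.smul_apply, h]
  | mem m =>
  induction c using JS.induction with
  | zero => simp
  | add x y h h' => simp only [map_add, h, h']
  | smul r x h => simp only [map_smul, h]
  | mem n => exact JS.trace_e l m n

theorem JS.one_mul (a : JS S) : JS.mul S (JS.basis S ⟨0, S.zero_mem⟩) a = a := by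
  have : JS.mul S (JS.basis S ⟨0, S.zero_mem⟩) = LinearMap.id := by
    refine (JS.basis S).ext fun l => ?_
    rw [JS.basis_eq, JS.basis_eq, JS.mul_e, LinearMap.id_apply, zero_add]
    have : JS.Gam S 0 l = 1 := if_pos ⟨S.zero_mem, l.2, Or.inl twoLat.zero_mem⟩
    rw [this, Int.cast_one, one_smul]
  rw [this, LinearMap.id_apply]

instance : JordanTorus (JS S) where
  mul := JS.mul S
  mul_comm := JS.mul_comm
  jordan := JS.jordan
  supp := S.carrier
  basis := JS.basis S
  zero_mem := S.zero_mem
  one_mul := JS.one_mul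
  mul_graded a b c h := by
    by_contra hc
    apply h
    rw [JS.basis_eq, JS.basis_eq, JS.mul_e, map_smul, Finsupp.smul_apply, JS.coord_e,
      if_neg (Ne.symm hc), smul_zero]
  closure_supp := S.closure_eq
  trace_assoc := JS.trace_assoc

end Semilattice

section Quantum

/-- The space of the quantum torus `ℂ_q`, with basis `x^λ = x₁^{λ₁} x₂^{λ₂}`, `λ ∈ Λ`. It is the
algebra generated by `x₁^{±1}, x₂^{±1}` subject to `x₂ x₁ = q x₁ x₂`. -/
def QT (_ : ℂˣ) : Type := GrLat →₀ ℂ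

variable (q : ℂˣ)

instance : AddCommGroup (QT q) := inferInstanceAs (AddCommGroup (GrLat →₀ ℂ))

instance : Module ℂ (QT q) := inferInstanceAs (Module ℂ (GrLat →₀ ℂ))

/-- The basis `x^λ`. -/
def QT.basis : Module.Basis GrLat ℂ (QT q) :=
  (Finsupp.basisSingleOne : Module.Basis GrLat ℂ (GrLat →₀ ℂ))

/-- The structure constants `η(λ, μ) = q^{λ₂ μ₁}`. -/
def eta (l m : GrLat) : ℂˣ := q ^ (l.2 * m.1)

theorem eta_add_left (l m n : GrLat) : eta q (l + m) n = eta q l n * eta q m n := by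
  rw [eta, eta, eta, ← zpow_add, Prod.snd_add, add_mul]

theorem eta_add_right (l m n : GrLat) : eta q l (m + n) = eta q l m * eta q l n := by
  rw [eta, eta, eta, ← zpow_add, Prod.fst_add, mul_add]

/-- The product `x^λ x^μ = η(λ, μ) x^{λ + μ}`. -/
def QT.mul : QT q →ₗ[ℂ] QT q →ₗ[ℂ] QT q :=
  (QT.basis q).constr ℂ fun l => (QT.basis q).constr ℂ fun m =>
    (eta q l m : ℂ) • QT.basis q (l + m)

theorem QT.mul_basis (l m : GrLat) : QT.mul q (QT.basis q l) (QT.basis q m) =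
    (eta q l m : ℂ) • QT.basis q (l + m) := by
  rw [QT.mul, Module.Basis.constr_basis, Module.Basis.constr_basis]

theorem QT.induction {p : QT q → Prop} (a : QT q) (mem : ∀ l, p (QT.basis q l)) (zero : p 0)
    (add : ∀ a b, p a → p b → p (a + b)) (smul : ∀ (r : ℂ) a, p a → p (r • a)) : p a := by
  induction (QT.basis q).mem_span a using Submodule.span_induction with
  | mem x h => obtain ⟨l, rfl⟩ := h; exact mem l
  | zero => exact zero
  | add x y _ _ hx hy => exact add x y hx hy
  | smul r x _ hx => exact smul r x hx

theorem QT.mul_assoc' (a b c : QT q) :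
    QT.mul q (QT.mul q a b) c = QT.mul q a (QT.mul q b c) := by
  induction a using QT.induction with
  | zero => simp
  | add x y h h' => simp only [map_add, LinearMap.add_apply, h, h']
  | smul r x h => simp only [map_smul, LinearMap.smul_apply, h]
  | mem l =>
  induction b using QT.induction with
  | zero => simp
  | add x y h h' => simp only [map_add, LinearMap.add_apply, h, h']
  | smul r x h => simp only [map_smul, LinearMap.smul_apply, h]
  | mem m =>
  induction c using QT.induction with
  | zero => simp
  | add x y h h' => simp only [map_add, h, h']
  | smul r x h => simp only [map_smul, h]
  | mem n =>
    simp only [QT.mul_basis, map_smul, LinearMap.smul_apply, smul_smul, eta_add_left,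
      eta_add_right, Units.val_mul, add_assoc]
    congr 1
    ring

instance : Ring (QT q) :=
  { (inferInstance : AddCommGroup (QT q)) with
    mul := fun a b => QT.mul q a b
    one := QT.basis q 0
    mul_assoc := QT.mul_assoc' q
    left_distrib := fun a b c => map_add _ b c
    right_distrib := fun a b c => LinearMap.map_add₂ _ a b c
    zero_mul := fun a => LinearMap.map_zero₂ _ a
    mul_zero := fun a => map_zero _
    one_mul := fun a => by
      have : QT.mul q (QT.basis q 0) = LinearMap.id :=
        (QT.basis q).ext fun l => by simp [QT.mul_basis, eta]
      exact LinearMap.congr_fun this a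
    mul_one := fun a => by
      have : (QT.mul q).flip (QT.basis q 0) = LinearMap.id :=
        (QT.basis q).ext fun l => by simp [QT.mul_basis, eta]
      exact LinearMap.congr_fun this a }

theorem QT.mul_def (a b : QT q) : a * b = QT.mul q a b := rfl

theorem QT.one_def : (1 : QT q) = QT.basis q 0 := rfl

theorem QT.basis_mul (l m : GrLat) : QT.basis q l * QT.basis q m =
    (eta q l m : ℂ) • QT.basis q (l + m) := QT.mul_basis q l m

instance : IsScalarTower ℂ (QT q) (QT q) := ⟨fun c a b => by
  rw [smul_eq_mul, smul_eq_mul, QT.mul_def, QT.mul_def, map_smul, LinearMap.smul_apply]⟩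

instance : SMulCommClass ℂ (QT q) (QT q) := ⟨fun c a b => by
  rw [smul_eq_mul, smul_eq_mul, QT.mul_def, QT.mul_def, map_smul]⟩

theorem QT.half_two : (2⁻¹ : ℂ) • (2 : QT q) = 1 := by
  have h : (2 : QT q) = (2 : ℂ) • 1 := by rw [two_smul, one_add_one_eq_two]
  rw [h, smul_smul, inv_mul_cancel₀ two_ne_zero, one_smul]

instance : Invertible (2 : QT q) where
  invOf := (2⁻¹ : ℂ) • 1
  invOf_mul_self := by rw [smul_mul_assoc, one_mul, QT.half_two]
  mul_invOf_self := by rw [mul_smul_comm, mul_one, QT.half_two]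

/-- The relation `x₂ x₁ = q x₁ x₂`. -/
theorem QT.relation : QT.basis q (0, 1) * QT.basis q (1, 0) =
    (q : ℂ) • (QT.basis q (1, 0) * QT.basis q (0, 1)) := by
  simp [QT.basis_mul, eta]


theorem QT.one_eq : (1 : QT q) = QT.basis q 0 := rfl

/-- The commutation factor `f(λ, μ) = η(λ, μ) η(μ, λ)⁻¹`. -/
def commFactor (l m : GrLat) : ℂˣ := eta q l m * (eta q m l)⁻¹

/-- The radical `rad(f) = {λ | f(λ, μ) = 1 for all μ}`. -/
def radF : Set GrLat := {l | ∀ m, commFactor q l m = 1}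

/-- The product `x · y = (x y + y x) / 2` of the plus algebra of `ℂ_q`. -/
def plusMul : (QT q)ˢʸᵐ →ₗ[ℂ] (QT q)ˢʸᵐ →ₗ[ℂ] (QT q)ˢʸᵐ :=
  LinearMap.mk₂ ℂ (fun a b => a * b) (fun a b c => add_mul a b c)
    (fun r a b => by
      rw [SymAlg.mul_def, SymAlg.mul_def, ← SymAlg.sym_smul, SymAlg.unsym_smul, smul_mul_assoc,
        mul_smul_comm, ← smul_add, mul_smul_comm])
    (fun a b c => mul_add a b c)
    (fun r a b => by
      rw [SymAlg.mul_def, SymAlg.mul_def, ← SymAlg.sym_smul, SymAlg.unsym_smul, smul_mul_assoc,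
        mul_smul_comm, ← smul_add, mul_smul_comm])

/-- The underlying space of the plus algebra is that of `ℂ_q`. -/
def symEquiv : QT q ≃ₗ[ℂ] (QT q)ˢʸᵐ where
  toFun := SymAlg.sym
  invFun := SymAlg.unsym
  left_inv _ := rfl
  right_inv _ := rfl
  map_add' _ _ := rfl
  map_smul' _ _ := rfl

theorem plusMul_sym (a b : QT q) : plusMul q (symEquiv q a) (symEquiv q b) =
    (2⁻¹ : ℂ) • symEquiv q (a * b + b * a) := by
  change SymAlg.sym (((2⁻¹ : ℂ) • 1) * (a * b + b * a)) = _
  rw [smul_mul_assoc, one_mul]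
  rfl

theorem plusMul_comm (a b : (QT q)ˢʸᵐ) : plusMul q a b = plusMul q b a :=
  SymAlg.mul_comm a b

theorem plusMul_jordan (a b : (QT q)ˢʸᵐ) : plusMul q (plusMul q a b) (plusMul q a a) =
    plusMul q a (plusMul q b (plusMul q a a)) :=
  IsCommJordan.lmul_comm_rmul_rmul a b

/-- The basis `x^λ` of the plus algebra. -/
def plusBasis : Module.Basis GrLat ℂ (QT q)ˢʸᵐ := (QT.basis q).map (symEquiv q)

theorem plusMul_basis (l m : GrLat) : plusMul q (plusBasis q l) (plusBasis q m) =
    (2⁻¹ * ((eta q l m : ℂ) + eta q m l)) • plusBasis q (l + m) := by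
  simp only [plusBasis, Module.Basis.map_apply, plusMul_sym, QT.basis_mul, map_add, map_smul,
    add_comm m l]
  rw [← add_smul, smul_smul]

theorem plus_one_mul (a : (QT q)ˢʸᵐ) : plusMul q (plusBasis q 0) a = a := one_mul a

theorem coord_comm (a b : QT q) : (QT.basis q).coord 0 (a * b) =
    (QT.basis q).coord 0 (b * a) := by
  induction a using QT.induction with
  | zero => simp
  | add x y h h' => simp only [add_mul, mul_add, map_add, h, h']
  | smul r x h => simp only [smul_mul_assoc, mul_smul_comm, map_smul, h]
  | mem l =>
  induction b using QT.induction with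
  | zero => simp
  | add x y h h' => simp only [add_mul, mul_add, map_add, h, h']
  | smul r x h => simp only [smul_mul_assoc, mul_smul_comm, map_smul, h]
  | mem m =>
    rw [QT.basis_mul, QT.basis_mul, add_comm m l, map_smul, map_smul]
    by_cases h : l + m = 0
    · have : m = -l := (neg_eq_of_add_eq_zero_right h).symm
      subst this
      congr 2
      simp only [eta, Prod.fst_neg, Prod.snd_neg]
      congr 1
      ring
    · simp [Module.Basis.coord_apply, h]

theorem plus_trace (a b c : (QT q)ˢʸᵐ) :
    (plusBasis q).coord 0 (plusMul q (plusMul q a b) c) =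
    (plusBasis q).coord 0 (plusMul q a (plusMul q b c)) := by
  have e : ∀ u : QT q, (plusBasis q).coord 0 (symEquiv q u) = (QT.basis q).coord 0 u := by
    intro u
    simp [plusBasis, Module.Basis.coord_apply]
  obtain ⟨a, rfl⟩ := (symEquiv q).surjective a
  obtain ⟨b, rfl⟩ := (symEquiv q).surjective b
  obtain ⟨c, rfl⟩ := (symEquiv q).surjective c
  simp only [plusMul_sym, map_smul, LinearMap.smul_apply, e]
  congr 2
  simp only [mul_add, add_mul, map_add, mul_assoc]
  have h5 := coord_comm q b (a * c)
  have h6 := coord_comm q b (c * a)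
  simp only [mul_assoc] at h5 h6
  linear_combination h5 - h6

instance : JordanTorus (QT q)ˢʸᵐ where
  mul := plusMul q
  mul_comm := plusMul_comm q
  jordan := plusMul_jordan q
  supp := Set.univ
  basis := (plusBasis q).reindex (Equiv.Set.univ GrLat).symm
  zero_mem := Set.mem_univ 0
  one_mul a := by rw [Module.Basis.reindex_apply]; exact plus_one_mul q a
  mul_graded a b c h := by
    by_contra hc
    apply h
    rw [Module.Basis.reindex_apply, Module.Basis.reindex_apply, Module.Basis.repr_reindex_apply,
      plusMul_basis, map_smul, Finsupp.smul_apply, Module.Basis.repr_self, Finsupp.single_apply,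
      if_neg (fun e => hc ?_), smul_zero]
    exact e.symm
  closure_supp := by simp
  trace_assoc a b c := by
    simp only [Module.Basis.coord_apply, Module.Basis.repr_reindex_apply]
    exact plus_trace q a b c

/-- The right multiplication `r_σ(a) = a x^σ` by `x^σ` in `ℂ_q`. -/
def rMul (s : GrLat) : Module.End ℂ (QT q)ˢʸᵐ :=
  (symEquiv q).conj (LinearMap.mulRight ℂ (QT.basis q s))

theorem rMul_basis (s l : GrLat) : rMul q s (plusBasis q l) =
    (eta q l s : ℂ) • plusBasis q (l + s) := by
  simp [rMul, plusBasis, LinearEquiv.conj_apply, QT.basis_mul]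

end Quantum

section Hermitian

variable (ε : ℤˣ)

/-- The entry `q = ε = ±1` of the elementary quantum matrix. -/
def sgn : ℂˣ := Units.map (Int.castRingHom ℂ).toMonoidHom ε

theorem sgn_mul_self : sgn ε * sgn ε = 1 := by
  rw [sgn, ← map_mul, Int.units_mul_self, map_one]

theorem sgn_zpow_mul_self (n : ℤ) : sgn ε ^ n * sgn ε ^ n = 1 := by
  rw [← mul_zpow, sgn_mul_self, one_zpow]

/-- The involution of `ℂ_𝐞` (`x₂ x₁ = ε x₁ x₂`) with `x̄₁ = x₁` and `x̄₂ = x₂`; it sends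
`x^λ = x₁^{λ₁} x₂^{λ₂}` to `x₂^{λ₂} x₁^{λ₁} = ε^{λ₁ λ₂} x^λ`. -/
def hermInv : QT (sgn ε) →ₗ[ℂ] QT (sgn ε) :=
  (QT.basis (sgn ε)).constr ℂ fun l => ((sgn ε ^ (l.1 * l.2) : ℂˣ) : ℂ) • QT.basis (sgn ε) l

theorem hermInv_basis (l : GrLat) : hermInv ε (QT.basis (sgn ε) l) =
    ((sgn ε ^ (l.1 * l.2) : ℂˣ) : ℂ) • QT.basis (sgn ε) l := by
  rw [hermInv, Module.Basis.constr_basis]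

theorem hermInv_generators : hermInv ε (QT.basis (sgn ε) (1, 0)) = QT.basis (sgn ε) (1, 0) ∧
    hermInv ε (QT.basis (sgn ε) (0, 1)) = QT.basis (sgn ε) (0, 1) := by
  simp [hermInv_basis]

theorem hermInv_inv (a : QT (sgn ε)) : hermInv ε (hermInv ε a) = a := by
  induction a using QT.induction with
  | zero => simp
  | add x y h h' => simp only [map_add, h, h']
  | smul r x h => simp only [map_smul, h]
  | mem l =>
    rw [hermInv_basis, map_smul, hermInv_basis, smul_smul, ← Units.val_mul, sgn_zpow_mul_self,
      Units.val_one, one_smul]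

theorem hermInv_mul (a b : QT (sgn ε)) : hermInv ε (a * b) = hermInv ε b * hermInv ε a := by
  induction a using QT.induction with
  | zero => simp
  | add x y h h' => simp only [add_mul, mul_add, map_add, h, h']
  | smul r x h => simp only [smul_mul_assoc, mul_smul_comm, map_smul, h]
  | mem l =>
  induction b using QT.induction with
  | zero => simp
  | add x y h h' => simp only [add_mul, mul_add, map_add, h, h']
  | smul r x h => simp only [smul_mul_assoc, mul_smul_comm, map_smul, h]
  | mem m =>
    rw [hermInv_basis, hermInv_basis, smul_mul_smul_comm, QT.basis_mul, QT.basis_mul, map_smul, hermInv_basis,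
      smul_smul, smul_smul, add_comm m l]
    congr 1
    simp only [eta, ← Units.val_mul]
    congr 1
    rw [← zpow_add, ← zpow_add, ← zpow_add, Prod.fst_add, Prod.snd_add,
      show l.2 * m.1 + (l.1 + m.1) * (l.2 + m.2) =
        (m.1 * m.2 + l.1 * l.2 + m.2 * l.1) + (l.2 * m.1 + l.2 * m.1) by ring, zpow_add _ _ (_ + _),
      zpow_add _ (l.2 * m.1), sgn_zpow_mul_self, mul_one]

/-- The space `H(ℂ_𝐞, ¯) = {x ∈ ℂ_𝐞 | x̄ = x}`. -/
def Herm : Submodule ℂ (QT (sgn ε))ˢʸᵐ where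
  carrier := {a | hermInv ε (SymAlg.unsym a) = SymAlg.unsym a}
  add_mem' {a b} ha hb := by
    change hermInv ε (SymAlg.unsym a + SymAlg.unsym b) = SymAlg.unsym a + SymAlg.unsym b
    rw [map_add, ha, hb]
  zero_mem' := map_zero _
  smul_mem' c a ha := by
    change hermInv ε (c • SymAlg.unsym a) = c • SymAlg.unsym a
    rw [map_smul, ha]

theorem mem_Herm (a : QT (sgn ε)) : symEquiv _ a ∈ Herm ε ↔ hermInv ε a = a := Iff.rfl

theorem plusMul_mem_Herm {a b : (QT (sgn ε))ˢʸᵐ} (ha : a ∈ Herm ε) (hb : b ∈ Herm ε) :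
    plusMul _ a b ∈ Herm ε := by
  obtain ⟨a, rfl⟩ := (symEquiv _).surjective a
  obtain ⟨b, rfl⟩ := (symEquiv _).surjective b
  rw [mem_Herm] at ha hb
  rw [plusMul_sym, ← map_smul, mem_Herm, map_smul, map_add, hermInv_mul, hermInv_mul, ha, hb, add_comm]

/-- The Jordan product of `H(ℂ_𝐞, ¯)`, restricted from the plus algebra of `ℂ_𝐞`. -/
def hermMul : Herm ε →ₗ[ℂ] Herm ε →ₗ[ℂ] Herm ε :=
  LinearMap.mk₂ ℂ (fun a b : Herm ε => (⟨plusMul (sgn ε) a.1 b.1, plusMul_mem_Herm ε a.2 b.2⟩ : Herm ε))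
    (fun a b c => Subtype.ext (LinearMap.map_add₂ (plusMul (sgn ε)) a.1 b.1 c.1))
    (fun r a b => Subtype.ext (LinearMap.map_smul₂ (plusMul (sgn ε)) r a.1 b.1))
    (fun a b c => Subtype.ext (map_add (plusMul (sgn ε) a.1) b.1 c.1))
    (fun r a b => Subtype.ext (map_smul (plusMul (sgn ε) a.1) r b.1))

@[simp] theorem coe_hermMul (a b : Herm ε) :
    (hermMul ε a b : (QT (sgn ε))ˢʸᵐ) = plusMul _ (a : (QT (sgn ε))ˢʸᵐ) b := rfl

/-- The support of `H(ℂ_𝐞, ¯)`: the `λ` such that `x^λ` is fixed by the involution. -/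
def hermSupp : Set GrLat := {l | sgn ε ^ (l.1 * l.2) = 1}

theorem plusBasis_mem (l : hermSupp ε) : plusBasis (sgn ε) l ∈ Herm ε := by
  rw [plusBasis, Module.Basis.map_apply, mem_Herm, hermInv_basis, l.2, Units.val_one, one_smul]

theorem repr_hermInv (a : QT (sgn ε)) (l : GrLat) : (QT.basis (sgn ε)).repr (hermInv ε a) l =
    ((sgn ε ^ (l.1 * l.2) : ℂˣ) : ℂ) * (QT.basis (sgn ε)).repr a l := by
  induction a using QT.induction with
  | zero => simp
  | add x y h h' => simp only [map_add, Finsupp.add_apply, h, h', mul_add]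
  | smul r x h => simp only [map_smul, Finsupp.smul_apply, smul_eq_mul, h]; ring
  | mem m =>
    rw [hermInv_basis, map_smul, Finsupp.smul_apply, Module.Basis.repr_self, smul_eq_mul]
    by_cases h : m = l
    · rw [h]
    · rw [Finsupp.single_apply, if_neg h, mul_zero, mul_zero]

theorem hermBasis_li : LinearIndependent ℂ
    fun l : hermSupp ε => (⟨plusBasis (sgn ε) l, plusBasis_mem ε l⟩ : Herm ε) := by
  apply LinearIndependent.of_comp (Herm ε).subtype
  exact (plusBasis (sgn ε)).linearIndependent.comp _ Subtype.val_injective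

theorem hermBasis_span : ⊤ ≤ Submodule.span ℂ
    (Set.range fun l : hermSupp ε => (⟨plusBasis (sgn ε) l, plusBasis_mem ε l⟩ : Herm ε)) := by
  rintro ⟨a, ha⟩ -
  obtain ⟨a, rfl⟩ := (symEquiv _).surjective a
  have h0 : ∀ l, l ∉ hermSupp ε → (QT.basis (sgn ε)).repr a l = 0 := by
    intro l hl
    have h := repr_hermInv ε a l
    rw [(mem_Herm ε a).1 ha] at h
    by_contra hne
    exact hl (Units.ext (mul_right_cancel₀ hne (by rw [← h, Units.val_one, _root_.one_mul])))
  suffices h : symEquiv _ a ∈ (Submodule.span ℂ (Set.range fun l : hermSupp ε =>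
      (⟨plusBasis (sgn ε) l, plusBasis_mem ε l⟩ : Herm ε))).map (Herm ε).subtype by
    obtain ⟨b, hb, e⟩ := h
    rwa [show (⟨symEquiv _ a, ha⟩ : Herm ε) = b from Subtype.ext e.symm]
  rw [← (QT.basis (sgn ε)).linearCombination_repr a, Finsupp.linearCombination_apply, Finsupp.sum,
    map_sum]
  refine sum_mem fun l hl => ?_
  rw [map_smul]
  refine Submodule.smul_mem _ _ ?_
  have hl' : l ∈ hermSupp ε := by
    by_contra hn
    exact Finsupp.mem_support_iff.1 hl (h0 l hn)
  exact ⟨⟨plusBasis (sgn ε) l, plusBasis_mem ε ⟨l, hl'⟩⟩, Submodule.subset_span ⟨⟨l, hl'⟩, rfl⟩, rfl⟩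

/-- The basis of `H(ℂ_𝐞, ¯)` of the `x^λ` fixed by the involution. -/
def hermBasis : Module.Basis (hermSupp ε) ℂ (Herm ε) :=
  Module.Basis.mk (hermBasis_li ε) (hermBasis_span ε)

theorem hermBasis_coe (l : hermSupp ε) :
    (hermBasis ε l : (QT (sgn ε))ˢʸᵐ) = plusBasis (sgn ε) l := by
  rw [hermBasis, Module.Basis.mk_apply]

theorem hermBasis_repr (a : Herm ε) (l : hermSupp ε) :
    (hermBasis ε).repr a l = (plusBasis (sgn ε)).repr (a : (QT (sgn ε))ˢʸᵐ) l := by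
  have : (Finsupp.lapply l) ∘ₗ (hermBasis ε).repr.toLinearMap =
      Finsupp.lapply (l : GrLat) ∘ₗ (plusBasis (sgn ε)).repr.toLinearMap ∘ₗ (Herm ε).subtype := by
    refine (hermBasis ε).ext fun m => ?_
    simp [hermBasis_coe, Finsupp.single_apply, Subtype.ext_iff]
  exact LinearMap.congr_fun this a

theorem zero_mem_hermSupp : (0 : GrLat) ∈ hermSupp ε := by simp [hermSupp]

theorem hermSupp_closure : AddSubgroup.closure (hermSupp ε) = ⊤ := by
  rw [eq_top_iff]
  rintro ⟨a, b⟩ -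
  have e : ((a, b) : GrLat) = (a, 0) + (0, b) := by simp
  rw [e]
  exact add_mem (AddSubgroup.subset_closure (by simp [hermSupp]))
    (AddSubgroup.subset_closure (by simp [hermSupp]))

instance : JordanTorus (Herm ε) where
  mul := hermMul ε
  mul_comm a b := Subtype.ext (plusMul_comm _ _ _)
  jordan a b := Subtype.ext (plusMul_jordan _ _ _)
  supp := hermSupp ε
  basis := hermBasis ε
  zero_mem := zero_mem_hermSupp ε
  one_mul a := Subtype.ext (by rw [coe_hermMul, hermBasis_coe]; exact plus_one_mul _ _)
  mul_graded a b c h := by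
    by_contra hc
    apply h
    rw [hermBasis_repr, coe_hermMul, hermBasis_coe, hermBasis_coe, plusMul_basis, map_smul,
      Finsupp.smul_apply, Module.Basis.repr_self, Finsupp.single_apply, if_neg (Ne.symm hc),
      smul_zero]
  closure_supp := hermSupp_closure ε
  trace_assoc a b c := by
    simp only [Module.Basis.coord_apply, hermBasis_repr, coe_hermMul]
    exact plus_trace _ _ _ _

end Hermitian

end EllipticEALA

end

open EllipticEALA

/-!
Fix a Jordan torus `J` whose form pairs `x^l` and `x^{-l}` nontrivially, as it does in the three
families.

*Centroidal derivations.* An element of the centroid commutes with the grading element `L_1` of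
`TKK(J)`, so it acts on both copies of `J` as the multiplication by a central element
(`centroid_actsBy`). Hence the part of degree `l` of a centroidal derivation acts as
`L_{x^l} ∂_θ`, with `x^l` central unless `θ = 0`, and skewness forces `θ(l) = 0` (`SCDer_actsBy`).
As `Λ` has rank two, `D^l` and `C^l` have dimension at most one for `l ≠ 0`; the same description
shows that `D^l` and `D^{-l}` commute, so that `D` acts trivially on `C^0`
(`Permissible.act_Cgr_zero`).

*Root spaces.* Since `ev` is injective, the degree derivations in `D` separate the degrees, and a
simultaneous eigenvector for them is homogeneous (`mem_iSup_of_eigenvector`). Together with the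
action of `L_1` this gives `E_σ = Instrl(J)^σ ⊕ C^σ ⊕ D^σ` (`EALA.Egr_eq_map_sup`). An isotropic
root vanishes on `C^0`, then on `L_1`, and its values on `D^0` are those of some `σ ∈ Λ`;
conversely `σ` is represented by an element of `C^0`, a combination of the functionals
`d ↦` coefficient of `x^s` in `d(x^s)`, `s` in the support (`EALA.isotropicRoots_eq`).

*The three families.* It remains to describe `Instrl(J)^σ`, which is spanned by `L_{x^σ}` and the
`[L_{x^m}, L_{x^n}]` with `m + n = σ`. In each family the latter are all proportional to a single
operator. For `J_S` the structure constants depend only on classes modulo `2Λ`, and a nonzero class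
is a sum of two distinct nonzero classes in only one way. In `ℂ_q` one has
`[L_{x^m}, L_{x^n}] = ½ (η(m, n) - η(n, m)) (L_{x^σ} - r_σ)` (`QT.lie_L_plusBasis`), and the
hermitian case follows by restriction.
-/

noncomputable section

attribute [local instance 100] LieRing.ofAssociativeRing

namespace EllipticEALA

/-! ### Homogeneous components of a Jordan torus -/

section Components

variable {J : Type} [AddCommGroup J] [Module ℂ J] [JordanTorus J]

theorem xElt_of_mem {l : GrLat} (h : l ∈ JordanTorus.supp J) :
    xElt J l = JordanTorus.basis ⟨l, h⟩ := dif_pos h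

theorem xElt_of_notMem {l : GrLat} (h : l ∉ JordanTorus.supp J) : xElt J l = 0 := dif_neg h

theorem xElt_ne_zero {l : GrLat} (h : l ∈ JordanTorus.supp J) : xElt J l ≠ 0 := by
  rw [xElt_of_mem h]; exact JordanTorus.basis.ne_zero _

theorem basis_eq_xElt (l : JordanTorus.supp J) : (JordanTorus.basis l : J) = xElt J l :=
  (xElt_of_mem l.2).symm

variable (J) in
theorem xElt_zero : xElt J 0 = one J := xElt_of_mem JordanTorus.zero_mem

theorem xElt_mem_gr (l : GrLat) : xElt J l ∈ gr J l := Submodule.mem_span_singleton_self _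

theorem linearMap_ext_xElt {M : Type*} [AddCommGroup M] [Module ℂ M] {f g : J →ₗ[ℂ] M}
    (h : ∀ l, f (xElt J l) = g (xElt J l)) : f = g :=
  JordanTorus.basis.ext fun l => by rw [basis_eq_xElt]; exact h l

theorem mem_gr_of_repr {l : GrLat} {a : J}
    (h : ∀ c, JordanTorus.basis.repr a c ≠ 0 → (c : GrLat) = l) : a ∈ gr J l := by
  rw [← JordanTorus.basis.linearCombination_repr a, Finsupp.linearCombination_apply]
  refine sum_mem fun c hc => Submodule.smul_mem _ _ ?_
  rw [← h c (Finsupp.mem_support_iff.1 hc)]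
  exact basis_mem_gr c

theorem L_xElt_mem (l m : GrLat) : L J (xElt J l) (xElt J m) ∈ gr J (l + m) := by
  by_cases hl : l ∈ JordanTorus.supp J
  · by_cases hm : m ∈ JordanTorus.supp J
    · rw [xElt_of_mem hl, xElt_of_mem hm]
      exact mem_gr_of_repr (JordanTorus.mul_graded _ _)
    · rw [xElt_of_notMem hm, map_zero]; exact zero_mem _
  · rw [xElt_of_notMem hl, map_zero]; exact zero_mem _

open Classical in
variable (J) in
/-- The coefficient of `x^l`, zero when `l` is not in the support. -/
def coeff (l : GrLat) : J →ₗ[ℂ] ℂ :=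
  if h : l ∈ JordanTorus.supp J then JordanTorus.basis.coord ⟨l, h⟩ else 0

variable (J) in
/-- The projection of `J` onto `J^l`. -/
def proj (l : GrLat) : J →ₗ[ℂ] J := (coeff J l).smulRight (xElt J l)

theorem proj_apply (l : GrLat) (a : J) : proj J l a = coeff J l a • xElt J l := rfl

theorem coeff_xElt_self {l : GrLat} (h : l ∈ JordanTorus.supp J) : coeff J l (xElt J l) = 1 := by
  rw [coeff, dif_pos h, xElt_of_mem h, Module.Basis.coord_apply, Module.Basis.repr_self,
    Finsupp.single_eq_same]

theorem coeff_xElt_of_ne {l m : GrLat} (h : m ≠ l) : coeff J l (xElt J m) = 0 := by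
  by_cases hl : l ∈ JordanTorus.supp J
  · by_cases hm : m ∈ JordanTorus.supp J
    · rw [coeff, dif_pos hl, xElt_of_mem hm, Module.Basis.coord_apply, Module.Basis.repr_self,
        Finsupp.single_apply, if_neg fun e => h (congrArg Subtype.val e)]
    · rw [xElt_of_notMem hm, map_zero]
  · rw [coeff, dif_neg hl, LinearMap.zero_apply]

theorem coeff_of_mem_gr_of_ne {l m : GrLat} (h : m ≠ l) {a : J} (ha : a ∈ gr J m) :
    coeff J l a = 0 := by
  obtain ⟨c, rfl⟩ := Submodule.mem_span_singleton.1 ha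
  rw [map_smul, coeff_xElt_of_ne h, smul_zero]

theorem proj_of_mem_gr {l : GrLat} {a : J} (ha : a ∈ gr J l) : proj J l a = a := by
  obtain ⟨c, rfl⟩ := Submodule.mem_span_singleton.1 ha
  rw [map_smul, proj_apply]
  by_cases hl : l ∈ JordanTorus.supp J
  · rw [coeff_xElt_self hl, one_smul]
  · rw [xElt_of_notMem hl, smul_zero]

theorem proj_of_mem_gr_of_ne {l m : GrLat} (h : m ≠ l) {a : J} (ha : a ∈ gr J m) :
    proj J l a = 0 := by
  rw [proj_apply, coeff_of_mem_gr_of_ne h ha, zero_smul]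

theorem proj_L_xElt (l m : GrLat) (z : J) :
    proj J (l + m) (L J z (xElt J m)) = L J (proj J l z) (xElt J m) := by
  have : proj J (l + m) ∘ₗ (L J).flip (xElt J m) = (L J).flip (xElt J m) ∘ₗ proj J l := by
    refine linearMap_ext_xElt fun k => ?_
    simp only [LinearMap.comp_apply, LinearMap.flip_apply]
    by_cases h : k = l
    · rw [h, proj_of_mem_gr (L_xElt_mem l m), proj_of_mem_gr (xElt_mem_gr l)]
    · rw [proj_of_mem_gr_of_ne (fun e => h (add_right_cancel e)) (L_xElt_mem k m),
        proj_of_mem_gr_of_ne h (xElt_mem_gr k), map_zero, LinearMap.zero_apply]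
  exact LinearMap.congr_fun this z

/-- The elements `z` of `J` whose multiplication operator commutes with all the multiplication
operators. -/
def IsCentral (z : J) : Prop := ∀ a b, L J z (L J a b) = L J a (L J z b)

theorem IsCentral.smul {z : J} (hz : IsCentral z) (c : ℂ) : IsCentral (c • z) := fun a b => by
  simp only [map_smul, LinearMap.smul_apply, hz a b]

/-- The homogeneous components of a central element are central. -/
theorem IsCentral.proj {z : J} (hz : IsCentral z) (l : GrLat) : IsCentral (proj J l z) := by
  have : (L J).compr₂ (L J (EllipticEALA.proj J l z)) =
      (L J).compl₂ (L J (EllipticEALA.proj J l z)) := by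
    refine linearMap_ext_xElt fun m => linearMap_ext_xElt fun n => ?_
    simp only [LinearMap.compr₂_apply, LinearMap.compl₂_apply]
    obtain ⟨c, hc⟩ := Submodule.mem_span_singleton.1 (L_xElt_mem (J := J) m n)
    have e : EllipticEALA.proj J (l + (m + n)) (L J z (L J (xElt J m) (xElt J n))) =
        L J (EllipticEALA.proj J l z) (L J (xElt J m) (xElt J n)) := by
      rw [← hc, map_smul, map_smul, map_smul, proj_L_xElt]
    rw [← e, hz, L_comm (xElt J m), show l + (m + n) = l + n + m by abel, proj_L_xElt,
      proj_L_xElt, L_comm]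
  exact LinearMap.congr_fun₂ this

end Components

/-! ### Centroidal derivations -/

section Derivations

theorem eq_zero_of_eq_neg {M : Type*} [AddCommGroup M] [Module ℂ M] {a : M} (h : a = -a) : a = 0 := by
  have : (2 : ℂ) • a = 0 := by rw [two_smul]; nth_rw 2 [h]; exact add_neg_cancel a
  exact (smul_eq_zero.1 this).resolve_left two_ne_zero

variable {J : Type} [AddCommGroup J] [Module ℂ J] [JordanTorus J]

/-- The endomorphism `d` of `TKK(J)` preserves the two copies of `J` and acts as `f` on both. -/
def ActsBy (d : Module.End ℂ (TKK J)) (f : Module.End ℂ J) : Prop :=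
  ∀ a, d (a, 0, 0) = (f a, 0, 0) ∧ d (0, 0, a) = (0, 0, f a)

theorem ActsBy.add {d e : Module.End ℂ (TKK J)} {f g : Module.End ℂ J} (hd : ActsBy d f)
    (he : ActsBy e g) : ActsBy (d + e) (f + g) := fun a => by
  simp only [LinearMap.add_apply, (hd a).1, (hd a).2, (he a).1, (he a).2, Prod.mk_add_mk, add_zero,
    and_self]

theorem ActsBy.sub {d e : Module.End ℂ (TKK J)} {f g : Module.End ℂ J} (hd : ActsBy d f)
    (he : ActsBy e g) : ActsBy (d - e) (f - g) := fun a => by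
  simp only [LinearMap.sub_apply, (hd a).1, (hd a).2, (he a).1, (he a).2, Prod.mk_sub_mk, sub_zero,
    and_self]

theorem ActsBy.smul {d : Module.End ℂ (TKK J)} {f : Module.End ℂ J} (hd : ActsBy d f) (c : ℂ) :
    ActsBy (c • d) (c • f) := fun a => by
  simp [(hd a).1, (hd a).2]

theorem ActsBy.mul {d e : Module.End ℂ (TKK J)} {f g : Module.End ℂ J} (hd : ActsBy d f)
    (he : ActsBy e g) : ActsBy (d * e) (f * g) := fun a => by
  simp [(hd (g a)).1, (he a).1, (hd (g a)).2, (he a).2]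

theorem actsBy_degDer (θ : GrLat →+ ℂ) : ActsBy (degDer J θ) (Theta J θ) := fun a => by
  simp [degDer_def]

theorem LI_one_coe : (LI J (one J) : Module.End ℂ J) = 1 := by
  ext a; simp

theorem LPart_LI (a : J) : LPart J (LI J a) = a := by rw [LPart_apply, coe_LI, L_one']

theorem LI_injective : Function.Injective (LI J) := fun a b h => by
  rw [← LPart_LI a, h, LPart_LI]

theorem LI_one_lie (T : instrl J) : ⁅LI J (one J), T⁆ = 0 := by
  apply Subtype.ext
  rw [LieSubalgebra.coe_bracket, LI_one_coe, LieRing.of_associative_ring_bracket, one_mul,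
    mul_one, sub_self]
  rfl

theorem bar_LI (a : J) : bar J (LI J a) = - LI J a := by
  rw [bar_apply, LPart_LI]; module

theorem tri_one_left (a : J) : tri J (one J) a = LI J a := by
  rw [tri_apply, LI_one_lie, L_one, add_zero]

theorem LPart_tri (a b : J) : LPart J (tri J a b) = L J a b := by
  rw [LPart_apply, tri_coe_apply]; simp [L_comm b a]

/-- `L_1` is the grading element of `J ⊕ Instrl(J) ⊕ J̄`. -/
theorem LI_one_lie_TKK (u : TKK J) : ⁅((0, LI J (one J), 0) : TKK J), u⁆ = (u.1, 0, -u.2.2) := by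
  rw [TKK_lie]
  simp [LI_one_lie, bar_LI]

theorem LI_lie_left (a b : J) : ⁅((0, LI J a, 0) : TKK J), ((b, 0, 0) : TKK J)⁆ =
    (L J a b, 0, 0) := by
  rw [TKK_lie]; simp

theorem left_lie_right (a b : J) : ⁅((a, 0, 0) : TKK J), ((0, 0, b) : TKK J)⁆ =
    (0, tri J a b, 0) := by
  rw [TKK_lie]; simp

/-- An element of the centroid acts on the two copies of `J` as the multiplication by a central
element, its value at the unit. -/
theorem centroid_actsBy {χ : Module.End ℂ (TKK J)} (hχ : χ ∈ centroid J) :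
    ∃ z, IsCentral z ∧ ActsBy χ (L J z) := by
  -- the eigenvalues `1`, `0`, `-1` of `L_1` separate the three summands of `TKK(J)`
  have h1 : ∀ a, χ (a, 0, 0) = ((χ (a, 0, 0)).1, 0, 0) := by
    intro a
    have h := (hχ (0, LI J (one J), 0) (a, 0, 0)).2
    rw [LI_one_lie_TKK, LI_one_lie_TKK] at h
    simp only [neg_zero] at h
    have h2 := congrArg (fun u : TKK J => u.2.1) h
    have h3 := congrArg (fun u : TKK J => u.2.2) h
    exact Prod.ext rfl (Prod.ext h2 (eq_zero_of_eq_neg h3))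
  have h3 : ∀ b, χ (0, 0, b) = (0, 0, (χ (0, 0, b)).2.2) := by
    intro b
    have h := (hχ (0, LI J (one J), 0) (0, 0, b)).2
    rw [LI_one_lie_TKK, LI_one_lie_TKK] at h
    have e : ((0, 0, -b) : TKK J) = -(0, 0, b) := by simp
    simp only [e, map_neg] at h
    have h1 := congrArg (fun u : TKK J => u.1) h
    have h2 := congrArg (fun u : TKK J => u.2.1) h
    exact Prod.ext (eq_zero_of_eq_neg h1.symm) (Prod.ext (neg_eq_zero.1 h2) rfl)
  have hL : ∀ a b, (χ (L J a b, 0, 0)).1 = L J a (χ (b, 0, 0)).1 := by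
    intro a b
    have h := (hχ (0, LI J a, 0) (b, 0, 0)).2
    rw [LI_lie_left, h1 b, LI_lie_left] at h
    rw [h]
  have hz : ∀ a, (χ (a, 0, 0)).1 = L J (χ (one J, 0, 0)).1 a := by
    intro a
    rw [L_comm, ← hL, L_one']
  refine ⟨(χ (one J, 0, 0)).1, fun a b => ?_, fun a => ⟨?_, ?_⟩⟩
  · rw [← hz, hL, hz]
  · rw [h1 a, hz]
  · have h := hχ (one J, 0, 0) (0, 0, a)
    rw [h.1] at h
    have h := h.2
    rw [h1, h3 a, left_lie_right, left_lie_right, tri_one_left] at h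
    have h := congrArg (fun u : TKK J => LPart J u.2.1) h
    simp only [LPart_tri, LPart_LI] at h
    rw [h3 a, ← h]

/-- The component of degree `l` of a centroidal derivation is `L_{x^l} ∂_θ` for some `θ`, where
`x^l` is central unless `θ = 0`. -/
theorem CDer_actsBy {d : Module.End ℂ (TKK J)} (hd : d ∈ CDer J) :
    ∃ f, ActsBy d f ∧ ∀ l, ∃ θ : GrLat →+ ℂ, (θ = 0 ∨ IsCentral (xElt J l)) ∧
      ∀ m, proj J (l + m) (f (xElt J m)) = θ m • L J (xElt J l) (xElt J m) := by
  induction hd using Submodule.span_induction with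
  | mem d h =>
    obtain ⟨χ, hχ, ψ, rfl⟩ := h
    obtain ⟨z, hz, hχz⟩ := centroid_actsBy hχ
    refine ⟨L J z * Theta J ψ, hχz.mul (actsBy_degDer ψ), fun l =>
      ⟨coeff J l z • ψ, ?_, fun m => ?_⟩⟩
    · by_cases hc : coeff J l z = 0
      · left; rw [hc, zero_smul]
      · right
        have := (hz.proj l).smul (coeff J l z)⁻¹
        rwa [proj_apply, smul_smul, inv_mul_cancel₀ hc, one_smul] at this
    · rw [Module.End.mul_apply, Theta_gr ψ m (xElt_mem_gr m), map_smul, map_smul, proj_L_xElt,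
        proj_apply, map_smul, LinearMap.smul_apply, smul_smul, AddMonoidHom.smul_apply,
        smul_eq_mul, mul_comm]
  | zero => exact ⟨0, fun a => ⟨rfl, rfl⟩, fun l => ⟨0, Or.inl rfl, fun m => by simp⟩⟩
  | add d e _ _ h1 h2 =>
    obtain ⟨f, hf, hf'⟩ := h1
    obtain ⟨g, hg, hg'⟩ := h2
    refine ⟨f + g, hf.add hg, fun l => ?_⟩
    obtain ⟨θ, hθ, hθ'⟩ := hf' l
    obtain ⟨ψ, hψ, hψ'⟩ := hg' l
    refine ⟨θ + ψ, ?_, fun m => ?_⟩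
    · rcases hθ with rfl | h
      · rwa [zero_add]
      · exact Or.inr h
    · rw [LinearMap.add_apply, map_add, hθ', hψ', AddMonoidHom.add_apply, add_smul]
  | smul c d _ h =>
    obtain ⟨f, hf, hf'⟩ := h
    refine ⟨c • f, hf.smul c, fun l => ?_⟩
    obtain ⟨θ, hθ, hθ'⟩ := hf' l
    refine ⟨c • θ, ?_, fun m => ?_⟩
    · rcases hθ with rfl | h
      · left; rw [smul_zero]
      · exact Or.inr h
    · rw [LinearMap.smul_apply, map_smul, hθ', AddMonoidHom.smul_apply, smul_assoc]

variable (J) in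
/-- The form of `J` pairs `x^l` and `x^{-l}` nontrivially, for every `l` in the support. -/
def NondegenerateForm : Prop :=
  ∀ l ∈ JordanTorus.supp J, formJ J (xElt J l) (xElt J (-l)) ≠ 0

theorem form_left_right (a b : J) : form J (a, 0, 0) (0, 0, b) = formJ J a b := by
  rw [form_apply]; simp

/-- A skew centroidal derivation of degree `l` is `L_{x^l} ∂_θ` with `θ(l) = 0`. -/
theorem SCDer_actsBy (hJ : NondegenerateForm J) {d : Module.End ℂ (TKK J)} (hd : d ∈ SCDer J)
    {l : GrLat} (hl : d ∈ endDeg J l) :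
    ∃ θ : GrLat →+ ℂ, θ l = 0 ∧ (θ = 0 ∨ IsCentral (xElt J l)) ∧
      ActsBy d (L J (xElt J l) * Theta J θ) := by
  obtain ⟨f, hf, hf'⟩ := CDer_actsBy hd.1
  obtain ⟨θ, hθ, hθ'⟩ := hf' l
  have hfθ : f = L J (xElt J l) * Theta J θ := by
    refine linearMap_ext_xElt fun m => ?_
    have h := hl m (xElt J m, 0, 0) ⟨xElt_mem_gr m, zero_mem _, zero_mem _⟩
    rw [(hf _).1] at h
    rw [Module.End.mul_apply, Theta_gr θ m (xElt_mem_gr m), map_smul, ← hθ', proj_of_mem_gr]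
    rw [add_comm]
    exact h.1
  rw [hfθ] at hf
  by_cases hs : l ∈ JordanTorus.supp J
  · refine ⟨θ, ?_, hθ, hf⟩
    -- skewness on `x^0` in `J` and `x^{-l}` in `J̄` reads `θ(l) (x^l, x^{-l}) = 0`
    have h := SCDer_skew hd (one J, 0, 0) (0, 0, xElt J (-l))
    rw [(hf _).1, (hf _).2, form_left_right, form_left_right, Module.End.mul_apply,
      Module.End.mul_apply, Theta_one, map_zero, map_zero, LinearMap.zero_apply,
      Theta_gr θ (-l) (xElt_mem_gr _), map_smul, map_smul, formJ_apply, L_one, map_neg, neg_smul,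
      neg_neg, smul_eq_mul] at h
    exact (mul_eq_zero.1 h.symm).resolve_right (hJ l hs)
  · -- here `x^l = 0`, so `d` acts as zero and `θ` may be replaced by `0`
    refine ⟨0, rfl, Or.inl rfl, ?_⟩
    rw [xElt_of_notMem hs, map_zero, zero_mul] at hf
    rwa [map_zero, mul_zero]

/-- A centroidal derivation vanishing on the two copies of `J` is zero, as these generate
`TKK(J)`. -/
theorem CDer_eq_zero {d : Module.End ℂ (TKK J)} (hd : d ∈ CDer J) (h : ActsBy d 0) : d = 0 := by
  have h1 : ∀ a, d (a, 0, 0) = 0 := fun a => (h a).1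
  have h3 : ∀ a, d (0, 0, a) = 0 := fun a => (h a).2
  have htri : ∀ a b, d (0, tri J a b, 0) = 0 := by
    intro a b
    rw [← left_lie_right, CDer_lie hd, h1, h3, zero_lie, lie_zero, add_zero]
  have hLI : ∀ a, d (0, LI J a, 0) = 0 := by
    intro a
    rw [← tri_one_left]; exact htri _ _
  let φ : instrl J →ₗ[ℂ] TKK J :=
    d ∘ₗ LinearMap.inr ℂ J (instrl J × J) ∘ₗ LinearMap.inl ℂ (instrl J) J
  have hφ : ∀ a b, φ ⁅LI J a, LI J b⁆ = 0 := by
    intro a b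
    have e : ⁅LI J a, LI J b⁆ = tri J a b - LI J (L J a b) := by rw [tri_apply]; abel
    rw [e, map_sub, show φ (tri J a b) = 0 from htri a b, show φ (LI J _) = 0 from hLI _, sub_zero]
  have hD : ∀ D : inder J, φ ⟨_, inder_mem D.2⟩ = 0 := by
    intro D
    induction D using inder_induction with
    | lie a b => exact hφ a b
    | zero => exact map_zero φ
    | add D E h h' =>
      exact (map_add φ ⟨_, inder_mem D.2⟩ ⟨_, inder_mem E.2⟩).trans (by rw [h, h', add_zero])
    | smul c D h => exact (map_smul φ c ⟨_, inder_mem D.2⟩).trans (by rw [h, smul_zero])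
  have h2 : ∀ T, d (0, T, 0) = 0 := by
    intro T
    obtain ⟨a, D, hD', rfl⟩ := instrl_cases T
    exact (map_add φ (LI J a) D).trans (by
      rw [show φ (LI J a) = 0 from hLI a, show φ D = 0 from hD ⟨_, hD'⟩, add_zero])
  refine LinearMap.ext fun u => ?_
  have e : u = (u.1, 0, 0) + ((0, u.2.1, 0) + (0, 0, u.2.2)) :=
    Prod.ext (by simp) (Prod.ext (by simp) (by simp))
  rw [e, map_add, map_add, h1, h2, h3]
  simp

theorem Theta_comm (θ ψ : GrLat →+ ℂ) : Theta J θ * Theta J ψ = Theta J ψ * Theta J θ := by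
  refine linearMap_ext_xElt fun m => ?_
  simp only [Module.End.mul_apply, Theta_gr _ m (xElt_mem_gr m), map_smul]
  rw [smul_comm]

theorem Theta_comm_L {θ : GrLat →+ ℂ} {l : GrLat} (h : θ l = 0) :
    Theta J θ * L J (xElt J l) = L J (xElt J l) * Theta J θ := by
  ext a
  rw [Module.End.mul_apply, Theta_L, Theta_gr θ l (xElt_mem_gr l), h, zero_smul, map_zero,
    LinearMap.zero_apply, zero_add, Module.End.mul_apply]

theorem IsCentral.L_comm_L {z : J} (hz : IsCentral z) (a : J) : L J z * L J a = L J a * L J z :=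
  LinearMap.ext fun b => hz a b

/-- A homomorphism `Λ → ℂ` vanishing at `l ≠ 0` is proportional to `m ↦ l₁ m₂ - l₂ m₁`. -/
theorem exists_eq_smul_of_apply_eq_zero {l : GrLat} (hl : l ≠ 0) {θ : GrLat →+ ℂ} (h : θ l = 0) :
    ∃ t : ℂ, ∀ m : GrLat, θ m = t * (l.1 * m.2 - l.2 * m.1) := by
  have hm : ∀ m : GrLat, θ m = m.1 * θ (1, 0) + m.2 * θ (0, 1) := by
    intro m
    have e : m = m.1 • (1, 0) + m.2 • (0, 1) := by simp
    conv_lhs => rw [e]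
    rw [map_add, map_zsmul, map_zsmul, zsmul_eq_mul, zsmul_eq_mul]
  have h0 := hm l
  rw [h] at h0
  by_cases h1 : l.1 = 0
  · have h2 : (l.2 : ℂ) ≠ 0 := by
      intro e
      exact hl (Prod.ext h1 (by exact_mod_cast e))
    refine ⟨- θ (1, 0) / l.2, fun m => ?_⟩
    rw [h1] at h0 ⊢
    have h3 : θ (0, 1) = 0 := by
      simpa [h2] using h0.symm
    rw [hm m, h3]
    field_simp
    push_cast
    ring
  · have h2 : (l.1 : ℂ) ≠ 0 := by exact_mod_cast h1
    refine ⟨θ (0, 1) / l.1, fun m => ?_⟩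
    rw [hm m]
    field_simp
    linear_combination (-(m.1 : ℂ)) * h0

end Derivations

/-! ### Simultaneous eigenvectors -/

/-- If the operators `T i` act on `V l` by the scalars `w i l`, then a simultaneous eigenvector in
the sum of the `V l`, with eigenvalues `a i`, lies in the sum of those `V l` on which the
eigenvalues are the `a i`. Independence of the `V l` is not needed. -/
theorem mem_iSup_of_eigenvector {M ι κ : Type*} [AddCommGroup M] [Module ℂ M]
    {V : κ → Submodule ℂ M} {T : ι → Module.End ℂ M} {w : ι → κ → ℂ}
    (hT : ∀ i l, ∀ v ∈ V l, T i v = w i l • v) {a : ι → ℂ} {u : M} (hu : u ∈ ⨆ l, V l)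
    (h : ∀ i, T i u = a i • u) : u ∈ ⨆ l, ⨆ (_ : ∀ i, w i l = a i), V l := by
  classical
  set W : Submodule ℂ M := ⨆ l, ⨆ (_ : ∀ i, w i l = a i), V l with hW
  have hTV : ∀ i l, V l ≤ (V l).comap (T i) := fun i l v hv => by
    rw [Submodule.mem_comap, hT i l v hv]; exact Submodule.smul_mem _ _ hv
  have hTW : ∀ i, W ≤ W.comap (T i) := fun i => iSup₂_le fun l hl =>
    (hTV i l).trans (Submodule.comap_mono (le_iSup₂_of_le l hl le_rfl))
  obtain ⟨s, hs⟩ := (Submodule.mem_iSup_iff_exists_finset).1 hu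
  have key : ∀ s : Finset κ, u ∈ (⨆ l ∈ s, V l) ⊔ W → u ∈ W := by
    intro s
    induction s using Finset.induction_on with
    | empty => intro hu; simpa using hu
    | insert l s _ ih =>
      intro hu
      refine ih ?_
      rw [Finset.iSup_insert, sup_assoc] at hu
      by_cases hl : ∀ i, w i l = a i
      · have hV : V l ≤ (⨆ l ∈ s, V l) ⊔ W := le_sup_of_le_right (le_iSup₂_of_le l hl le_rfl)
        exact sup_le hV le_rfl hu
      · push Not at hl
        obtain ⟨i, hi⟩ := hl
        have hTX : (⨆ l ∈ s, V l) ⊔ W ≤ ((⨆ l ∈ s, V l) ⊔ W).comap (T i) :=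
          sup_le (iSup₂_le fun m hm => (hTV i m).trans
            (Submodule.comap_mono (le_sup_of_le_left (le_iSup₂_of_le m hm le_rfl))))
            ((hTW i).trans (Submodule.comap_mono le_sup_right))
        obtain ⟨v, hv, x, hx, rfl⟩ := Submodule.mem_sup.1 hu
        -- `T i - w i l` kills `v` and multiplies `v + x` by a nonzero scalar
        have e : (a i - w i l) • (v + x) = T i x - w i l • x := by
          rw [sub_smul, ← h i, map_add, hT i l v hv, smul_add]; abel
        rw [← Submodule.smul_mem_iff _ (sub_ne_zero.2 (Ne.symm hi)), e]
        exact sub_mem (hTX hx) (Submodule.smul_mem _ _ hx)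
  exact key s (Submodule.mem_sup_left hs)

/-! ### The subalgebra `D` and its graded dual -/

section Dual

variable {J : Type} [AddCommGroup J] [Module ℂ J] [JordanTorus J]

theorem tkk_linearMap_ext {M : Type*} [AddCommGroup M] [Module ℂ M] {f g : TKK J →ₗ[ℂ] M}
    (h : ∀ l, ∀ u ∈ tkkGr J l, f u = g u) : f = g := by
  refine LinearMap.ext fun u => ?_
  have hu : u ∈ ⨆ l, tkkGr J l := by rw [iSup_tkkGr]; trivial
  exact (iSup_le fun l v hv => h l v hv : (⨆ l, tkkGr J l) ≤ LinearMap.eqLocus f g) hu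

theorem degDer_LI_one (θ : GrLat →+ ℂ) : degDer J θ (0, LI J (one J), 0) = 0 := by
  rw [degDer_def]; simp [ThetaI_LI]

/-- `L_1` has degree `0`, so the centroidal derivations kill it. -/
theorem CDer_LI_one {d : Module.End ℂ (TKK J)} (hd : d ∈ CDer J) :
    d (0, LI J (one J), 0) = 0 := by
  induction hd using Submodule.span_induction with
  | mem d h => obtain ⟨χ, _, θ, rfl⟩ := h; rw [Module.End.mul_apply, degDer_LI_one, map_zero]
  | zero => rfl
  | add d e _ _ h1 h2 => rw [LinearMap.add_apply, h1, h2, add_zero]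
  | smul c d _ h => rw [LinearMap.smul_apply, h, smul_zero]

namespace Permissible

variable (P : Permissible J)

/-- The set of the `θ` with `∂_θ ∈ D`. -/
abbrev DegIdx : Type := {θ : GrLat →+ ℂ // degDer J θ ∈ P.D}

/-- The degree derivation `∂_θ`, as an element of `D`. -/
def deg (θ : P.DegIdx) : P.DAlg := ⟨degDer J θ.1, θ.2⟩

theorem toEnd_deg (θ : P.DegIdx) : P.toEnd (P.deg θ) = degDer J θ.1 := rfl

theorem toEnd_injective : Function.Injective P.toEnd := Subtype.val_injective

theorem toEnd_mem_SCDer (d : P.DAlg) : P.toEnd d ∈ SCDer J := P.le_SCDer (P.toEnd_mem d)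

theorem deg_mem (θ : P.DegIdx) : P.deg θ ∈ P.Dgr 0 := fun m u hu => by
  rw [toEnd_deg, degDer_apply _ m hu, add_zero]
  exact Submodule.smul_mem _ _ hu

theorem deg_lie (θ : P.DegIdx) {l : GrLat} {d : P.DAlg} (hd : d ∈ P.Dgr l) :
    ⁅P.deg θ, d⁆ = θ.1 l • d := by
  apply P.toEnd_injective
  rw [toEnd_lie, map_smul, toEnd_deg]
  refine tkk_linearMap_ext fun m u hu => ?_
  rw [LinearMap.sub_apply, Module.End.mul_apply, Module.End.mul_apply,
    degDer_apply _ _ (hd m u hu), degDer_apply _ m hu, map_smul, LinearMap.smul_apply, map_add,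
    add_smul]
  abel

theorem dual_ext {f g : Module.Dual ℂ P.DAlg} (h : ∀ l, ∀ d ∈ P.Dgr l, f d = g d) : f = g := by
  refine LinearMap.ext fun u => ?_
  have hu : u ∈ ⨆ l, P.Dgr l := by rw [iSup_Dgr]; trivial
  exact (iSup_le fun l v hv => h l v hv : (⨆ l, P.Dgr l) ≤ LinearMap.eqLocus f g) hu

theorem C_ext_Dgr {c c' : P.C} (h : ∀ l, ∀ d ∈ P.Dgr l, P.toDual c d = P.toDual c' d) : c = c' :=
  P.toDual_injective (P.dual_ext h)

theorem act_deg (θ : P.DegIdx) {l : GrLat} {c : P.C} (hc : c ∈ P.Cgr l) :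
    P.act (P.deg θ) c = θ.1 l • c := by
  refine P.C_ext_Dgr fun m d hd => ?_
  rw [act_apply, ← lie_skew, P.deg_lie θ hd, map_neg, map_smul, map_smul, LinearMap.smul_apply]
  by_cases h : m = -l
  · rw [h, map_neg, neg_smul, neg_neg]
  · rw [hc m h d hd, smul_zero, smul_zero, neg_zero]

theorem iSup_Cgr : ⨆ l, P.Cgr l = ⊤ := by
  rw [eq_top_iff]
  rintro ⟨c, hc⟩ -
  have h : P.gradedDual ≤ Submodule.map P.toDual (⨆ l, P.Cgr l) :=
    iSup_le fun l φ hφ => ⟨P.mkC φ (Submodule.mem_iSup_of_mem l hφ),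
      Submodule.mem_iSup_of_mem l hφ, rfl⟩
  obtain ⟨e, he, h'⟩ := h hc
  rwa [show (⟨c, hc⟩ : P.C) = e from P.toDual_injective h'.symm]

theorem eq_of_forall_deg {l m : GrLat} (h : ∀ θ : P.DegIdx, θ.1 l = θ.1 m) : l = m :=
  P.ev_injective (funext h)

/-- A simultaneous eigenvector for the degree derivations, with the eigenvalues of degree `s`, is
homogeneous of degree `s`. -/
theorem eigen_mem {M : Type*} [AddCommGroup M] [Module ℂ M] {V : GrLat → Submodule ℂ M}
    {T : P.DegIdx → Module.End ℂ M} (hT : ∀ i l, ∀ v ∈ V l, T i v = i.1 l • v)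
    (hV : ⨆ l, V l = ⊤) {u : M} {s : GrLat} (h : ∀ i, T i u = i.1 s • u) : u ∈ V s := by
  have := mem_iSup_of_eigenvector (w := fun i l => i.1 l) hT (hV ▸ Submodule.mem_top : u ∈ _) h
  refine (iSup₂_le fun l hl => ?_ : (_ : Submodule ℂ M) ≤ V s) this
  rw [P.eq_of_forall_deg hl]

variable {P}

/-- Opposite homogeneous components of `D` commute. -/
theorem lie_eq_zero_of_opposite (hJ : NondegenerateForm J) {l : GrLat} {d e : P.DAlg}
    (hd : d ∈ P.Dgr l) (he : e ∈ P.Dgr (-l)) : ⁅d, e⁆ = 0 := by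
  obtain ⟨θ, hθ, hzθ, haθ⟩ := SCDer_actsBy hJ (P.toEnd_mem_SCDer d) hd
  obtain ⟨ψ, hψ, hzψ, haψ⟩ := SCDer_actsBy hJ (P.toEnd_mem_SCDer e) he
  apply P.toEnd_injective
  rw [map_zero]
  refine CDer_eq_zero (P.toEnd_mem_SCDer _).1 ?_
  rw [toEnd_lie]
  have h := (haθ.mul haψ).sub (haψ.mul haθ)
  suffices e : (L J (xElt J l) * Theta J θ) * (L J (xElt J (-l)) * Theta J ψ) =
      (L J (xElt J (-l)) * Theta J ψ) * (L J (xElt J l) * Theta J θ) by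
    rwa [e, sub_self] at h
  rcases hzθ with rfl | hz
  · simp
  have hθ' : θ (-l) = 0 := by rw [map_neg, hθ, neg_zero]
  have hψ' : ψ l = 0 := by rwa [map_neg, neg_eq_zero] at hψ
  rw [mul_assoc, ← mul_assoc (Theta J θ), Theta_comm_L hθ', mul_assoc _ (Theta J ψ),
    ← mul_assoc (Theta J ψ), Theta_comm_L hψ', mul_assoc _ (Theta J θ), mul_assoc _ (Theta J ψ),
    Theta_comm θ ψ, ← mul_assoc, ← mul_assoc, hz.L_comm_L, mul_assoc,
    mul_assoc]

/-- The components `D^l` with `l ≠ 0` are at most one-dimensional: their elements are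
`L_{x^l} ∂_θ` with `θ(l) = 0`, and `Λ` has rank two. -/
theorem exists_Dgr_le_span (hJ : NondegenerateForm J) {l : GrLat} (hl : l ≠ 0) :
    ∃ d₀ ∈ P.Dgr l, P.Dgr l ≤ Submodule.span ℂ {d₀} := by
  let θ₀ : GrLat →+ ℂ :=
    { toFun := fun m => l.1 * m.2 - l.2 * m.1
      map_zero' := by simp
      map_add' := by intros; simp only [Prod.fst_add, Prod.snd_add]; push_cast; ring }
  have h1 : ∀ d ∈ P.Dgr l, ∃ t : ℂ, ActsBy (P.toEnd d) (t • (L J (xElt J l) * Theta J θ₀)) := by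
    intro d hd
    obtain ⟨θ, hθ, -, ha⟩ := SCDer_actsBy hJ (P.toEnd_mem_SCDer d) hd
    obtain ⟨t, ht⟩ := exists_eq_smul_of_apply_eq_zero hl hθ
    refine ⟨t, ?_⟩
    rwa [← mul_smul_comm, ← map_smul, show t • θ₀ = θ from AddMonoidHom.ext fun m => (ht m).symm]
  by_cases h0 : ∃ d ∈ P.Dgr l, d ≠ 0
  · obtain ⟨d₀, hd₀, hne⟩ := h0
    refine ⟨d₀, hd₀, fun d hd => ?_⟩
    obtain ⟨t₀, ht₀⟩ := h1 d₀ hd₀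
    obtain ⟨t, ht⟩ := h1 d hd
    have ht₀' : t₀ ≠ 0 := by
      rintro rfl
      rw [zero_smul] at ht₀
      exact hne (P.toEnd_injective
        ((CDer_eq_zero (P.toEnd_mem_SCDer _).1 ht₀).trans (map_zero _).symm))
    refine Submodule.mem_span_singleton.2 ⟨t / t₀, ?_⟩
    apply P.toEnd_injective
    rw [← sub_eq_zero, ← map_sub]
    refine CDer_eq_zero (P.toEnd_mem_SCDer _).1 ?_
    have := (ht₀.smul (t / t₀)).sub ht
    rwa [smul_smul, div_mul_cancel₀ _ ht₀', sub_self, ← map_smul, ← map_sub] at this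
  · push Not at h0
    exact ⟨0, zero_mem _, fun d hd => by rw [h0 d hd]; exact zero_mem _⟩

theorem rank_Dgr_le_one (hJ : NondegenerateForm J) {l : GrLat} (hl : l ≠ 0) :
    Module.rank ℂ (P.Dgr l) ≤ 1 :=
  (rank_submodule_le_one_iff (P.Dgr l)).2 (exists_Dgr_le_span hJ hl)

theorem rank_Cgr_le_one (hJ : NondegenerateForm J) {l : GrLat} (hl : l ≠ 0) :
    Module.rank ℂ (P.Cgr l) ≤ 1 := by
  obtain ⟨d₀, -, hd₀⟩ := exists_Dgr_le_span (P := P) hJ (neg_ne_zero.2 hl)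
  let f : P.Cgr l →ₗ[ℂ] ℂ := LinearMap.applyₗ d₀ ∘ₗ P.toDual ∘ₗ (P.Cgr l).subtype
  have hf : Function.Injective f := by
    refine (injective_iff_map_eq_zero f).2 fun c hc => Subtype.ext (P.C_ext_Dgr fun m d hd => ?_)
    rw [Submodule.coe_zero, map_zero, LinearMap.zero_apply]
    by_cases h : m = -l
    · subst h
      obtain ⟨t, rfl⟩ := Submodule.mem_span_singleton.1 (hd₀ hd)
      rw [map_smul, show P.toDual (c : P.C) d₀ = 0 from hc, smul_zero]
    · exact c.2 m h d hd
  exact (LinearMap.rank_le_of_injective f hf).trans_eq (Module.rank_self ℂ)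

/-- `D` acts trivially on `C^0`: by degree only the brackets `[D^{-l}, D^l]` could contribute. -/
theorem act_Cgr_zero (hJ : NondegenerateForm J) {l : GrLat} {d : P.DAlg} (hd : d ∈ P.Dgr l)
    {c : P.C} (hc : c ∈ P.Cgr 0) : P.act d c = 0 := by
  refine P.C_ext_Dgr fun m e he => ?_
  rw [act_apply, map_zero, LinearMap.zero_apply]
  by_cases h : m + l = 0
  · rw [lie_eq_zero_of_opposite hJ he (by rwa [show -m = l from neg_eq_of_add_eq_zero_right h]),
      map_zero]
  · exact hc (m + l) (by rwa [neg_zero]) _ (P.Dgr_lie he hd)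

variable (P) in
/-- Every `σ ∈ Λ` is the restriction to `D^0` of an element of `C^0 = (D^0)^*`. For `σ` in the
support of `J` it is the functional sending `d` to the coefficient of `x^σ` in `d(x^σ)`. -/
theorem exists_Cgr_zero (s : GrLat) :
    ∃ c ∈ P.Cgr 0, ∀ θ : P.DegIdx, P.toDual c (P.deg θ) = θ.1 s := by
  have hs : s ∈ AddSubgroup.closure (JordanTorus.supp J) := by
    rw [JordanTorus.closure_supp]; trivial
  induction hs using AddSubgroup.closure_induction with
  | mem s hs =>
    let φ : Module.Dual ℂ P.DAlg := coeff J s ∘ₗ LinearMap.fst ℂ J (instrl J × J) ∘ₗ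
      LinearMap.applyₗ ((xElt J s, 0, 0) : TKK J) ∘ₗ P.toEnd
    have hφ : φ ∈ P.dualGr 0 := by
      intro m hm d hd
      have := (hd s (xElt J s, 0, 0) ⟨xElt_mem_gr s, zero_mem _, zero_mem _⟩).1
      refine coeff_of_mem_gr_of_ne (fun e => hm ?_) this
      rw [neg_zero]
      exact add_eq_left.1 e
    refine ⟨P.mkC φ (Submodule.mem_iSup_of_mem 0 hφ), hφ, fun θ => ?_⟩
    change coeff J s (degDer J θ.1 (xElt J s, 0, 0)).1 = _
    rw [degDer_def, Theta_gr _ s (xElt_mem_gr s), map_smul, coeff_xElt_self hs, smul_eq_mul,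
      mul_one]
  | zero => exact ⟨0, zero_mem _, fun θ => by simp⟩
  | add s t _ _ h1 h2 =>
    obtain ⟨c, hc, hc'⟩ := h1
    obtain ⟨b, hb, hb'⟩ := h2
    exact ⟨c + b, add_mem hc hb, fun θ => by simp [hc', hb']⟩
  | neg s _ h =>
    obtain ⟨c, hc, hc'⟩ := h
    exact ⟨-c, neg_mem hc, fun θ => by simp [hc']⟩

end Permissible

end Dual

/-! ### Root spaces of the extended affine Lie algebra -/

namespace EALA

variable {J : Type} [AddCommGroup J] [Module ℂ J] [JordanTorus J] {P : Permissible J}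
  {K : AffineCocycle P}

theorem inG_mem_H : inG K (0, LI J (one J), 0) ∈ H K :=
  ⟨⟨Submodule.mem_span_singleton_self _, (P.Cgr 0).zero_mem⟩, ⟨0, map_zero _⟩⟩

theorem inC_mem_H {c : P.C} (hc : c ∈ P.Cgr 0) : inC K c ∈ H K :=
  ⟨⟨Submodule.zero_mem (Submodule.span ℂ _), hc⟩, ⟨0, map_zero _⟩⟩

theorem inD_mem_H (θ : P.DegIdx) : inD K (P.deg θ) ∈ H K :=
  ⟨⟨Submodule.zero_mem (Submodule.span ℂ _), (P.Cgr 0).zero_mem⟩, ⟨θ.1, rfl⟩⟩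

variable (K) in
/-- The element `L_1` of `H`. -/
def hG : H K := ⟨_, inG_mem_H⟩

/-- An element of `C^0` as an element of `H`. -/
def hC {c : P.C} (hc : c ∈ P.Cgr 0) : H K := ⟨_, inC_mem_H hc⟩

variable (K) in
/-- The degree derivation `∂_θ` as an element of `H`. -/
def hD (θ : P.DegIdx) : H K := ⟨_, inD_mem_H θ⟩

theorem exists_eq_of_H (h : H K) : ∃ (a : ℂ) (c : P.C) (hc : c ∈ P.Cgr 0) (θ : P.DegIdx),
    h = a • hG K + hC hc + hD K θ := by
  obtain ⟨h, ⟨h1, h2⟩, θ, hθ⟩ := h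
  obtain ⟨a, ha⟩ := Submodule.mem_span_singleton.1 h1
  have hm : degDer J θ ∈ P.D := by rw [hθ]; exact P.toEnd_mem _
  refine ⟨a, prC K h, h2, ⟨θ, hm⟩, Subtype.ext (EALA.ext ?_ ?_ ?_)⟩
  · change prG K h = a • (0, LI J (one J), 0) + 0 + 0
    rw [ha, add_zero, add_zero]
  · change prC K h = a • 0 + prC K h + 0
    rw [smul_zero, zero_add, add_zero]
  · change prD K h = a • 0 + 0 + P.deg ⟨θ, hm⟩
    rw [smul_zero, zero_add, zero_add]
    exact P.toEnd_injective hθ.symm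

theorem latticeRoot_hG (s : GrLat) : latticeRoot K s (hG K) = 0 :=
  latticeRoot_apply K s _ 0 (map_zero _)

theorem latticeRoot_hC (s : GrLat) {c : P.C} (hc : c ∈ P.Cgr 0) : latticeRoot K s (hC hc) = 0 :=
  latticeRoot_apply K s _ 0 (map_zero _)

theorem latticeRoot_hD (s : GrLat) (θ : P.DegIdx) : latticeRoot K s (hD K θ) = θ.1 s :=
  latticeRoot_apply K s _ θ.1 rfl

theorem latticeRoot_injective : Function.Injective (latticeRoot K) := fun s t h =>
  P.eq_of_forall_deg fun θ => by rw [← latticeRoot_hD (K := K), h, latticeRoot_hD]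

theorem hG_lie (e : EALA K) : ⁅(hG K : EALA K), e⁆ =
    inG K ((prG K e).1, 0, -(prG K e).2.2) := by
  have hd : ∀ d : P.DAlg, P.toEnd d (0, LI J (one J), 0) = 0 := fun d =>
    CDer_LI_one (P.toEnd_mem_SCDer d).1
  refine EALA.ext ?_ ?_ ?_
  · change ⁅((0, LI J (one J), 0) : TKK J), prG K e⁆ + P.toEnd 0 (prG K e) -
      P.toEnd (prD K e) (0, LI J (one J), 0) = ((prG K e).1, 0, -(prG K e).2.2)
    rw [hd, LI_one_lie_TKK, map_zero, LinearMap.zero_apply, sub_zero, add_zero]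
  · change P.cD (0, LI J (one J), 0) (prG K e) + P.act 0 (prC K e) - P.act (prD K e) 0 +
      K.κ 0 (prD K e) = 0
    have : P.cD (0, LI J (one J), 0) (prG K e) = 0 := by
      refine P.C_ext fun d => ?_
      rw [Permissible.cD_apply, hd, map_zero, map_zero, LinearMap.zero_apply, LinearMap.zero_apply]
    simp [this]
  · change ⁅(0 : P.DAlg), prD K e⁆ = 0
    rw [zero_lie]

theorem inC_lie (c : P.C) (e : EALA K) : ⁅inC K c, e⁆ = inC K (- P.act (prD K e) c) := by
  refine EALA.ext ?_ ?_ ?_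
  · change ⁅(0 : TKK J), prG K e⁆ + P.toEnd 0 (prG K e) - P.toEnd (prD K e) 0 = 0
    simp
  · change P.cD 0 (prG K e) + P.act 0 (prC K e) - P.act (prD K e) c + K.κ 0 (prD K e) =
      - P.act (prD K e) c
    simp
  · change ⁅(0 : P.DAlg), prD K e⁆ = 0
    rw [zero_lie]

theorem prG_hD_lie (θ : P.DegIdx) (e : EALA K) :
    prG K ⁅(hD K θ : EALA K), e⁆ = degDer J θ.1 (prG K e) := by
  change ⁅(0 : TKK J), prG K e⁆ + degDer J θ.1 (prG K e) - P.toEnd (prD K e) 0 = _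
  simp

theorem prC_hD_lie (θ : P.DegIdx) (e : EALA K) :
    prC K ⁅(hD K θ : EALA K), e⁆ = P.act (P.deg θ) (prC K e) := by
  change P.cD 0 (prG K e) + P.act (P.deg θ) (prC K e) - P.act (prD K e) 0 +
    K.κ (P.deg θ) (prD K e) = _
  rw [K.zero _ (P.deg_mem θ)]
  simp

theorem prD_hD_lie (θ : P.DegIdx) (e : EALA K) :
    prD K ⁅(hD K θ : EALA K), e⁆ = ⁅P.deg θ, prD K e⁆ := rfl

variable (P) in
/-- The operator `[d, ·]` on `D`. -/
def adD (d : P.DAlg) : Module.End ℂ P.DAlg where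
  toFun e := ⁅d, e⁆
  map_add' _ _ := lie_add _ _ _
  map_smul' _ _ := lie_smul _ _ _

/-- The root space `E_s` is the part of degree `s` of `E` on which `L_1` acts trivially. -/
theorem mem_Egr_iff (hJ : NondegenerateForm J) (s : GrLat) (e : EALA K) :
    e ∈ Egr K s ↔ ((prG K e).1 = 0 ∧ (prG K e).2.2 = 0) ∧ prG K e ∈ tkkGr J s ∧
      prC K e ∈ P.Cgr s ∧ prD K e ∈ P.Dgr s := by
  constructor
  · intro he
    have h1 := he (hG K)
    rw [latticeRoot_hG, zero_smul, hG_lie] at h1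
    have h1 : ((prG K e).1, 0, -(prG K e).2.2) = (0 : TKK J) := congrArg (prG K) h1
    have h2 : ∀ θ, ⁅(hD K θ : EALA K), e⁆ = θ.1 s • e := fun θ => by
      rw [he (hD K θ), latticeRoot_hD]
    refine ⟨⟨congrArg Prod.fst h1, ?_⟩, ?_, ?_, ?_⟩
    · exact neg_eq_zero.1 (congrArg (fun u : TKK J => u.2.2) h1)
    · refine P.eigen_mem (T := fun θ => degDer J θ.1) (fun θ l v hv => degDer_apply _ l hv)
        iSup_tkkGr fun θ => ?_
      rw [← prG_hD_lie, h2, map_smul]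
    · refine P.eigen_mem (T := fun θ => P.act (P.deg θ)) (fun θ l v hv => P.act_deg θ hv)
        P.iSup_Cgr fun θ => ?_
      rw [← prC_hD_lie, h2, map_smul]
    · refine P.eigen_mem (T := fun θ => adD P (P.deg θ)) (fun θ l v hv => P.deg_lie θ hv)
        P.iSup_Dgr fun θ => ?_
      rw [← map_smul, ← h2]
      rfl
  · rintro ⟨⟨h1, h3⟩, hu, hc, hd⟩ h
    obtain ⟨a, c, hc0, θ, rfl⟩ := exists_eq_of_H h
    have e1 : ⁅(hG K : EALA K), e⁆ = 0 := by
      rw [hG_lie, h1, h3, neg_zero]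
      exact map_zero _
    have e2 : ⁅((hC hc0 : H K) : EALA K), e⁆ = 0 := by
      change ⁅inC K c, e⁆ = 0
      rw [inC_lie, Permissible.act_Cgr_zero hJ hd hc0, neg_zero, map_zero]
    have e3 : ⁅(hD K θ : EALA K), e⁆ = θ.1 s • e := by
      refine EALA.ext ?_ ?_ ?_
      · rw [prG_hD_lie, degDer_apply _ s hu, map_smul]
      · rw [prC_hD_lie, P.act_deg θ hc, map_smul]
      · rw [prD_hD_lie, P.deg_lie θ hd, map_smul]
    rw [Submodule.coe_add, Submodule.coe_add, Submodule.coe_smul, add_lie, add_lie, smul_lie, e1,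
      e2, e3, map_add, map_add, map_smul, latticeRoot_hG, latticeRoot_hC, latticeRoot_hD,
      smul_zero, smul_zero, zero_add, zero_add, zero_add, zero_add]

variable (K) in
/-- The sum map `Instrl(J)^s × C^s × D^s → E`. -/
def grMap (s : GrLat) : (instrlGr J s × P.Cgr s × P.Dgr s) →ₗ[ℂ] EALA K :=
  (inI K ∘ₗ (instrlGr J s).subtype).coprod
    ((inC K ∘ₗ (P.Cgr s).subtype).coprod (inD K ∘ₗ (P.Dgr s).subtype))

theorem prG_grMap (s : GrLat) (x : instrlGr J s × P.Cgr s × P.Dgr s) :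
    prG K (grMap K s x) = (0, (x.1 : instrl J), 0) := by
  change ((0, (x.1 : instrl J), 0) : TKK J) + (0 + 0) = _
  rw [add_zero, add_zero]

theorem prC_grMap (s : GrLat) (x : instrlGr J s × P.Cgr s × P.Dgr s) :
    prC K (grMap K s x) = x.2.1 := by
  change (0 : P.C) + (x.2.1 + 0) = _
  rw [add_zero, zero_add]

theorem prD_grMap (s : GrLat) (x : instrlGr J s × P.Cgr s × P.Dgr s) :
    prD K (grMap K s x) = x.2.2 := by
  change (0 : P.DAlg) + (0 + x.2.2) = _
  rw [zero_add, zero_add]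

theorem grMap_injective (s : GrLat) : Function.Injective (grMap K s) := fun x y h => by
  have h1 := congrArg (prG K) h
  have h2 := congrArg (prC K) h
  have h3 := congrArg (prD K) h
  rw [prG_grMap, prG_grMap] at h1
  rw [prC_grMap, prC_grMap] at h2
  rw [prD_grMap, prD_grMap] at h3
  exact Prod.ext (Subtype.ext (congrArg (fun u : TKK J => u.2.1) h1))
    (Prod.ext (Subtype.ext h2) (Subtype.ext h3))

theorem range_grMap (hJ : NondegenerateForm J) (s : GrLat) :
    LinearMap.range (grMap K s) = Egr K s := by
  ext e
  rw [mem_Egr_iff hJ]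
  constructor
  · rintro ⟨x, rfl⟩
    rw [prG_grMap, prC_grMap, prD_grMap]
    exact ⟨⟨rfl, rfl⟩, ⟨zero_mem _, x.1.2, zero_mem _⟩, x.2.1.2, x.2.2.2⟩
  · rintro ⟨⟨h1, h3⟩, hu, hc, hd⟩
    refine ⟨(⟨(prG K e).2.1, hu.2.1⟩, ⟨prC K e, hc⟩, ⟨prD K e, hd⟩), EALA.ext ?_ ?_ ?_⟩
    · rw [prG_grMap]; exact Prod.ext h1.symm (Prod.ext rfl h3.symm)
    · rw [prC_grMap]
    · rw [prD_grMap]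

theorem Egr_eq_map_sup (hJ : NondegenerateForm J) (s : GrLat) :
    Egr K s = (instrlGr J s).map (inI K) ⊔ DC K s := by
  rw [← range_grMap hJ, grMap, LinearMap.range_coprod, LinearMap.range_coprod,
    LinearMap.range_comp, LinearMap.range_comp, LinearMap.range_comp, Submodule.range_subtype,
    Submodule.range_subtype, Submodule.range_subtype, DC, sup_comm (Submodule.map (inC K) _)]

theorem rank_Egr (hJ : NondegenerateForm J) (s : GrLat) :
    Module.rank ℂ (Egr K s) =
      Module.rank ℂ (instrlGr J s) + Module.rank ℂ (P.Dgr s) + Module.rank ℂ (P.Cgr s) := by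
  rw [← range_grMap hJ, ← (LinearEquiv.ofInjective _ (grMap_injective s)).rank_eq, rank_prod',
    rank_prod', add_assoc, add_comm (Module.rank ℂ (P.Dgr s))]

theorem Egr_eq_of_instrlGr_eq (hJ : NondegenerateForm J) {s : GrLat} {X : Set (instrl J)}
    (h : instrlGr J s = Submodule.span ℂ X) :
    Egr K s = Submodule.span ℂ (inI K '' X) ⊔ DC K s := by
  rw [Egr_eq_map_sup hJ, h, Submodule.map_span]

theorem rank_Egr_bounds (hJ : NondegenerateForm J) {s : GrLat} (hs : s ≠ 0) {n : Cardinal}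
    (hn : Module.rank ℂ (instrlGr J s) = n) :
    Module.rank ℂ (Egr K s) = n + Module.rank ℂ (P.Dgr s) + Module.rank ℂ (P.Cgr s) ∧
      n ≤ Module.rank ℂ (Egr K s) ∧ Module.rank ℂ (Egr K s) ≤ n + 2 := by
  rw [rank_Egr hJ, hn, add_assoc]
  refine ⟨rfl, self_le_add_right _ _, ?_⟩
  rw [← one_add_one_eq_two]
  gcongr
  · exact Permissible.rank_Dgr_le_one hJ hs
  · exact Permissible.rank_Cgr_le_one hJ hs

theorem rootSpace_ne_bot_of_instrlGr (hJ : NondegenerateForm J) {s : GrLat}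
    (h : instrlGr J s ≠ ⊥) : Egr K s ≠ ⊥ := by
  intro h0
  rw [Egr_eq_map_sup hJ] at h0
  refine h ((Submodule.eq_bot_iff _).2 fun T hT => ?_)
  have h1 : inI K T ∈ (⊥ : Submodule ℂ (EALA K)) :=
    h0 ▸ Submodule.mem_sup_left (Submodule.mem_map_of_mem hT)
  exact congrArg (fun u : TKK J => u.2.1) (congrArg (prG K) ((Submodule.mem_bot ℂ).1 h1))

theorem bilin_of_prG_eq_zero (e f : EALA K) (h : prG K f = 0) :
    bilin e f = P.toDual (prC K e) (prD K f) + P.toDual (prC K f) (prD K e) := by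
  rw [bilin, h, map_zero, zero_add]

/-- The element of `C^0` representing `s ∈ Λ` is the element `t_s`, and it is isotropic. -/
theorem latticeRoot_mem_isotropicRoots (hJ : NondegenerateForm J) {s : GrLat}
    (h : instrlGr J s ≠ ⊥) : latticeRoot K s ∈ isotropicRoots K := by
  refine ⟨rootSpace_ne_bot_of_instrlGr hJ h, ?_⟩
  obtain ⟨c, hc, hc'⟩ := P.exists_Cgr_zero s
  refine ⟨hC hc, fun x => ?_, ?_⟩
  · obtain ⟨a, b, hb, θ, rfl⟩ := exists_eq_of_H x
    rw [map_add, map_add, map_smul, latticeRoot_hG, latticeRoot_hC, latticeRoot_hD,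
      bilin_of_prG_eq_zero _ _ rfl]
    change _ = P.toDual _ 0 + P.toDual c (a • 0 + 0 + P.deg θ)
    rw [map_zero, smul_zero, smul_zero, zero_add, zero_add, zero_add, zero_add, zero_add, hc']
  · rw [bilin_of_prG_eq_zero _ _ rfl]
    change P.toDual _ 0 + P.toDual _ 0 = 0
    rw [map_zero, add_zero]

/-- An isotropic root vanishes on `C^0`, since `C^0` acts nilpotently, and then on `L_1` since it
is isotropic; its values on the degree derivations are those of a degree of `E`. -/
theorem exists_eq_latticeRoot {α : Module.Dual ℂ (H K)}
    (hα : α ∈ isotropicRoots K) : ∃ s, α = latticeRoot K s := by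
  obtain ⟨hne, t, ht, htt⟩ := hα
  obtain ⟨e, he, he0⟩ := (Submodule.ne_bot_iff _).1 hne
  have hC0 : ∀ {c : P.C} (hc : c ∈ P.Cgr 0), α (hC hc) = 0 := by
    intro c hc
    by_contra h0
    have h1 : ⁅inC K c, e⁆ = α (hC hc) • e := he (hC hc)
    rw [inC_lie] at h1
    have h2 : (0 : P.DAlg) = α (hC hc) • prD K e := congrArg (prD K) h1
    have h3 : prD K e = 0 := (smul_eq_zero.1 h2.symm).resolve_left h0
    rw [h3, map_zero, LinearMap.zero_apply, neg_zero, map_zero] at h1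
    exact he0 ((smul_eq_zero.1 h1.symm).resolve_left h0)
  have hform : form J (0, LI J (one J), 0) (0, LI J (one J), 0) = 1 := by
    have hd : dPart J (LI J (one J)) = 0 := by
      ext1; rw [coe_dPart, LPart_LI, coe_LI, sub_self]; rfl
    rw [form_apply]
    simp only [hd, LPart_LI, map_zero, zero_add, add_zero, formJ_apply, L_one]
    rw [eps, one, Module.Basis.coord_apply, Module.Basis.repr_self, Finsupp.single_eq_same]
  have hG0 : α (hG K) = 0 := by
    obtain ⟨a, c, hc, θ, rfl⟩ := exists_eq_of_H t
    have h1 := ht (hG K)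
    have h2 := ht (hC hc)
    have g1 : prG K ((a • hG K + hC hc + hD K θ : H K) : EALA K) = a • (0, LI J (one J), 0) := by
      change a • ((0, LI J (one J), 0) : TKK J) + 0 + 0 = _
      rw [add_zero, add_zero]
    have g2 : prC K ((a • hG K + hC hc + hD K θ : H K) : EALA K) = c := by
      change a • (0 : P.C) + c + 0 = _
      rw [smul_zero, zero_add, add_zero]
    have g3 : prD K ((a • hG K + hC hc + hD K θ : H K) : EALA K) = P.deg θ := by
      change a • (0 : P.DAlg) + 0 + P.deg θ = _
      rw [smul_zero, zero_add, zero_add]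
    rw [hC0, bilin, g1, g2, g3] at h2
    change 0 = form J 0 _ + P.toDual c (P.deg θ) + P.toDual c 0 at h2
    rw [map_zero, LinearMap.zero_apply, zero_add, map_zero, add_zero] at h2
    rw [bilin, g1, g2, g3, map_smul, map_smul, LinearMap.smul_apply, hform, ← h2] at htt
    have ha : a = 0 := by simpa using htt
    rw [bilin, g1, g2, g3, ha, zero_smul, map_zero] at h1
    change α (hG K) = 0 + P.toDual 0 _ + P.toDual c 0 at h1
    rw [h1, map_zero, map_zero, LinearMap.zero_apply, add_zero, add_zero]
  have hD0 : ∀ θ, ⁅(hD K θ : EALA K), e⁆ = α (hD K θ) • e := fun θ => he (hD K θ)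
  -- some component of `e` is nonzero, hence has a nonzero homogeneous part
  have key : ∃ s, ∀ θ : P.DegIdx, θ.1 s = α (hD K θ) := by
    by_contra hcon
    have hbot : ∀ {M : Type} [AddCommGroup M] [Module ℂ M] {V : GrLat → Submodule ℂ M}
        {T : P.DegIdx → Module.End ℂ M} (_ : ∀ i l, ∀ v ∈ V l, T i v = i.1 l • v)
        (_ : ⨆ l, V l = ⊤) {u : M} (_ : ∀ i, T i u = α (hD K i) • u), u = 0 := by
      intro M _ _ V T hT hV u hu
      have h1 := mem_iSup_of_eigenvector (w := fun (i : P.DegIdx) l => i.1 l) hT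
        (hV ▸ Submodule.mem_top : u ∈ _) hu
      refine (Submodule.mem_bot ℂ).1 ((iSup₂_le fun l hl => ?_ : (_ : Submodule ℂ M) ≤ ⊥) h1)
      exact absurd ⟨l, hl⟩ hcon
    refine he0 (EALA.ext ?_ ?_ ?_)
    · refine hbot (T := fun θ => degDer J θ.1) (fun θ l v hv => degDer_apply _ l hv)
        iSup_tkkGr fun θ => ?_
      rw [← prG_hD_lie, hD0, map_smul]
    · refine hbot (T := fun θ => P.act (P.deg θ)) (fun θ l v hv => P.act_deg θ hv)
        P.iSup_Cgr fun θ => ?_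
      rw [← prC_hD_lie, hD0, map_smul]
    · refine hbot (T := fun θ => adD P (P.deg θ)) (fun θ l v hv => P.deg_lie θ hv)
        P.iSup_Dgr fun θ => ?_
      rw [← map_smul, ← hD0]
      rfl
  obtain ⟨s, hs⟩ := key
  refine ⟨s, LinearMap.ext fun x => ?_⟩
  obtain ⟨a, c, hc, θ, rfl⟩ := exists_eq_of_H x
  simp only [map_add, map_smul, hC0, hG0, latticeRoot_hG, latticeRoot_hC, latticeRoot_hD, hs]

theorem isotropicRoots_eq (hJ : NondegenerateForm J) (h : ∀ s, instrlGr J s ≠ ⊥) :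
    isotropicRoots K = Set.range (latticeRoot K) :=
  Set.Subset.antisymm
    (fun _ hα => (exists_eq_latticeRoot hα).imp fun _ e => e.symm)
    (Set.range_subset_iff.2 fun s => latticeRoot_mem_isotropicRoots hJ (h s))

end EALA

/-! ### Homogeneous components of the inner structure algebra -/

section Instrl

variable {J : Type} [AddCommGroup J] [Module ℂ J] [JordanTorus J]

theorem instrlGr_eq_span (s : GrLat) : instrlGr J s = Submodule.span ℂ {LI J (xElt J s)} ⊔
    Submodule.span ℂ {T | ∃ m n : GrLat, m + n = s ∧ T = ⁅LI J (xElt J m), LI J (xElt J n)⁆} := by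
  rw [instrlGr, gr, Submodule.map_span, Set.image_singleton]
  congr 1
  refine le_antisymm (Submodule.span_le.2 ?_) (Submodule.span_mono ?_)
  · rintro _ ⟨m, n, h, a, ha, b, hb, rfl⟩
    obtain ⟨c, rfl⟩ := Submodule.mem_span_singleton.1 ha
    obtain ⟨d, rfl⟩ := Submodule.mem_span_singleton.1 hb
    rw [map_smul, map_smul, smul_lie, lie_smul]
    exact Submodule.smul_mem _ _ (Submodule.smul_mem _ _ (Submodule.subset_span ⟨m, n, h, rfl⟩))
  · rintro _ ⟨m, n, h, rfl⟩
    exact ⟨m, n, h, _, xElt_mem_gr m, _, xElt_mem_gr n, rfl⟩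

theorem LI_xElt_mem (s : GrLat) : LI J (xElt J s) ∈ instrlGr J s := by
  rw [instrlGr_eq_span]
  exact Submodule.mem_sup_left (Submodule.mem_span_singleton_self _)

theorem lie_mem_instrlGr {m n s : GrLat} (h : m + n = s) :
    ⁅LI J (xElt J m), LI J (xElt J n)⁆ ∈ instrlGr J s := by
  rw [instrlGr_eq_span]
  exact Submodule.mem_sup_right (Submodule.subset_span ⟨m, n, h, rfl⟩)

theorem instrlGr_eq_span_pair {s : GrLat} {R : instrl J} (hR : R ∈ instrlGr J s)
    (h : ∀ m n, m + n = s → ∃ c : ℂ, ⁅LI J (xElt J m), LI J (xElt J n)⁆ = c • R) :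
    instrlGr J s = Submodule.span ℂ {LI J (xElt J s), R} := by
  refine le_antisymm ?_ (Submodule.span_le.2 ?_)
  · rw [instrlGr_eq_span, Submodule.span_insert]
    refine sup_le_sup le_rfl (Submodule.span_le.2 ?_)
    rintro _ ⟨m, n, hmn, rfl⟩
    obtain ⟨c, hc⟩ := h m n hmn
    rw [hc]
    exact Submodule.smul_mem _ _ (Submodule.mem_span_singleton_self _)
  · rintro _ (rfl | rfl)
    · exact LI_xElt_mem s
    · exact hR

theorem instrlGr_eq_span_LI {s : GrLat}
    (h : ∀ m n, m + n = s → ⁅LI J (xElt J m), LI J (xElt J n)⁆ = 0) :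
    instrlGr J s = Submodule.span ℂ {LI J (xElt J s)} := by
  rw [instrlGr_eq_span_pair (R := 0) (zero_mem _) fun m n hmn => ⟨0, by rw [h m n hmn, smul_zero]⟩,
    Set.pair_comm, Submodule.span_insert_zero]

theorem instrlGr_eq_span_of_notMem {s : GrLat} (hs : s ∉ JordanTorus.supp J) {R : instrl J}
    (hR : R ∈ instrlGr J s)
    (h : ∀ m n, m + n = s → ∃ c : ℂ, ⁅LI J (xElt J m), LI J (xElt J n)⁆ = c • R) :
    instrlGr J s = Submodule.span ℂ {R} := by
  rw [instrlGr_eq_span_pair hR h, xElt_of_notMem hs, map_zero, Submodule.span_insert_zero]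

theorem rank_span_singleton_eq_one {M : Type*} [AddCommGroup M] [Module ℂ M] {v : M} (hv : v ≠ 0) :
    Module.rank ℂ (Submodule.span ℂ {v}) = 1 := by
  rw [rank_span_set (LinearIndepOn.singleton hv), Cardinal.mk_singleton]

theorem LI_xElt_ne_zero {s : GrLat} (hs : s ∈ JordanTorus.supp J) : LI J (xElt J s) ≠ 0 := by
  rw [← map_zero (LI J), LI_injective.ne_iff]; exact xElt_ne_zero hs

/-- A nonzero operator killing the unit is linearly independent of `L_{x^s}`. -/
theorem rank_span_pair_eq_two {s : GrLat} (hs : s ∈ JordanTorus.supp J) {R : instrl J}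
    (hR : R ≠ 0) (hR1 : LPart J R = 0) :
    Module.rank ℂ (Submodule.span ℂ {LI J (xElt J s), R}) = 2 := by
  have hli : LinearIndependent ℂ ![LI J (xElt J s), R] := by
    refine LinearIndependent.pair_iff.2 fun a b hab => ?_
    have h1 := congrArg (LPart J) hab
    rw [map_add, map_smul, map_smul, hR1, LPart_LI, smul_zero, add_zero, map_zero] at h1
    have ha : a = 0 := (smul_eq_zero.1 h1).resolve_right (xElt_ne_zero hs)
    rw [ha, zero_smul, zero_add] at hab
    exact ⟨ha, (smul_eq_zero.1 hab).resolve_right hR⟩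
  have := rank_span hli
  rw [Matrix.range_cons, Matrix.range_cons, Matrix.range_empty, Set.union_empty,
    Set.singleton_union] at this
  rw [this]
  have hne : LI J (xElt J s) ≠ R := fun e => by
    have := hli.injective (a₁ := 0) (a₂ := 1) e
    simp at this
  rw [Cardinal.mk_insert (by simpa using hne), Cardinal.mk_singleton, one_add_one_eq_two]

theorem LPart_lie_LI (a b : J) : LPart J ⁅LI J a, LI J b⁆ = 0 :=
  inder_one (lie_mem_inder a b)

theorem coe_lie_LI_apply (a b c : J) : ((⁅LI J a, LI J b⁆ : instrl J) : Module.End ℂ J) c =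
    L J a (L J b c) - L J b (L J a c) := rfl

theorem instrl_ext_xElt {S T : instrl J}
    (h : ∀ l, (S : Module.End ℂ J) (xElt J l) = (T : Module.End ℂ J) (xElt J l)) : S = T :=
  Subtype.ext (linearMap_ext_xElt h)

theorem eps_xElt_zero : eps J (xElt J 0) = 1 := by
  rw [xElt_zero, eps, one, Module.Basis.coord_apply, Module.Basis.repr_self,
    Finsupp.single_eq_same]

end Instrl

/-! ### The Jordan tori of semilattices -/

section JS

variable {S : Semilattice}

theorem JS.L_xElt (l m : GrLat) : L (JS S) (xElt (JS S) l) (xElt (JS S) m) =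
    (gamBar (sBar S) (red l) (red m) : ℂ) • xElt (JS S) (l + m) := by
  rw [← Gam_eq]; exact JS.mul_e l m

theorem red_neg (l : GrLat) : red (-l) = red l := by
  simp [red, ZMod.neg_eq_self_mod_two]

theorem JS.nondegenerateForm : NondegenerateForm (JS S) := by
  intro l hl
  have h : ∀ s i, s i = true → gamBar s i i = 1 := by decide
  rw [formJ_apply, JS.L_xElt, add_neg_cancel, map_smul, eps_xElt_zero, red_neg,
    h _ _ ((sBar_red S l).2 hl)]
  simp

/-- The structure constants of the operators `[L_{x^m}, L_{x^n}]` of `J_S`, in terms of the classes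
`i`, `j`, `k` modulo `2Λ` of `m`, `n` and of the argument; `s` tells which classes `S` contains. -/
def brBar (s : ZMod 2 × ZMod 2 → Bool) (i j k : ZMod 2 × ZMod 2) : ℤ :=
  gamBar s j k * gamBar s i (j + k) - gamBar s i k * gamBar s j (i + k)

theorem JS.lie_LI_xElt (m n k : GrLat) :
    ((⁅LI (JS S) (xElt (JS S) m), LI (JS S) (xElt (JS S) n)⁆ : instrl (JS S)) :
      Module.End ℂ (JS S)) (xElt (JS S) k) =
    (brBar (sBar S) (red m) (red n) (red k) : ℂ) • xElt (JS S) (m + n + k) := by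
  rw [coe_lie_LI_apply, JS.L_xElt, JS.L_xElt, map_smul, map_smul, JS.L_xElt, JS.L_xElt, smul_smul,
    smul_smul, red_add, red_add, ← add_assoc, ← add_assoc, add_comm n m, ← sub_smul, brBar]
  push_cast
  rfl

theorem brBar_eq_zero_of_add_eq_zero : ∀ s i j k, i + j = 0 → brBar s i j k = 0 := by decide

theorem brBar_eq_zero : ∀ s i j k, s 0 = true → (¬ ∀ i, s i = true) → s (i + j) = true →
    brBar s i j k = 0 := by decide

set_option synthInstance.maxSize 1000 in
set_option synthInstance.maxHeartbeats 200000 in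
set_option maxRecDepth 100000 in
/-- A nonzero class modulo `2Λ` is, up to the order, in only one way the sum of two distinct
nonzero classes. -/
theorem brBar_proportional : ∀ s i j i' j', (s 0 && s i' && s j') = true →
    ¬ (i' = 0 ∨ j' = 0 ∨ i' = j') → i + j = i' + j' →
      ∃ c ∈ ([0, 1, -1] : List ℤ), ∀ k, brBar s i j k = c * brBar s i' j' k := by
  decide

theorem brBar_right_eq_one : ∀ s i j, s 0 = true → s i = true → s j = true → i ≠ 0 → j ≠ 0 →
    i ≠ j → brBar s i j j = 1 := by decide

theorem JS.lie_LI_eq_zero {m n : GrLat} (h : m + n ∈ twoLat) :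
    ⁅LI (JS S) (xElt (JS S) m), LI (JS S) (xElt (JS S) n)⁆ = 0 := by
  refine instrl_ext_xElt fun k => ?_
  rw [JS.lie_LI_xElt, brBar_eq_zero_of_add_eq_zero, Int.cast_zero, zero_smul]
  · rfl
  · rwa [mem_twoLat, red_add] at h

/-- When all of `m`, `n`, `m + n` lie in `S ≠ Λ`, two of their classes coincide or one is zero. -/
theorem JS.lie_LI_eq_zero_of_mem (hS : S.carrier ≠ Set.univ) {m n : GrLat}
    (h : m + n ∈ S.carrier) : ⁅LI (JS S) (xElt (JS S) m), LI (JS S) (xElt (JS S) n)⁆ = 0 := by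
  refine instrl_ext_xElt fun k => ?_
  rw [JS.lie_LI_xElt, brBar_eq_zero _ _ _ _ (sBar_zero S), Int.cast_zero, zero_smul]
  · rfl
  · exact fun hs => hS (Set.eq_univ_of_forall fun l => (sBar_red S l).1 (hs _))
  · rwa [← red_add, sBar_red]

section Pair

variable {s t : GrLat} (hs : s ∉ twoLat) (ht : t ∈ S.carrier) (ht2 : t ∉ twoLat)
  (hst : s + t ∈ S.carrier) (hst2 : s + t ∉ twoLat)

include hs ht ht2 hst hst2

theorem JS.lie_LI_ne_zero :
    ⁅LI (JS S) (xElt (JS S) (s + t)), LI (JS S) (xElt (JS S) (-t))⁆ ≠ 0 := by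
  intro h
  have h1 := JS.lie_LI_xElt (S := S) (s + t) (-t) t
  rw [h, red_neg, brBar_right_eq_one _ _ _ (sBar_zero S) ((sBar_red S _).2 hst)
    ((sBar_red S _).2 ht) (by rwa [ne_eq, ← mem_twoLat]) (by rwa [ne_eq, ← mem_twoLat])
    (by rwa [ne_eq, ← sub_eq_zero, ← red_sub, add_sub_cancel_right, ← mem_twoLat]),
    add_neg_cancel_right, Int.cast_one, one_smul] at h1
  exact xElt_ne_zero hst h1.symm

theorem JS.exists_lie_LI_eq_smul {m n : GrLat} (hmn : m + n = s) :
    ∃ c : ℂ, ⁅LI (JS S) (xElt (JS S) m), LI (JS S) (xElt (JS S) n)⁆ =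
      c • ⁅LI (JS S) (xElt (JS S) (s + t)), LI (JS S) (xElt (JS S) (-t))⁆ := by
  have key : ∀ c : ℤ, (∀ k, brBar (sBar S) (red m) (red n) k =
      c * brBar (sBar S) (red (s + t)) (red t) k) →
      ⁅LI (JS S) (xElt (JS S) m), LI (JS S) (xElt (JS S) n)⁆ =
      (c : ℂ) • ⁅LI (JS S) (xElt (JS S) (s + t)), LI (JS S) (xElt (JS S) (-t))⁆ := by
    intro c hc
    refine instrl_ext_xElt fun k => ?_
    rw [SetLike.val_smul, LinearMap.smul_apply, JS.lie_LI_xElt, JS.lie_LI_xElt, hc, red_neg, hmn,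
      add_neg_cancel_right, smul_smul]
    push_cast
    rfl
  obtain ⟨c, -, hc⟩ := brBar_proportional (sBar S) (red m) (red n) (red (s + t)) (red t)
    (by rw [sBar_zero, (sBar_red S _).2 hst, (sBar_red S _).2 ht]; rfl)
    (by
      rw [← sub_eq_zero (a := red (s + t)) (b := red t), ← red_sub, add_sub_cancel_right,
        ← mem_twoLat, ← mem_twoLat, ← mem_twoLat]
      tauto)
    (by rw [← red_neg t, ← red_add, ← red_add, hmn, add_neg_cancel_right])
  exact ⟨c, key c hc⟩

theorem JS.instrlGr_eq_span_pair : instrlGr (JS S) s = Submodule.span ℂ {LI (JS S) (xElt (JS S) s),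
    ⁅LI (JS S) (xElt (JS S) (s + t)), LI (JS S) (xElt (JS S) (-t))⁆} :=
  EllipticEALA.instrlGr_eq_span_pair (lie_mem_instrlGr (add_neg_cancel_right s t))
    fun _ _ => JS.exists_lie_LI_eq_smul hs ht ht2 hst hst2

theorem JS.rank_instrlGr_eq_two (hsS : s ∈ S.carrier) : Module.rank ℂ (instrlGr (JS S) s) = 2 := by
  rw [JS.instrlGr_eq_span_pair hs ht ht2 hst hst2]
  exact rank_span_pair_eq_two hsS (JS.lie_LI_ne_zero hs ht ht2 hst hst2) (LPart_lie_LI _ _)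

theorem JS.instrlGr_eq_span_lie (hsS : s ∉ S.carrier) : instrlGr (JS S) s = Submodule.span ℂ
    {⁅LI (JS S) (xElt (JS S) (s + t)), LI (JS S) (xElt (JS S) (-t))⁆} :=
  instrlGr_eq_span_of_notMem hsS (lie_mem_instrlGr (add_neg_cancel_right s t))
    fun _ _ => JS.exists_lie_LI_eq_smul hs ht ht2 hst hst2

end Pair

/-- If `S` misses the class of `s`, then it contains the class of `s + t` for every `t ∈ S` outside
`2Λ`, since otherwise it would not generate `Λ`. -/
theorem Semilattice.add_mem_of_notMem {s t : GrLat} (hs : s ∉ S.carrier) (ht : t ∈ S.carrier)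
    (ht2 : t ∉ twoLat) : s + t ∈ S.carrier := by
  by_contra hst
  have key : ∀ a b c : ZMod 2 × ZMod 2, ¬ (a = 0 ∨ b = 0 ∨ a = b) →
    ¬ (c = a ∨ c = a + b) → c = 0 ∨ c = b := by decide
  have hadd : ∀ b c d : ZMod 2 × ZMod 2, (c = 0 ∨ c = b) → (d = 0 ∨ d = b) →
    (c + d = 0 ∨ c + d = b) := by decide
  have hst' : red s ≠ red t := fun e => hs (mem_of_red e.symm ht)
  have hs0 : red s ≠ 0 := fun e => hs (mem_of_red (l := 0) (by rw [e]; rfl) S.zero_mem)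
  have ht0 : red t ≠ 0 := by rwa [ne_eq, ← mem_twoLat]
  have h : ∀ l ∈ AddSubgroup.closure S.carrier, red l = 0 ∨ red l = red t := by
    intro l hl
    induction hl using AddSubgroup.closure_induction with
    | mem l hl =>
      refine key (red s) (red t) (red l) (by tauto) ?_
      rintro (e | e)
      · exact hs (mem_of_red e hl)
      · exact hst (mem_of_red (by rw [e, red_add]) hl)
    | zero => left; rfl
    | add l m _ _ h h' => rw [red_add]; exact hadd _ _ _ h h'
    | neg l _ h => rwa [red_neg]
  rw [S.closure_eq] at h
  exact (h s trivial).elim hs0 hst'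

theorem Semilattice.exists_mem_notMem_twoLat {s : GrLat} (hs : s ∉ S.carrier) :
    ∃ t ∈ S.carrier, t ∉ twoLat := by
  by_contra! h
  have h1 : AddSubgroup.closure S.carrier ≤ twoLat := (AddSubgroup.closure_le _).2 h
  rw [S.closure_eq] at h1
  obtain ⟨l, rfl⟩ := h1 (AddSubgroup.mem_top s)
  have := S.add_two_smul_mem 0 S.zero_mem l
  rw [zero_add] at this
  exact hs this

theorem Semilattice.twoLat_subset {s : GrLat} (hs : s ∈ twoLat) : s ∈ S.carrier := by
  by_contra h
  obtain ⟨t, ht, ht2⟩ := Semilattice.exists_mem_notMem_twoLat h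
  rw [mem_twoLat] at hs
  exact h (mem_of_red (l := 0) (by rw [hs]; rfl) S.zero_mem)

theorem exists_notMem_twoLat (s : GrLat) : ∃ t, t ∉ twoLat ∧ s + t ∉ twoLat := by
  have h : ∀ a : ZMod 2 × ZMod 2, ¬ (1, 0) = (0 : ZMod 2 × ZMod 2) ∧ ¬ a + (1, 0) = 0 ∨
    ¬ (0, 1) = (0 : ZMod 2 × ZMod 2) ∧ ¬ a + (0, 1) = 0 := by decide
  simp only [mem_twoLat, red_add]
  rcases h (red s) with h | h
  · exact ⟨(1, 0), by simpa [red] using h⟩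
  · exact ⟨(0, 1), by simpa [red] using h⟩

theorem JS.instrlGr_eq_span_LI {s : GrLat} (h : ¬ (S.carrier = Set.univ ∧ s ∉ twoLat))
    (hs : s ∈ S.carrier) : instrlGr (JS S) s = Submodule.span ℂ {LI (JS S) (xElt (JS S) s)} := by
  refine EllipticEALA.instrlGr_eq_span_LI fun m n hmn => ?_
  subst hmn
  by_cases h2 : m + n ∈ twoLat
  · exact JS.lie_LI_eq_zero h2
  · exact JS.lie_LI_eq_zero_of_mem (fun hS => h ⟨hS, h2⟩) hs

theorem JS.instrlGr_eq_span_lie_of_notMem {s t : GrLat} (hs : s ∉ S.carrier) (ht : t ∈ S.carrier)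
    (ht2 : t ∉ twoLat) : instrlGr (JS S) s = Submodule.span ℂ
      {⁅LI (JS S) (xElt (JS S) (s + t)), LI (JS S) (xElt (JS S) (-t))⁆} ∧
    Module.rank ℂ (instrlGr (JS S) s) = 1 := by
  have hst := Semilattice.add_mem_of_notMem hs ht ht2
  have hs2 : s ∉ twoLat := fun h => hs (Semilattice.twoLat_subset h)
  have hst2 : s + t ∉ twoLat := by
    intro h
    refine hs (mem_of_red (l := t) ?_ ht)
    rw [← red_neg t, eq_comm, ← sub_eq_zero, ← red_sub, sub_neg_eq_add, ← mem_twoLat]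
    exact h
  have e := JS.instrlGr_eq_span_lie hs2 ht ht2 hst hst2 hs
  refine ⟨e, ?_⟩
  rw [e]
  exact rank_span_singleton_eq_one (JS.lie_LI_ne_zero hs2 ht ht2 hst hst2)

theorem JS.rank_instrlGr_eq_one {s : GrLat} (h : ¬ (S.carrier = Set.univ ∧ s ∉ twoLat)) :
    Module.rank ℂ (instrlGr (JS S) s) = 1 := by
  by_cases hs : s ∈ S.carrier
  · rw [JS.instrlGr_eq_span_LI h hs]
    exact rank_span_singleton_eq_one (LI_xElt_ne_zero hs)
  · obtain ⟨t, ht, ht2⟩ := Semilattice.exists_mem_notMem_twoLat hs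
    exact (JS.instrlGr_eq_span_lie_of_notMem hs ht ht2).2

theorem JS.rank_instrlGr_of_univ {s : GrLat} (hS : S.carrier = Set.univ) (hs : s ∉ twoLat) :
    Module.rank ℂ (instrlGr (JS S) s) = 2 := by
  have hmem : ∀ l, l ∈ S.carrier := fun l => hS ▸ Set.mem_univ l
  obtain ⟨t, ht, hst⟩ := exists_notMem_twoLat s
  exact JS.rank_instrlGr_eq_two hs (hmem t) ht (hmem _) hst (hmem s)

theorem JS.instrlGr_ne_bot (s : GrLat) : instrlGr (JS S) s ≠ ⊥ := by
  intro h0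
  have h1 : Module.rank ℂ (instrlGr (JS S) s) = 0 := by rw [h0, rank_bot]
  by_cases h : S.carrier = Set.univ ∧ s ∉ twoLat
  · rw [JS.rank_instrlGr_of_univ h.1 h.2] at h1
    exact two_ne_zero h1
  · rw [JS.rank_instrlGr_eq_one h] at h1
    exact one_ne_zero h1

end JS

/-! ### The plus algebras of quantum tori -/

section Quantum

variable (q : ℂˣ)

theorem QT.xElt_eq (l : GrLat) : xElt (QT q)ˢʸᵐ l = plusBasis q l := by
  rw [xElt_of_mem (Set.mem_univ l)]
  exact Module.Basis.reindex_apply _ _ _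

theorem QT.L_plusBasis (l m : GrLat) : L (QT q)ˢʸᵐ (plusBasis q l) (plusBasis q m) =
    (2⁻¹ * ((eta q l m : ℂ) + eta q m l)) • plusBasis q (l + m) := plusMul_basis q l m

theorem QT.nondegenerateForm : NondegenerateForm (QT q)ˢʸᵐ := by
  intro l _
  rw [formJ_apply, QT.xElt_eq, QT.xElt_eq, QT.L_plusBasis, add_neg_cancel, map_smul,
    ← QT.xElt_eq, eps_xElt_zero, eta, eta, show l.2 * (-l).1 = (-l).2 * l.1 by simp [mul_comm],
    ← two_mul, smul_eq_mul, mul_one, inv_mul_cancel_left₀ two_ne_zero]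
  exact Units.ne_zero _

/-- Both sides are multiples of the commutator with `x^{m + n}`: with `l` and `r` for left and right
multiplications, `L_{x^m} = (l_m + r_m) / 2` and
`[L_{x^m}, L_{x^n}] = ([l_m, l_n] + [r_m, r_n]) / 4`. -/
theorem QT.lie_L_plusBasis (m n : GrLat) :
    ⁅L (QT q)ˢʸᵐ (plusBasis q m), L (QT q)ˢʸᵐ (plusBasis q n)⁆ =
      (2⁻¹ * ((eta q m n : ℂ) - eta q n m)) •
        (L (QT q)ˢʸᵐ (plusBasis q (m + n)) - rMul q (m + n)) := by
  refine (plusBasis q).ext fun k => ?_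
  simp only [LieRing.of_associative_ring_bracket, LinearMap.sub_apply, Module.End.mul_apply,
    LinearMap.smul_apply, QT.L_plusBasis, map_smul, rMul_basis, smul_smul]
  rw [show n + (m + k) = m + n + k by abel, show m + (n + k) = m + n + k by abel,
    show k + (m + n) = m + n + k by abel, ← sub_smul, ← sub_smul, smul_smul]
  congr 1
  simp only [eta_add_left, eta_add_right, Units.val_mul]
  ring

theorem QT.L_sub_rMul_apply (s k : GrLat) : (L (QT q)ˢʸᵐ (plusBasis q s) - rMul q s)
    (plusBasis q k) = (2⁻¹ * ((eta q s k : ℂ) - eta q k s)) • plusBasis q (s + k) := by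
  rw [LinearMap.sub_apply, QT.L_plusBasis, rMul_basis, add_comm k s, ← sub_smul]
  congr 1
  ring

theorem commFactor_eq_one_iff (l m : GrLat) : commFactor q l m = 1 ↔ eta q l m = eta q m l :=
  mul_inv_eq_one

theorem QT.instrlGr_of_mem_radF {s : GrLat} (hs : s ∈ radF q) :
    instrlGr (QT q)ˢʸᵐ s = Submodule.span ℂ {LI (QT q)ˢʸᵐ (xElt (QT q)ˢʸᵐ s)} := by
  refine instrlGr_eq_span_LI fun m n hmn => Subtype.ext ?_
  have h1 : eta q m n = eta q n m := by
    have := (commFactor_eq_one_iff q s n).1 (hs n)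
    rw [← hmn, eta_add_left, eta_add_right] at this
    exact mul_right_cancel this
  rw [QT.xElt_eq, QT.xElt_eq, LieSubalgebra.coe_bracket, coe_LI, coe_LI, QT.lie_L_plusBasis, h1,
    sub_self, mul_zero, zero_smul]
  rfl

theorem QT.exists_instrlGr_of_notMem_radF {s : GrLat} (hs : s ∉ radF q) :
    ∃ R : instrl (QT q)ˢʸᵐ,
      (R : Module.End ℂ (QT q)ˢʸᵐ) = L (QT q)ˢʸᵐ (xElt (QT q)ˢʸᵐ s) - rMul q s ∧
      instrlGr (QT q)ˢʸᵐ s = Submodule.span ℂ {LI (QT q)ˢʸᵐ (xElt (QT q)ˢʸᵐ s), R} ∧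
      Module.rank ℂ (instrlGr (QT q)ˢʸᵐ s) = 2 := by
  -- with `f(s, n) ≠ 1`, the operator is a multiple of `[L_{x^{s - n}}, L_{x^n}]`
  obtain ⟨n, hn⟩ : ∃ n, commFactor q s n ≠ 1 := by simpa [radF] using hs
  rw [ne_eq, commFactor_eq_one_iff] at hn
  have hsn : (2⁻¹ * ((eta q s n : ℂ) - eta q n s)) ≠ 0 :=
    mul_ne_zero (inv_ne_zero two_ne_zero) (sub_ne_zero.2 fun e => hn (Units.ext e))
  have hc : (2⁻¹ * ((eta q (s - n) n : ℂ) - eta q n (s - n))) ≠ 0 := by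
    refine mul_ne_zero (inv_ne_zero two_ne_zero) (sub_ne_zero.2 fun e => hn ?_)
    rw [← sub_add_cancel s n, eta_add_left, eta_add_right, Units.ext e]
  set c := (2⁻¹ * ((eta q (s - n) n : ℂ) - eta q n (s - n))) with hcdef
  set B := ⁅LI (QT q)ˢʸᵐ (xElt (QT q)ˢʸᵐ (s - n)), LI (QT q)ˢʸᵐ (xElt (QT q)ˢʸᵐ n)⁆ with hB
  have hR : ((c⁻¹ • B : instrl (QT q)ˢʸᵐ) : Module.End ℂ (QT q)ˢʸᵐ) =
      L (QT q)ˢʸᵐ (xElt (QT q)ˢʸᵐ s) - rMul q s := by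
    rw [SetLike.val_smul, hB, LieSubalgebra.coe_bracket, coe_LI, coe_LI, QT.xElt_eq, QT.xElt_eq,
      QT.xElt_eq, QT.lie_L_plusBasis, ← hcdef, smul_smul, inv_mul_cancel₀ hc, one_smul,
      sub_add_cancel]
  have e : instrlGr (QT q)ˢʸᵐ s =
      Submodule.span ℂ {LI (QT q)ˢʸᵐ (xElt (QT q)ˢʸᵐ s), c⁻¹ • B} := by
    refine instrlGr_eq_span_pair
      (Submodule.smul_mem _ _ (lie_mem_instrlGr (sub_add_cancel s n))) fun m n hmn =>
        ⟨2⁻¹ * ((eta q m n : ℂ) - eta q n m), Subtype.ext ?_⟩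
    rw [SetLike.val_smul, hR, QT.xElt_eq, QT.xElt_eq, QT.xElt_eq, LieSubalgebra.coe_bracket,
      coe_LI, coe_LI, QT.lie_L_plusBasis, hmn]
  refine ⟨c⁻¹ • B, hR, e, ?_⟩
  rw [e]
  refine rank_span_pair_eq_two (Set.mem_univ s) (fun h0 => ?_) ?_
  · rw [h0, QT.xElt_eq] at hR
    have h1 := QT.L_sub_rMul_apply q s n
    rw [← hR] at h1
    exact smul_ne_zero hsn ((plusBasis q).ne_zero _) h1.symm
  · rw [map_smul, hB, LPart_lie_LI, smul_zero]

theorem QT.rank_instrlGr_of_mem_radF {s : GrLat} (hs : s ∈ radF q) :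
    Module.rank ℂ (instrlGr (QT q)ˢʸᵐ s) = 1 := by
  rw [QT.instrlGr_of_mem_radF q hs]
  exact rank_span_singleton_eq_one (LI_xElt_ne_zero (Set.mem_univ s))

theorem QT.instrlGr_ne_bot (s : GrLat) : instrlGr (QT q)ˢʸᵐ s ≠ ⊥ := fun h =>
  LI_xElt_ne_zero (Set.mem_univ s) ((Submodule.mem_bot ℂ).1 (h ▸ LI_xElt_mem s))

end Quantum

/-! ### Hermitian elements of elementary quantum tori -/

section Hermitian

variable (ε : ℤˣ)

theorem Herm.coe_xElt {l : GrLat} (hl : l ∈ hermSupp ε) :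
    (xElt (Herm ε) l : (QT (sgn ε))ˢʸᵐ) = plusBasis (sgn ε) l := by
  rw [xElt_of_mem (J := Herm ε) hl]
  exact hermBasis_coe ε ⟨l, hl⟩

theorem Herm.coe_L (a b : Herm ε) : ((L (Herm ε) a b : Herm ε) : (QT (sgn ε))ˢʸᵐ) =
    L (QT (sgn ε))ˢʸᵐ a b := rfl

theorem Herm.eps_eq (a : Herm ε) : eps (Herm ε) a = eps (QT (sgn ε))ˢʸᵐ a := by
  change (hermBasis ε).repr a ⟨0, _⟩ = _
  rw [hermBasis_repr]
  rfl

theorem Herm.nondegenerateForm : NondegenerateForm (Herm ε) := by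
  intro l hl
  have hl' : -l ∈ hermSupp ε := by
    change sgn ε ^ ((-l).1 * (-l).2) = 1
    rw [Prod.fst_neg, Prod.snd_neg, neg_mul_neg]
    exact hl
  have := QT.nondegenerateForm (sgn ε) l (Set.mem_univ l)
  rw [formJ_apply, QT.xElt_eq, QT.xElt_eq] at this
  rwa [formJ_apply, Herm.eps_eq, Herm.coe_L, Herm.coe_xElt ε hl, Herm.coe_xElt ε hl']

/-- The brackets are restrictions of those of the plus algebra of `ℂ_𝐞`. -/
theorem Herm.coe_lie_LI_apply {m n : GrLat} (hm : m ∈ hermSupp ε) (hn : n ∈ hermSupp ε)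
    (a : Herm ε) :
    ((((⁅LI (Herm ε) (xElt (Herm ε) m), LI (Herm ε) (xElt (Herm ε) n)⁆ : instrl (Herm ε)) :
      Module.End ℂ (Herm ε)) a : Herm ε) : (QT (sgn ε))ˢʸᵐ) =
    (2⁻¹ * ((eta (sgn ε) m n : ℂ) - eta (sgn ε) n m)) •
        (L (QT (sgn ε))ˢʸᵐ (plusBasis (sgn ε) (m + n)) - rMul (sgn ε) (m + n))
          (a : (QT (sgn ε))ˢʸᵐ) := by
  rw [← LinearMap.smul_apply, ← QT.lie_L_plusBasis, EllipticEALA.coe_lie_LI_apply,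
    Submodule.coe_sub, Herm.coe_L, Herm.coe_L, Herm.coe_L, Herm.coe_L, Herm.coe_xElt ε hm,
    Herm.coe_xElt ε hn]
  rfl

theorem Herm.lie_LI_of_notMem {m n : GrLat} (h : ¬ (m ∈ hermSupp ε ∧ n ∈ hermSupp ε)) :
    ⁅LI (Herm ε) (xElt (Herm ε) m), LI (Herm ε) (xElt (Herm ε) n)⁆ = 0 := by
  rw [not_and_or] at h
  rcases h with h | h
  · rw [xElt_of_notMem (J := Herm ε) h, map_zero, zero_lie]
  · rw [xElt_of_notMem (J := Herm ε) h, map_zero, lie_zero]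

theorem mem_hermSupp_iff_even (l : GrLat) : l ∈ hermSupp ε ↔ ε = 1 ∨ Even (l.1 * l.2) := by
  change sgn ε ^ (l.1 * l.2) = 1 ↔ _
  rcases Int.units_eq_one_or ε with rfl | rfl
  · simp [sgn]
  · have h1 : sgn (-1) = -1 := by ext; simp [sgn]
    rw [h1]
    rcases Int.even_or_odd (l.1 * l.2) with h | h
    · simp [h.neg_zpow, h]
    · have h2 : (-1 : ℂˣ) ≠ 1 := fun e => by
        have := congrArg Units.val e
        norm_num at this
      have h3 : (-1 : ℤˣ) ≠ 1 := by decide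
      simp only [h.neg_zpow, one_zpow, h2, h3, Int.not_even_iff_odd.2 h, or_self]

theorem mem_twoLat_iff_even (m : GrLat) : m ∈ twoLat ↔ Even m.1 ∧ Even m.2 := by
  rw [mem_twoLat, red, Prod.mk_eq_zero, ZMod.intCast_eq_zero_iff_even,
    ZMod.intCast_eq_zero_iff_even]

theorem mem_hermSupp_iff (l : GrLat) : l ∈ hermSupp ε ↔
    (ε = 1 ∨ l ∈ twoLat ∨ l - (1, 0) ∈ twoLat ∨ l - (0, 1) ∈ twoLat) := by
  rw [mem_hermSupp_iff_even, mem_twoLat_iff_even, mem_twoLat_iff_even, mem_twoLat_iff_even,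
    Int.even_mul]
  simp only [Prod.fst_sub, Prod.snd_sub, Int.even_sub, Int.not_even_one, Even.zero, iff_true,
    iff_false]
  tauto

/-- If `m`, `n` and `m + n` lie in the support, then `x^m` and `x^n` commute in `ℂ_𝐞`. -/
theorem Herm.instrlGr_of_mem {s : GrLat} (hs : s ∈ hermSupp ε) :
    instrlGr (Herm ε) s = Submodule.span ℂ {LI (Herm ε) (xElt (Herm ε) s)} := by
  refine instrlGr_eq_span_LI fun m n hmn => ?_
  by_cases h : m ∈ hermSupp ε ∧ n ∈ hermSupp ε
  · obtain ⟨hm, hn⟩ := h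
    -- `q^{l₁ l₂} = 1` for the three degrees gives `η(m, n) η(n, m) = 1`, and both are `±1`
    have h1 : eta (sgn ε) m n = eta (sgn ε) n m := by
      rw [← hmn] at hs
      have e : sgn ε ^ ((m + n).1 * (m + n).2) = sgn ε ^ (m.1 * m.2) * sgn ε ^ (n.1 * n.2) *
          (eta (sgn ε) m n * eta (sgn ε) n m) := by
        rw [eta, eta, ← zpow_add, ← zpow_add, ← zpow_add, Prod.fst_add, Prod.snd_add]
        congr 1
        ring
      have hmn' : eta (sgn ε) m n * eta (sgn ε) n m = 1 := by
        rwa [hm, hn, one_mul, one_mul, show sgn ε ^ ((m + n).1 * (m + n).2) = 1 from hs,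
          eq_comm] at e
      exact mul_right_cancel (hmn'.trans (sgn_zpow_mul_self ε _).symm)
    refine Subtype.ext (LinearMap.ext fun a => Subtype.ext ?_)
    rw [Herm.coe_lie_LI_apply ε hm hn, h1, sub_self, mul_zero, zero_smul]
    rfl
  · exact Herm.lie_LI_of_notMem ε h

theorem Herm.instrlGr_of_notMem {s : GrLat} (hs : s ∉ hermSupp ε) :
    instrlGr (Herm ε) s = Submodule.span ℂ
      {⁅LI (Herm ε) (xElt (Herm ε) (s + (1, 0))), LI (Herm ε) (xElt (Herm ε) (-(1, 0)))⁆} ∧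
    Module.rank ℂ (instrlGr (Herm ε) s) = 1 := by
  have hn : -(1, 0) ∈ hermSupp ε := by simp [hermSupp]
  have h10 : (1, 0) ∈ hermSupp ε := by simp [hermSupp]
  have hm : s + (1, 0) ∈ hermSupp ε := by
    rw [mem_hermSupp_iff_even, Int.even_mul] at hs ⊢
    rw [Prod.fst_add, Int.even_add_one]
    tauto
  have hq : sgn ε ^ s.2 ≠ 1 := by
    intro h
    refine hs ?_
    change sgn ε ^ (s.1 * s.2) = 1
    rw [mul_comm, zpow_mul, h, one_zpow]
  set R := ⁅LI (Herm ε) (xElt (Herm ε) (s + (1, 0))), LI (Herm ε) (xElt (Herm ε) (-(1, 0)))⁆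
    with hRdef
  set c : ℂ := 2⁻¹ * ((eta (sgn ε) (s + (1, 0)) (-(1, 0)) : ℂ) -
    eta (sgn ε) (-(1, 0)) (s + (1, 0))) with hc
  have hc0 : c ≠ 0 := by
    refine mul_ne_zero (inv_ne_zero two_ne_zero) (sub_ne_zero.2 fun e => hq ?_)
    simpa [eta] using Units.ext e
  have hR : ∀ a : Herm ε, (((R : Module.End ℂ (Herm ε)) a : Herm ε) : (QT (sgn ε))ˢʸᵐ) =
      c • (L (QT (sgn ε))ˢʸᵐ (plusBasis (sgn ε) s) - rMul (sgn ε) s) (a : (QT (sgn ε))ˢʸᵐ) := by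
    intro a
    rw [hRdef, Herm.coe_lie_LI_apply ε hm hn, add_neg_cancel_right]
  have hR0 : R ≠ 0 := by
    intro h0
    have h1 := hR (xElt (Herm ε) (1, 0))
    rw [h0, Herm.coe_xElt ε h10, QT.L_sub_rMul_apply] at h1
    refine smul_ne_zero hc0 (smul_ne_zero (mul_ne_zero (inv_ne_zero two_ne_zero)
      (sub_ne_zero.2 fun e => hq ?_)) ((plusBasis (sgn ε)).ne_zero _)) h1.symm
    simpa [eta] using Units.ext e
  have e : instrlGr (Herm ε) s = Submodule.span ℂ {R} := by
    refine instrlGr_eq_span_of_notMem hs (lie_mem_instrlGr (add_neg_cancel_right _ _))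
      fun m n hmn => ?_
    by_cases h : m ∈ hermSupp ε ∧ n ∈ hermSupp ε
    · refine ⟨2⁻¹ * ((eta (sgn ε) m n : ℂ) - eta (sgn ε) n m) * c⁻¹,
        Subtype.ext (LinearMap.ext fun a => Subtype.ext ?_)⟩
      rw [Herm.coe_lie_LI_apply ε h.1 h.2, SetLike.val_smul, LinearMap.smul_apply,
        SetLike.val_smul, hR, smul_smul, inv_mul_cancel_right₀ hc0, hmn]
    · exact ⟨0, by rw [Herm.lie_LI_of_notMem ε h, zero_smul]⟩
  refine ⟨e, ?_⟩
  rw [e]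
  exact rank_span_singleton_eq_one hR0

theorem Herm.rank_instrlGr (s : GrLat) : Module.rank ℂ (instrlGr (Herm ε) s) = 1 := by
  by_cases hs : s ∈ hermSupp ε
  · rw [Herm.instrlGr_of_mem ε hs]
    exact rank_span_singleton_eq_one (LI_xElt_ne_zero (J := Herm ε) hs)
  · exact (Herm.instrlGr_of_notMem ε hs).2

theorem Herm.instrlGr_ne_bot (s : GrLat) : instrlGr (Herm ε) s ≠ ⊥ := by
  intro h
  have := Herm.rank_instrlGr ε s
  rw [h, rank_bot] at this
  exact zero_ne_one this

end Hermitian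

end EllipticEALA

end

/-! ### Root spaces for the three families -/

theorem mainTheorem1 :
    (∀ (S : Semilattice) (P : Permissible (JS S)) (K : AffineCocycle P),
      Function.Injective (EALA.latticeRoot K) ∧
      EALA.isotropicRoots K = Set.range (EALA.latticeRoot K) ∧
      ∀ σ : GrLat, σ ≠ 0 →
        ((S.carrier = Set.univ ∧ σ ∉ twoLat) →
          (Module.rank ℂ (EALA.Egr K σ) =
              2 + Module.rank ℂ (P.Dgr σ) + Module.rank ℂ (P.Cgr σ) ∧
            2 ≤ Module.rank ℂ (EALA.Egr K σ) ∧ Module.rank ℂ (EALA.Egr K σ) ≤ 4 ∧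
            ∀ τ : GrLat, τ ∉ twoLat → σ + τ ∉ twoLat →
              EALA.Egr K σ =
                Submodule.span ℂ {EALA.Lx K σ, EALA.brLx K σ τ} ⊔ EALA.DC K σ)) ∧
        (¬ (S.carrier = Set.univ ∧ σ ∉ twoLat) →
          (Module.rank ℂ (EALA.Egr K σ) =
              1 + Module.rank ℂ (P.Dgr σ) + Module.rank ℂ (P.Cgr σ) ∧
            1 ≤ Module.rank ℂ (EALA.Egr K σ) ∧ Module.rank ℂ (EALA.Egr K σ) ≤ 3 ∧
            (σ ∈ S.carrier →
              EALA.Egr K σ = Submodule.span ℂ {EALA.Lx K σ} ⊔ EALA.DC K σ) ∧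
            (σ ∉ S.carrier → ∀ τ ∈ S.carrier, τ ∉ twoLat →
              EALA.Egr K σ = Submodule.span ℂ {EALA.brLx K σ τ} ⊔ EALA.DC K σ)))) ∧
    (∀ (q : ℂˣ) (P : Permissible (QT q)ˢʸᵐ) (K : AffineCocycle P),
      Function.Injective (EALA.latticeRoot K) ∧
      EALA.isotropicRoots K = Set.range (EALA.latticeRoot K) ∧
      ∀ σ : GrLat, σ ≠ 0 →
        (σ ∉ radF q →
          (Module.rank ℂ (EALA.Egr K σ) =
              2 + Module.rank ℂ (P.Dgr σ) + Module.rank ℂ (P.Cgr σ) ∧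
            2 ≤ Module.rank ℂ (EALA.Egr K σ) ∧ Module.rank ℂ (EALA.Egr K σ) ≤ 4 ∧
            ∃ R : instrl (QT q)ˢʸᵐ,
              (R : Module.End ℂ (QT q)ˢʸᵐ) =
                L (QT q)ˢʸᵐ (xElt (QT q)ˢʸᵐ σ) - rMul q σ ∧
              EALA.Egr K σ =
                Submodule.span ℂ {EALA.Lx K σ, EALA.inI K R} ⊔ EALA.DC K σ)) ∧
        (σ ∈ radF q →
          (Module.rank ℂ (EALA.Egr K σ) =
              1 + Module.rank ℂ (P.Dgr σ) + Module.rank ℂ (P.Cgr σ) ∧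
            1 ≤ Module.rank ℂ (EALA.Egr K σ) ∧ Module.rank ℂ (EALA.Egr K σ) ≤ 3 ∧
            EALA.Egr K σ = Submodule.span ℂ {EALA.Lx K σ} ⊔ EALA.DC K σ))) ∧
    (∀ (ε : ℤˣ) (P : Permissible (Herm ε)) (K : AffineCocycle P),
      Function.Injective (EALA.latticeRoot K) ∧
      EALA.isotropicRoots K = Set.range (EALA.latticeRoot K) ∧
      ∀ σ : GrLat, σ ≠ 0 →
        Module.rank ℂ (EALA.Egr K σ) =
            1 + Module.rank ℂ (P.Dgr σ) + Module.rank ℂ (P.Cgr σ) ∧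
        1 ≤ Module.rank ℂ (EALA.Egr K σ) ∧ Module.rank ℂ (EALA.Egr K σ) ≤ 3 ∧
        ((ε = 1 ∨ σ ∈ twoLat ∨ σ - (1, 0) ∈ twoLat ∨ σ - (0, 1) ∈ twoLat) →
          EALA.Egr K σ = Submodule.span ℂ {EALA.Lx K σ} ⊔ EALA.DC K σ) ∧
        (¬ (ε = 1 ∨ σ ∈ twoLat ∨ σ - (1, 0) ∈ twoLat ∨ σ - (0, 1) ∈ twoLat) →
          EALA.Egr K σ = Submodule.span ℂ {EALA.brLx K σ (1, 0)} ⊔ EALA.DC K σ)) := by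
  have h22 : (2 : Cardinal) + 2 = 4 := by norm_num
  have h12 : (1 : Cardinal) + 2 = 3 := by norm_num
  refine ⟨fun S P K => ⟨EALA.latticeRoot_injective,
    EALA.isotropicRoots_eq JS.nondegenerateForm JS.instrlGr_ne_bot, fun σ hσ => ⟨?_, ?_⟩⟩,
    fun q P K => ⟨EALA.latticeRoot_injective,
    EALA.isotropicRoots_eq (QT.nondegenerateForm q) (QT.instrlGr_ne_bot q), fun σ hσ => ⟨?_, ?_⟩⟩,
    fun ε P K => ⟨EALA.latticeRoot_injective,
    EALA.isotropicRoots_eq (Herm.nondegenerateForm ε) (Herm.instrlGr_ne_bot ε), fun σ hσ => ?_⟩⟩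
  · rintro ⟨hS, hσ2⟩
    have hmem : ∀ l, l ∈ S.carrier := fun l => hS ▸ Set.mem_univ l
    obtain ⟨h1, h2, h3⟩ := EALA.rank_Egr_bounds (K := K) JS.nondegenerateForm hσ
      (JS.rank_instrlGr_of_univ hS hσ2)
    refine ⟨h1, h2, h22 ▸ h3, fun τ hτ hστ => ?_⟩
    rw [EALA.Egr_eq_of_instrlGr_eq JS.nondegenerateForm
      (JS.instrlGr_eq_span_pair hσ2 (hmem τ) hτ (hmem _) hστ), Set.image_pair]
    rfl
  · intro h
    obtain ⟨h1, h2, h3⟩ := EALA.rank_Egr_bounds (K := K) JS.nondegenerateForm hσ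
      (JS.rank_instrlGr_eq_one h)
    refine ⟨h1, h2, h12 ▸ h3, fun hσS => ?_, fun hσS τ hτ hτ2 => ?_⟩
    · rw [EALA.Egr_eq_of_instrlGr_eq JS.nondegenerateForm (JS.instrlGr_eq_span_LI h hσS),
        Set.image_singleton]
      rfl
    · rw [EALA.Egr_eq_of_instrlGr_eq JS.nondegenerateForm
        (JS.instrlGr_eq_span_lie_of_notMem hσS hτ hτ2).1, Set.image_singleton]
      rfl
  · intro h
    obtain ⟨R, hR, hspan, hrank⟩ := QT.exists_instrlGr_of_notMem_radF q h
    obtain ⟨h1, h2, h3⟩ := EALA.rank_Egr_bounds (K := K) (QT.nondegenerateForm q) hσ hrank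
    refine ⟨h1, h2, h22 ▸ h3, R, hR, ?_⟩
    rw [EALA.Egr_eq_of_instrlGr_eq (QT.nondegenerateForm q) hspan, Set.image_pair]
    rfl
  · intro h
    obtain ⟨h1, h2, h3⟩ := EALA.rank_Egr_bounds (K := K) (QT.nondegenerateForm q) hσ
      (QT.rank_instrlGr_of_mem_radF q h)
    refine ⟨h1, h2, h12 ▸ h3, ?_⟩
    rw [EALA.Egr_eq_of_instrlGr_eq (QT.nondegenerateForm q) (QT.instrlGr_of_mem_radF q h),
      Set.image_singleton]
    rfl
  · obtain ⟨h1, h2, h3⟩ := EALA.rank_Egr_bounds (K := K) (Herm.nondegenerateForm ε) hσ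
      (Herm.rank_instrlGr ε σ)
    rw [← mem_hermSupp_iff]
    refine ⟨h1, h2, h12 ▸ h3, fun h => ?_, fun h => ?_⟩
    · rw [EALA.Egr_eq_of_instrlGr_eq (Herm.nondegenerateForm ε) (Herm.instrlGr_of_mem ε h),
        Set.image_singleton]
      rfl
    · rw [EALA.Egr_eq_of_instrlGr_eq (Herm.nondegenerateForm ε) (Herm.instrlGr_of_notMem ε h).1,
        Set.image_singleton]
      rfl
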